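/- Let $b\in\mathbb R$ and consider the $b$-Novikov equation $$u_t-u_{xxt}+(b+1)u^2u_x=b\,uu_xu_{xx}+u^2u_{xxx}$$ and its peakon $u(t,x)=\varphi(x-t)$, $\varphi(\xi)=e^{-|\xi|}$ (wave speed normalized to $1$ by scaling). Write $\varphi'(\xi)=-\operatorname{sgn}(\xi)e^{-|\xi|}$, $(f*g)(\xi)=\int_{\mathbb R}f(\xi-\eta)g(\eta)\,d\eta$, $\langle f,g\rangle=\int_{\mathbb R}fg$, and $$Q(v)=(b-3)\big[\varphi*\big((\varphi^2)'v\big)-2\,\varphi'*(\varphi^2v)\big],\qquad Lv=(1-\varphi^2)v'+(4-b)\varphi\varphi'v+Q(v).$$ The linearization of the equation at the peakon, in the frame modulated so that it follows the peak, is $v_t=A_bv$ with the operator $$A_bv=(1-\varphi^2)v'+(b-4)\big(v(0)-\varphi v\big)\varphi'+Q(v),\qquad \mathrm{Dom}(A_b)=\{v\in H^1(\mathbb R):(1-\varphi^2)v'\in H^1(\mathbb R)\}$$ on the complex space $H^1(\mathbb R)$. For the reduced perturbation $\tilde v=v-v(0)\varphi$ it becomes $\tilde v_t=\tilde L_b\tilde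 v$ with the operator $$\tilde L_b\tilde v=L\tilde v-4(b-3)\langle\varphi^2\varphi',\tilde v\rangle\varphi,\qquad \mathrm{Dom}(\tilde L_b)=\{v\in\widetilde H^1:(1-\varphi^2)v'\in\widetilde H^1\}$$ on $\widetilde H^1=\{v\in H^1(\mathbb R):v(0)=0\}$. A point $z\in\mathbb C$ is in the resolvent set of an operator $T$ with domain $\mathrm{Dom}(T)$ in $X$ if $T-z:\mathrm{Dom}(T)\to X$ is bijective with bounded inverse; the spectrum $\sigma(T)$ is the complement of the resolvent set. The peakon is called spectrally stable on $\widetilde H^1$ (respectively on $H^1(\mathbb R)$) if $\sigma(\tilde L_b)$ (respectively $\sigma(A_b)$) is contained in $\{z:\operatorname{Re}z\le0\}$. **Theorem.** The peakon of the $b$-Novikov equation is spectrally stable on $\widetilde H^1$ if and only if $b=3$ (the Novikov equation), and it is spectrally stable on $H^1(\mathbb R)$ if and only if $b=3$. For $b=3$ the spectra are the whole imaginary axis: $\sigma(\tilde L_3)=\sigma(A_3)=i\mathbb R$. -/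

import Mathlib

open MeasureTheory Set

namespace BNovikov

noncomputable section

/-! ### The Sobolev space `H¹(ℝ)` -/

/-- `g` is the weak derivative of `v`, where `v` is the (locally absolutely) continuous
representative of its class: `v(y) - v(x) = ∫_x^y g`. -/
def IsWeakDeriv (v g : ℝ → ℂ) : Prop :=
  LocallyIntegrable g volume ∧ ∀ x y : ℝ, ∫ t in x..y, g t = v y - v x

/-- The complex Sobolev space `H¹(ℝ)`: the square integrable functions with square integrable weak
derivative. Each class is represented by its unique continuous representative, so that point values
make sense and equality in `H¹` is equality of functions. -/
def H1 : Submodule ℂ (ℝ → ℂ) where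
  carrier := {v | MemLp v 2 volume ∧ ∃ g : ℝ → ℂ, MemLp g 2 volume ∧ IsWeakDeriv v g}
  zero_mem' := ⟨MemLp.zero, 0, MemLp.zero, by
    refine ⟨(MemLp.zero (ε := ℂ) (p := 2)).locallyIntegrable (by norm_num), ?_⟩
    intro x y; simp⟩
  add_mem' := by
    rintro v w ⟨hv, g, hg, hgl, hgi⟩ ⟨hw, k, hk, hkl, hki⟩
    refine ⟨hv.add hw, g + k, hg.add hk, hgl.add hkl, fun x y => ?_⟩
    have h := intervalIntegral.integral_add (μ := volume) (a := x) (b := y)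
      (hgl.integrableOn_isCompact isCompact_uIcc).intervalIntegrable
      (hkl.integrableOn_isCompact isCompact_uIcc).intervalIntegrable
    simp only [Pi.add_apply]
    rw [h, hgi, hki]; ring
  smul_mem' := by
    rintro c v ⟨hv, g, hg, hgl, hgi⟩
    refine ⟨hv.const_smul c, c • g, hg.const_smul c, hgl.smul c, fun x y => ?_⟩
    simp only [Pi.smul_apply, intervalIntegral.integral_smul, hgi, smul_sub]

/-- The `H¹` norm `(‖v‖²_{L²} + ‖v'‖²_{L²})^{1/2}`; the classical derivative of a function of `H¹`
exists almost everywhere and agrees almost everywhere with the weak derivative. -/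
def h1Norm (v : ℝ → ℂ) : ℝ :=
  Real.sqrt ((∫ x, ‖v x‖ ^ 2) + ∫ x, ‖deriv v x‖ ^ 2)

/-- The subspace `{v ∈ H¹(ℝ) : v(0) = 0}`. -/
def H1zero : Submodule ℂ (ℝ → ℂ) where
  carrier := {v | v ∈ H1 ∧ v 0 = 0}
  zero_mem' := ⟨H1.zero_mem, rfl⟩
  add_mem' := by
    rintro v w ⟨hv, hv0⟩ ⟨hw, hw0⟩
    exact ⟨H1.add_mem hv hw, by simp [hv0, hw0]⟩
  smul_mem' := by
    rintro c v ⟨hv, hv0⟩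
    exact ⟨H1.smul_mem c hv, by simp [hv0]⟩

/-! ### The peakon and the linearized operators -/

/-- The profile `φ(ξ) = e^{-|ξ|}` of the peakon `u(t, x) = φ(x - t)`. -/
def φ (x : ℝ) : ℝ := Real.exp (-|x|)

/-- The piecewise continuous derivative `φ'(ξ) = -sgn(ξ) e^{-|ξ|}` (with the value `0` at the
peak). -/
def dφ (x : ℝ) : ℝ := -(Real.sign x) * Real.exp (-|x|)

/-- The convolution `(f * g)(x) = ∫ f(x - y) g(y) dy`. -/
def conv (f : ℝ → ℝ) (g : ℝ → ℂ) (x : ℝ) : ℂ := ∫ y, (f (x - y) : ℂ) * g y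

/-- `Q(v) = (b - 3) [φ * ((φ²)' v) - 2 φ' * (φ² v)]`, where `(φ²)' = 2 φ φ'`. -/
def Q (b : ℝ) (v : ℝ → ℂ) (x : ℝ) : ℂ :=
  ((b : ℂ) - 3) * (conv φ (fun y => ((2 * φ y * dφ y : ℝ) : ℂ) * v y) x
    - 2 * conv dφ (fun y => ((φ y ^ 2 : ℝ) : ℂ) * v y) x)

/-- `(1 - φ²) v'`. For `v ∈ H¹` this is a function of `H¹` (up to a null set) exactly if
it is one pointwise: `v` is then `C¹` off the origin, where the coefficient vanishes. -/
def transport (v : ℝ → ℂ) (x : ℝ) : ℂ := ((1 - φ x ^ 2 : ℝ) : ℂ) * deriv v x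

/-- The right-hand side of the linearized equation
`v_t = (1 - φ²) v' + (b - 4) (v(0) - φ v) φ' + Q(v)`. -/
def linFull (b : ℝ) (v : ℝ → ℂ) (x : ℝ) : ℂ :=
  transport v x + ((b : ℂ) - 4) * (v 0 - (φ x : ℂ) * v x) * (dφ x : ℂ) + Q b v x

/-- `L v = (1 - φ²) v' + (4 - b) φ φ' v + Q(v)`. -/
def L (b : ℝ) (v : ℝ → ℂ) (x : ℝ) : ℂ :=
  transport v x + (4 - (b : ℂ)) * ((φ x * dφ x : ℝ) : ℂ) * v x + Q b v x

/-- The right-hand side `L v - 4 (b - 3) ⟨φ² φ', v⟩ φ` of the linearized equation for perturbations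
that vanish at the peak. -/
def linRed (b : ℝ) (v : ℝ → ℂ) (x : ℝ) : ℂ :=
  L b v x - 4 * ((b : ℂ) - 3) * (∫ y, ((φ y ^ 2 * dφ y : ℝ) : ℂ) * v y) * (φ x : ℂ)

/-! ### Both operators act in the respective space

The lemmas of this section are used only to construct the operators below. -/

theorem H1.continuous {v : ℝ → ℂ} (hv : v ∈ H1) : Continuous v := by
  obtain ⟨-, g, -, hgl, hgi⟩ := hv
  have h : v = fun y => v 0 + ∫ t in (0 : ℝ)..y, g t := by
    funext y; rw [hgi]; ring
  rw [h]
  exact continuous_const.add (intervalIntegral.continuous_primitive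
    (fun a b => (hgl.integrableOn_isCompact isCompact_uIcc).intervalIntegrable) 0)

theorem H1.deriv_ae {v g : ℝ → ℂ} (h : IsWeakDeriv v g) : deriv v =ᵐ[volume] g := by
  filter_upwards [LocallyIntegrable.ae_hasDerivAt_integral h.1] with x hx
  have h' : v = fun y => v 0 + ∫ t in (0 : ℝ)..y, g t := by
    funext y; rw [h.2]; ring
  have := (hx 0).const_add (v 0)
  rw [← h'] at this
  exact this.deriv

theorem H1.memLp_deriv {v : ℝ → ℂ} (hv : v ∈ H1) : MemLp (deriv v) 2 volume := by
  obtain ⟨-, g, hg, h⟩ := hv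
  exact hg.ae_eq (H1.deriv_ae h).symm

theorem φ_continuous : Continuous φ := by unfold φ; fun_prop

theorem one_sub_φ_sq_ne {x : ℝ} (hx : x ≠ 0) : ((1 - φ x ^ 2 : ℝ) : ℂ) ≠ 0 := by
  have h1 : φ x < 1 := by
    unfold φ; rw [Real.exp_lt_one_iff]; simpa using hx
  have h0 : 0 < φ x := Real.exp_pos _
  have : (1 - φ x ^ 2 : ℝ) ≠ 0 := by nlinarith
  exact_mod_cast this

theorem H1.hasDerivAt {v : ℝ → ℂ} (hv : v ∈ H1) (ht : transport v ∈ H1) {x : ℝ} (hx : x ≠ 0) :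
    HasDerivAt v (deriv v x) x := by
  have hc : ContinuousAt (deriv v) x := by
    have h1 : ContinuousAt (fun y => transport v y / ((1 - φ y ^ 2 : ℝ) : ℂ)) x := by
      refine (H1.continuous ht).continuousAt.div ?_ (one_sub_φ_sq_ne hx)
      have := φ_continuous
      fun_prop
    refine h1.congr ?_
    filter_upwards [isOpen_ne.mem_nhds hx] with y hy
    unfold transport
    rw [mul_div_cancel_left₀ _ (one_sub_φ_sq_ne hy)]
  obtain ⟨-, g, -, hg⟩ := hv
  have hae := H1.deriv_ae hg
  have h' : v = fun y => v x + ∫ t in x..y, deriv v t := by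
    funext y
    rw [intervalIntegral.integral_congr_ae (g := g) (hae.mono fun t ht _ => ht), hg.2]; ring
  have h2 := intervalIntegral.integral_hasDerivAt_right (f := deriv v) (a := x) (b := x)
    (by simp) ((stronglyMeasurable_deriv v).stronglyMeasurableAtFilter) hc
  have h3 := h2.const_add (v x)
  rw [← h'] at h3
  exact h3

theorem H1.of_hasDerivAt {f f' : ℝ → ℂ} (hc : Continuous f)
    (hd : ∀ x, x ≠ 0 → HasDerivAt f (f' x) x) (hf : MemLp f 2 volume)
    (hf' : MemLp f' 2 volume) : f ∈ H1 := by
  have hl : LocallyIntegrable f' volume := hf'.locallyIntegrable (by norm_num)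
  refine ⟨hf, f', hf', hl, fun x y => ?_⟩
  exact integral_eq_of_hasDerivAt_off_countable f f' (s := {0}) (countable_singleton 0)
    hc.continuousOn (fun t ht => hd t ht.2)
    (hl.integrableOn_isCompact isCompact_uIcc).intervalIntegrable

theorem φ_pos (x : ℝ) : 0 < φ x := Real.exp_pos _

theorem φ_le_one (x : ℝ) : φ x ≤ 1 := by
  unfold φ; rw [Real.exp_le_one_iff]; simp

theorem abs_dφ_le (x : ℝ) : |dφ x| ≤ φ x := by
  unfold dφ φ
  rcases lt_trichotomy x 0 with h | h | h
  · simp [Real.sign_of_neg h]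
  · simp [h]
  · simp [Real.sign_of_pos h]

theorem dφ_measurable : Measurable dφ := by
  have : dφ = fun x => if x < 0 then Real.exp (-|x|) else if 0 < x then -Real.exp (-|x|) else 0 := by
    funext x; unfold dφ Real.sign
    split_ifs <;> simp
  rw [this]
  refine Measurable.ite measurableSet_Iio (by fun_prop)
    (Measurable.ite measurableSet_Ioi (by fun_prop) measurable_const)

theorem φ_memLp : MemLp (fun x => ((φ x : ℝ) : ℂ)) 2 volume := by
  rw [memLp_two_iff_integrable_sq_norm (by have := φ_continuous; fun_prop)]
  have h : Integrable (fun x : ℝ => Real.exp (-2 * |x|)) := by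
    rw [← integrableOn_univ, ← Iic_union_Ioi (a := (0 : ℝ))]
    refine IntegrableOn.union ?_ ?_
    · refine (integrableOn_exp_mul_Iic (a := 2) (by norm_num) 0).congr_fun ?_ measurableSet_Iic
      intro x hx
      simp only [abs_of_nonpos (mem_Iic.1 hx)]; congr 1; ring
    · refine (integrableOn_exp_mul_Ioi (a := -2) (by norm_num) 0).congr_fun ?_ measurableSet_Ioi
      intro x hx
      simp only [abs_of_pos (mem_Ioi.1 hx)]
  refine h.congr (Filter.Eventually.of_forall fun x => ?_)
  simp only [φ, Complex.norm_real, Real.norm_eq_abs, Real.abs_exp]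
  rw [← Real.exp_nat_mul]; congr 1; push_cast; ring

/-- Hypotheses on a source term under which both halves of the convolution with `φ` lie in `H¹`. -/
structure GoodSource (G : ℝ → ℂ) : Prop where
  memLp : MemLp G 2 volume
  integrable : Integrable (fun y => (Real.exp |y| : ℂ) * G y) volume
  continuousAt : ∀ x, x ≠ 0 → ContinuousAt G x

/-- The left half `∫_{y ≤ x} e^{-(x - y)} G(y) dy` of the convolution. -/
def leftHalf (G : ℝ → ℂ) (x : ℝ) : ℂ := ∫ y in Iic x, (Real.exp (y - x) : ℂ) * G y

/-- The right half `∫_{y > x} e^{x - y} G(y) dy` of the convolution. -/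
def rightHalf (G : ℝ → ℂ) (x : ℝ) : ℂ := ∫ y in Ioi x, (Real.exp (x - y) : ℂ) * G y

theorem GoodSource.integrable_mul {G : ℝ → ℂ} (h : GoodSource G) {k : ℝ → ℝ} (hk : Measurable k)
    {C : ℝ} (hkb : ∀ y, |k y| ≤ C * Real.exp |y|) :
    Integrable (fun y => (k y : ℂ) * G y) volume := by
  refine Integrable.mono' (h.integrable.norm.const_mul C) ?_ ?_
  · exact (Complex.measurable_ofReal.comp hk).aestronglyMeasurable.mul
      h.memLp.aestronglyMeasurable
  · refine Filter.Eventually.of_forall fun y => ?_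
    rw [norm_mul, norm_mul, Complex.norm_real, Complex.norm_real, Real.norm_eq_abs,
      Real.norm_eq_abs, Real.abs_exp, ← mul_assoc]
    exact mul_le_mul_of_nonneg_right (hkb y) (norm_nonneg _)

theorem GoodSource.integrable_exp {G : ℝ → ℂ} (h : GoodSource G) :
    Integrable (fun y => (Real.exp y : ℂ) * G y) volume :=
  h.integrable_mul (C := 1) (by fun_prop) (fun y => by
    rw [Real.abs_exp, one_mul]; exact Real.exp_le_exp.2 (le_abs_self y))

theorem GoodSource.integrable_exp_neg {G : ℝ → ℂ} (h : GoodSource G) :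
    Integrable (fun y => (Real.exp (-y) : ℂ) * G y) volume :=
  h.integrable_mul (C := 1) (by fun_prop) (fun y => by
    rw [Real.abs_exp, one_mul]; exact Real.exp_le_exp.2 (neg_le_abs y))

theorem GoodSource.norm_setIntegral_le {G : ℝ → ℂ} (h : GoodSource G) (x : ℝ) (k : ℝ → ℝ)
    (s : Set ℝ) (hs : MeasurableSet s)
    (hb : ∀ y ∈ s, |k y| ≤ Real.exp (-|x|) * Real.exp |y|) :
    ‖∫ y in s, (k y : ℂ) * G y‖ ≤ (∫ y, ‖(Real.exp |y| : ℂ) * G y‖) * φ x := by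
  have h1 : ‖∫ y in s, (k y : ℂ) * G y‖ ≤
      ∫ y in s, ‖(Real.exp |y| : ℂ) * G y‖ * φ x := by
    refine norm_integral_le_of_norm_le ((h.integrable.norm.mul_const _).integrableOn) ?_
    filter_upwards [ae_restrict_mem hs] with y hy
    rw [norm_mul, norm_mul, Complex.norm_real, Complex.norm_real, Real.norm_eq_abs,
      Real.norm_eq_abs, Real.abs_exp]
    have := mul_le_mul_of_nonneg_right (hb y hy) (norm_nonneg (G y))
    unfold φ
    linarith
  refine h1.trans ?_
  rw [integral_mul_const]
  refine mul_le_mul_of_nonneg_right ?_ (φ_pos x).le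
  exact setIntegral_le_integral h.integrable.norm (Filter.Eventually.of_forall fun y => norm_nonneg _)

theorem GoodSource.memLp_of_bound {F : ℝ → ℂ} {C : ℝ} (hF : Continuous F)
    (hb : ∀ x, ‖F x‖ ≤ C * φ x) : MemLp F 2 volume := by
  refine φ_memLp.of_le_mul (c := C) hF.aestronglyMeasurable (Filter.Eventually.of_forall fun x => ?_)
  rw [Complex.norm_real, Real.norm_eq_abs, abs_of_pos (φ_pos x)]
  exact hb x

theorem leftHalf_eq (G : ℝ → ℂ) (x : ℝ) :
    leftHalf G x = (Real.exp (-x) : ℂ) * ∫ y in Iic x, (Real.exp y : ℂ) * G y := by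
  unfold leftHalf
  rw [← integral_const_mul]
  congr 1; funext y
  rw [← mul_assoc, ← Complex.ofReal_mul, ← Real.exp_add]
  congr 3; ring

theorem rightHalf_eq (G : ℝ → ℂ) (x : ℝ) :
    rightHalf G x = (Real.exp x : ℂ) * ∫ y in Ioi x, (Real.exp (-y) : ℂ) * G y := by
  unfold rightHalf
  rw [← integral_const_mul]
  congr 1; funext y
  rw [← mul_assoc, ← Complex.ofReal_mul, ← Real.exp_add, sub_eq_add_neg]

theorem primitive_facts {f : ℝ → ℂ} (hf : Integrable f volume) :
    Continuous (fun x => ∫ y in Iic x, f y) ∧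
      ∀ x, ContinuousAt f x → HasDerivAt (fun x => ∫ y in Iic x, f y) (f x) x := by
  have h : ∀ a : ℝ, (fun x => ∫ y in Iic x, f y) =
      fun x => (∫ y in Iic a, f y) + ∫ y in a..x, f y := by
    intro a; funext x
    rw [← intervalIntegral.integral_Iic_sub_Iic hf.integrableOn hf.integrableOn]; ring
  constructor
  · rw [h 0]
    exact continuous_const.add (intervalIntegral.continuous_primitive
      (fun a b => hf.intervalIntegrable) 0)
  · intro x hx
    rw [h x]
    exact (intervalIntegral.integral_hasDerivAt_right (by simp)
      (hf.aestronglyMeasurable.stronglyMeasurableAtFilter) hx).const_add _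

theorem integral_Ioi_eq {f : ℝ → ℂ} (hf : Integrable f volume) (x : ℝ) :
    ∫ y in Ioi x, f y = (∫ y, f y) - ∫ y in Iic x, f y := by
  rw [← integral_add_compl (measurableSet_Iic (a := x)) hf, compl_Iic]; ring

theorem hasDerivAt_cexp_real (c x : ℝ) :
    HasDerivAt (fun x : ℝ => (Real.exp (c * x) : ℂ)) (c * Real.exp (c * x) : ℂ) x := by
  have h : HasDerivAt (fun x : ℝ => Real.exp (c * x)) (Real.exp (c * x) * (c * 1)) x :=
    ((hasDerivAt_id x).const_mul c).exp
  have := h.ofReal_comp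
  convert this using 1
  push_cast; ring

theorem leftHalf_mem {G : ℝ → ℂ} (h : GoodSource G) : leftHalf G ∈ H1 := by
  obtain ⟨hPc, hPd⟩ := primitive_facts h.integrable_exp
  have he : leftHalf G = fun x => (Real.exp (-1 * x) : ℂ) *
      ∫ y in Iic x, (Real.exp y : ℂ) * G y := by
    funext x; rw [leftHalf_eq]; simp
  have hc : Continuous (leftHalf G) := by
    rw [he]; exact (by fun_prop : Continuous fun x : ℝ => (Real.exp (-1 * x) : ℂ)).mul hPc
  have hL : MemLp (leftHalf G) 2 volume := by
    refine GoodSource.memLp_of_bound (C := ∫ y, ‖(Real.exp |y| : ℂ) * G y‖) hc fun x => ?_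
    refine h.norm_setIntegral_le x (fun y => Real.exp (y - x)) _ measurableSet_Iic ?_
    intro y hy
    rw [Real.abs_exp, ← Real.exp_add, Real.exp_le_exp]
    have hy' : y ≤ x := hy
    rcases abs_cases x with h1 | h1 <;> rcases abs_cases y with h2 | h2 <;> linarith
  refine H1.of_hasDerivAt (f' := fun x => -leftHalf G x + G x) hc (fun x hx => ?_) hL
    (hL.neg.add h.memLp)
  have hco : ContinuousAt (fun y : ℝ => (Real.exp y : ℂ) * G y) x :=
    (by fun_prop : Continuous fun x : ℝ => (Real.exp x : ℂ)).continuousAt.mul (h.continuousAt x hx)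
  have := (hasDerivAt_cexp_real (-1) x).mul (hPd x hco)
  rw [he]
  refine this.congr_deriv ?_
  have hE : (Real.exp (-1 * x) : ℂ) * (Real.exp x : ℂ) = 1 := by
    rw [← Complex.ofReal_mul, ← Real.exp_add]; simp
  simp only [Complex.ofReal_neg, Complex.ofReal_one]
  linear_combination G x * hE

theorem rightHalf_mem {G : ℝ → ℂ} (h : GoodSource G) : rightHalf G ∈ H1 := by
  obtain ⟨hPc, hPd⟩ := primitive_facts h.integrable_exp_neg
  have he : rightHalf G = fun x => (Real.exp (1 * x) : ℂ) *
      ((∫ y, (Real.exp (-y) : ℂ) * G y) - ∫ y in Iic x, (Real.exp (-y) : ℂ) * G y) := by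
    funext x; rw [rightHalf_eq, integral_Ioi_eq h.integrable_exp_neg]; simp
  have hc : Continuous (rightHalf G) := by
    rw [he]
    exact (by fun_prop : Continuous fun x : ℝ => (Real.exp (1 * x) : ℂ)).mul
      (continuous_const.sub hPc)
  have hL : MemLp (rightHalf G) 2 volume := by
    refine GoodSource.memLp_of_bound (C := ∫ y, ‖(Real.exp |y| : ℂ) * G y‖) hc fun x => ?_
    refine h.norm_setIntegral_le x (fun y => Real.exp (x - y)) _ measurableSet_Ioi ?_
    intro y hy
    rw [Real.abs_exp, ← Real.exp_add, Real.exp_le_exp]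
    have hy' : x < y := hy
    rcases abs_cases x with h1 | h1 <;> rcases abs_cases y with h2 | h2 <;> linarith
  refine H1.of_hasDerivAt (f' := fun x => rightHalf G x - G x) hc (fun x hx => ?_) hL
    (hL.sub h.memLp)
  have hco : ContinuousAt (fun y : ℝ => (Real.exp (-y) : ℂ) * G y) x :=
    (by fun_prop : Continuous fun x : ℝ => (Real.exp (-x) : ℂ)).continuousAt.mul
      (h.continuousAt x hx)
  have := (hasDerivAt_cexp_real 1 x).mul ((hPd x hco).const_sub (∫ y, (Real.exp (-y) : ℂ) * G y))
  rw [he]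
  refine this.congr_deriv ?_
  have hE : (Real.exp (1 * x) : ℂ) * (Real.exp (-x) : ℂ) = 1 := by
    rw [← Complex.ofReal_mul, ← Real.exp_add]; simp
  simp only [Complex.ofReal_one]
  linear_combination -G x * hE

theorem kernel_bound (x y : ℝ) : Real.exp (-|x - y|) ≤ 1 * Real.exp |y| := by
  rw [one_mul, Real.exp_le_exp]
  linarith [abs_nonneg (x - y), abs_nonneg y]

theorem GoodSource.integrable_φ {G : ℝ → ℂ} (h : GoodSource G) (x : ℝ) :
    Integrable (fun y => (φ (x - y) : ℂ) * G y) volume :=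
  h.integrable_mul (C := 1) (k := fun y => φ (x - y))
    (φ_continuous.measurable.comp (by fun_prop)) (fun y => by
      rw [abs_of_pos (φ_pos _)]; exact kernel_bound x y)

theorem GoodSource.integrable_dφ {G : ℝ → ℂ} (h : GoodSource G) (x : ℝ) :
    Integrable (fun y => (dφ (x - y) : ℂ) * G y) volume :=
  h.integrable_mul (C := 1) (k := fun y => dφ (x - y))
    (dφ_measurable.comp (by fun_prop)) (fun y => (abs_dφ_le _).trans (kernel_bound x y))

theorem conv_φ_mem {G : ℝ → ℂ} (h : GoodSource G) : conv φ G ∈ H1 := by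
  have : conv φ G = leftHalf G + rightHalf G := by
    funext x
    unfold conv leftHalf rightHalf
    rw [Pi.add_apply, ← integral_add_compl (measurableSet_Iic (a := x)) (h.integrable_φ x),
      compl_Iic]
    congr 1
    · refine setIntegral_congr_fun measurableSet_Iic fun y hy => ?_
      have hy' : y ≤ x := hy
      simp only [φ, abs_of_nonneg (sub_nonneg.2 hy'), neg_sub]
    · refine setIntegral_congr_fun measurableSet_Ioi fun y hy => ?_
      have hy' : x < y := hy
      simp only [φ, abs_of_neg (sub_neg.2 hy'), neg_neg]
  rw [this]; exact H1.add_mem (leftHalf_mem h) (rightHalf_mem h)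

theorem conv_dφ_mem {G : ℝ → ℂ} (h : GoodSource G) : conv dφ G ∈ H1 := by
  have : conv dφ G = rightHalf G - leftHalf G := by
    funext x
    unfold conv leftHalf rightHalf
    rw [Pi.sub_apply, ← integral_add_compl (measurableSet_Iic (a := x)) (h.integrable_dφ x),
      compl_Iic, add_comm, sub_eq_add_neg]
    congr 1
    · refine setIntegral_congr_fun measurableSet_Ioi fun y hy => ?_
      have hy' : x - y < 0 := sub_neg.2 hy
      simp only [dφ, abs_of_neg hy', Real.sign_of_neg hy', neg_neg, one_mul]
    · rw [← integral_neg, integral_Iic_eq_integral_Iio, integral_Iic_eq_integral_Iio]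
      refine setIntegral_congr_fun measurableSet_Iio fun y hy => ?_
      have hy' : 0 < x - y := sub_pos.2 hy
      simp only [dφ, abs_of_pos hy', Real.sign_of_pos hy', neg_sub, neg_mul, one_mul,
        Complex.ofReal_neg]
  rw [this]; exact H1.sub_mem (rightHalf_mem h) (leftHalf_mem h)

theorem profile_local {x : ℝ} (hx : x ≠ 0) : ∃ s : ℝ, s * s = 1 ∧
    (φ =ᶠ[nhds x] fun y => Real.exp (s * y)) ∧ (dφ =ᶠ[nhds x] fun y => s * Real.exp (s * y)) := by
  rcases lt_or_gt_of_ne hx with h | h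
  · refine ⟨1, by norm_num, ?_, ?_⟩ <;> filter_upwards [isOpen_Iio.mem_nhds h] with y hy
    · simp [φ, abs_of_neg (mem_Iio.1 hy)]
    · simp [dφ, abs_of_neg (mem_Iio.1 hy), Real.sign_of_neg (mem_Iio.1 hy)]
  · refine ⟨-1, by norm_num, ?_, ?_⟩ <;> filter_upwards [isOpen_Ioi.mem_nhds h] with y hy
    · simp [φ, abs_of_pos (mem_Ioi.1 hy)]
    · simp [dφ, abs_of_pos (mem_Ioi.1 hy), Real.sign_of_pos (mem_Ioi.1 hy)]

theorem hasDerivAt_φ {x : ℝ} (hx : x ≠ 0) : HasDerivAt φ (dφ x) x := by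
  obtain ⟨s, -, h1, h2⟩ := profile_local hx
  rw [h2.eq_of_nhds]
  refine HasDerivAt.congr_of_eventuallyEq ?_ h1
  have h : HasDerivAt (fun x : ℝ => Real.exp (s * x)) (Real.exp (s * x) * (s * 1)) x :=
    ((hasDerivAt_id x).const_mul s).exp
  exact h.congr_deriv (by ring)

theorem hasDerivAt_dφ {x : ℝ} (hx : x ≠ 0) : HasDerivAt dφ (φ x) x := by
  obtain ⟨s, hs, h1, h2⟩ := profile_local hx
  rw [h1.eq_of_nhds]
  refine HasDerivAt.congr_of_eventuallyEq ?_ h2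
  have h : HasDerivAt (fun x : ℝ => Real.exp (s * x)) (Real.exp (s * x) * (s * 1)) x :=
    ((hasDerivAt_id x).const_mul s).exp
  exact (h.const_mul s).congr_deriv (by linear_combination Real.exp (s * x) * hs)

theorem memLp_mul {w : ℝ → ℝ} (hw : Measurable w) {C : ℝ} (hb : ∀ y, |w y| ≤ C)
    {v : ℝ → ℂ} (hv : MemLp v 2 volume) : MemLp (fun y => (w y : ℂ) * v y) 2 volume := by
  refine hv.of_le_mul (c := C)
    ((Complex.measurable_ofReal.comp hw).aestronglyMeasurable.mul hv.aestronglyMeasurable)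
    (Filter.Eventually.of_forall fun y => ?_)
  rw [norm_mul, Complex.norm_real, Real.norm_eq_abs]
  exact mul_le_mul_of_nonneg_right (hb y) (norm_nonneg _)

theorem goodSource_mul {w : ℝ → ℝ} (hw : Measurable w) (hb : ∀ y, |w y| ≤ 2 * φ y ^ 2)
    (hc : ∀ x, x ≠ 0 → ContinuousAt w x) {v : ℝ → ℂ} (hv : v ∈ H1) :
    GoodSource (fun y => (w y : ℂ) * v y) where
  memLp := memLp_mul hw (C := 2) (fun y => (hb y).trans (by
    nlinarith [φ_pos y, φ_le_one y])) hv.1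
  integrable := by
    have h1 : Integrable (fun y => (φ y : ℂ) * v y) volume := φ_memLp.integrable_mul hv.1
    refine Integrable.mono' (h1.norm.const_mul 2) ?_ (Filter.Eventually.of_forall fun y => ?_)
    · have h2 : Measurable fun y => (w y : ℂ) := Complex.measurable_ofReal.comp hw
      have h3 : Measurable v := (H1.continuous hv).measurable
      exact Measurable.aestronglyMeasurable (by fun_prop)
    · rw [norm_mul, norm_mul, norm_mul, Complex.norm_real, Complex.norm_real, Complex.norm_real,
        Real.norm_eq_abs, Real.norm_eq_abs, Real.norm_eq_abs, Real.abs_exp, ← mul_assoc,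
        ← mul_assoc, abs_of_pos (φ_pos y)]
      refine mul_le_mul_of_nonneg_right ?_ (norm_nonneg _)
      have hE : Real.exp |y| * φ y = 1 := by unfold φ; rw [← Real.exp_add]; simp
      calc Real.exp |y| * |w y| ≤ Real.exp |y| * (2 * φ y ^ 2) :=
            mul_le_mul_of_nonneg_left (hb y) (Real.exp_pos _).le
        _ = 2 * φ y := by linear_combination 2 * φ y * hE
  continuousAt := fun x hx => by
    exact (Complex.continuous_ofReal.continuousAt.comp (hc x hx)).mul
      (H1.continuous hv).continuousAt

theorem goodSource_fst {v : ℝ → ℂ} (hv : v ∈ H1) :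
    GoodSource (fun y => ((2 * φ y * dφ y : ℝ) : ℂ) * v y) := by
  refine goodSource_mul ?_ ?_ ?_ hv
  · exact (φ_continuous.measurable.const_mul 2).mul dφ_measurable
  · intro y
    rw [abs_mul, abs_mul, abs_two, abs_of_pos (φ_pos y)]
    nlinarith [abs_dφ_le y, φ_pos y]
  · intro x hx
    exact (continuousAt_const.mul φ_continuous.continuousAt).mul (hasDerivAt_dφ hx).continuousAt

theorem goodSource_snd {v : ℝ → ℂ} (hv : v ∈ H1) :
    GoodSource (fun y => ((φ y ^ 2 : ℝ) : ℂ) * v y) := by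
  refine goodSource_mul (φ_continuous.measurable.pow_const 2) ?_ ?_ hv
  · intro y
    rw [abs_of_nonneg (sq_nonneg _)]; nlinarith [sq_nonneg (φ y)]
  · intro x hx
    exact (φ_continuous.pow 2).continuousAt

theorem Q_mem (b : ℝ) {v : ℝ → ℂ} (hv : v ∈ H1) : Q b v ∈ H1 :=
  H1.smul_mem ((b : ℂ) - 3) (H1.sub_mem (conv_φ_mem (goodSource_fst hv))
    (H1.smul_mem 2 (conv_dφ_mem (goodSource_snd hv))))

theorem Q_add (b : ℝ) {v w : ℝ → ℂ} (hv : v ∈ H1) (hw : w ∈ H1) (x : ℝ) :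
    Q b (v + w) x = Q b v x + Q b w x := by
  unfold Q conv
  simp only [Pi.add_apply, mul_add]
  rw [integral_add ((goodSource_fst hv).integrable_φ x) ((goodSource_fst hw).integrable_φ x),
    integral_add ((goodSource_snd hv).integrable_dφ x) ((goodSource_snd hw).integrable_dφ x)]
  ring

theorem Q_smul (b : ℝ) (c : ℂ) (v : ℝ → ℂ) (x : ℝ) : Q b (c • v) x = c * Q b v x := by
  unfold Q conv
  simp only [Pi.smul_apply, smul_eq_mul, mul_left_comm _ c, integral_const_mul]
  ring

theorem dφ_zero : dφ 0 = 0 := by simp [dφ]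

theorem φ_zero : φ 0 = 1 := by simp [φ]

theorem transport_zero (v : ℝ → ℂ) : transport v 0 = 0 := by simp [transport, φ_zero]

theorem Q_zero (b : ℝ) (v : ℝ → ℂ) :
    Q b v 0 = 4 * ((b : ℂ) - 3) * ∫ y, ((φ y ^ 2 * dφ y : ℝ) : ℂ) * v y := by
  have h1 : ∀ y, φ (0 - y) = φ y := fun y => by simp [φ]
  have h2 : ∀ y, dφ (0 - y) = -dφ y := fun y => by
    rcases lt_trichotomy y 0 with h | h | h
    · simp [dφ, Real.sign_of_neg h, Real.sign_of_pos (neg_pos.2 h)]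
    · simp [h, dφ]
    · simp [dφ, Real.sign_of_pos h, Real.sign_of_neg (neg_lt_zero.2 h)]
  unfold Q conv
  simp only [h1, h2]
  have e1 : (∫ y, (φ y : ℂ) * (((2 * φ y * dφ y : ℝ) : ℂ) * v y)) =
      2 * ∫ y, ((φ y ^ 2 * dφ y : ℝ) : ℂ) * v y := by
    rw [← integral_const_mul]; congr 1; funext y; push_cast; ring
  have e2 : (∫ y, ((-dφ y : ℝ) : ℂ) * (((φ y ^ 2 : ℝ) : ℂ) * v y)) =
      -1 * ∫ y, ((φ y ^ 2 * dφ y : ℝ) : ℂ) * v y := by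
    rw [← integral_const_mul]; congr 1; funext y; push_cast; ring
  rw [e1, e2]; ring

theorem dφ_memLp : MemLp (fun x => (dφ x : ℂ)) 2 volume := by
  refine φ_memLp.of_le (Complex.measurable_ofReal.comp dφ_measurable).aestronglyMeasurable
    (Filter.Eventually.of_forall fun x => ?_)
  rw [Complex.norm_real, Complex.norm_real, Real.norm_eq_abs, Real.norm_eq_abs,
    abs_of_pos (φ_pos x)]
  exact abs_dφ_le x

theorem φ_mem : (fun x => (φ x : ℂ)) ∈ H1 :=
  H1.of_hasDerivAt (f' := fun x => (dφ x : ℂ)) (Complex.continuous_ofReal.comp φ_continuous)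
    (fun _ hx => (hasDerivAt_φ hx).ofReal_comp) φ_memLp dφ_memLp

theorem local_mem {v : ℝ → ℂ} (hv : v ∈ H1) (ht : transport v ∈ H1) :
    (fun x => (v 0 - (φ x : ℂ) * v x) * (dφ x : ℂ)) ∈ H1 := by
  have hvc := H1.continuous hv
  have hφc : Continuous fun x => (φ x : ℂ) := Complex.continuous_ofReal.comp φ_continuous
  have hb1 : ∀ x, |φ x * dφ x| ≤ 1 := fun x => by
    rw [abs_mul, abs_of_pos (φ_pos x)]
    nlinarith [abs_dφ_le x, φ_pos x, φ_le_one x, abs_nonneg (dφ x)]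
  have hb2 : ∀ x, |dφ x ^ 2 + φ x ^ 2| ≤ 2 := fun x => by
    rw [abs_of_nonneg (by positivity), ← sq_abs (dφ x)]
    nlinarith [abs_dφ_le x, φ_pos x, φ_le_one x, abs_nonneg (dφ x)]
  have hm := φ_continuous.measurable
  have hm' := dφ_measurable
  refine H1.of_hasDerivAt (f' := fun x => v 0 * (φ x : ℂ) - ((dφ x ^ 2 + φ x ^ 2 : ℝ) : ℂ) * v x
    - ((φ x * dφ x : ℝ) : ℂ) * deriv v x) ?_ (fun x hx => ?_) ?_ ?_
  · rw [continuous_iff_continuousAt]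
    intro x
    by_cases hx : x = 0
    · subst hx
      unfold ContinuousAt
      have h0 : Filter.Tendsto (fun x => ‖v 0 - (φ x : ℂ) * v x‖) (nhds 0) (nhds 0) := by
        have : Continuous fun x => ‖v 0 - (φ x : ℂ) * v x‖ := by fun_prop
        have h := this.tendsto 0
        simpa [φ_zero] using h
      simp only [φ_zero, Complex.ofReal_one, one_mul, sub_self, zero_mul]
      refine squeeze_zero_norm (fun x => ?_) h0
      rw [norm_mul, Complex.norm_real, Real.norm_eq_abs]
      exact mul_le_of_le_one_right (norm_nonneg _) ((abs_dφ_le x).trans (φ_le_one x))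
    · exact (continuous_const.sub (hφc.mul hvc)).continuousAt.mul
        (Complex.continuous_ofReal.continuousAt.comp (hasDerivAt_dφ hx).continuousAt)
  · have h := (((hasDerivAt_φ hx).ofReal_comp.mul (H1.hasDerivAt hv ht hx)).const_sub (v 0)).mul
      (hasDerivAt_dφ hx).ofReal_comp
    refine h.congr_deriv ?_
    simp only [Pi.mul_apply]
    push_cast; ring
  · have h := (dφ_memLp.const_mul (v 0)).sub (memLp_mul (hm.mul hm') hb1 hv.1)
    refine h.ae_eq (Filter.Eventually.of_forall fun x => ?_)
    simp only [Pi.sub_apply, Pi.mul_apply]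
    push_cast; ring
  · exact ((φ_memLp.const_mul (v 0)).sub
      (memLp_mul ((hm'.pow_const 2).add (hm.pow_const 2)) hb2 hv.1)).sub
      (memLp_mul (hm.mul hm') hb1 (H1.memLp_deriv hv))

theorem linFull_mem (b : ℝ) {v : ℝ → ℂ} (hv : v ∈ H1) (ht : transport v ∈ H1) :
    linFull b v ∈ H1 := by
  have h := H1.add_mem (H1.add_mem ht (H1.smul_mem ((b : ℂ) - 4) (local_mem hv ht))) (Q_mem b hv)
  have e : linFull b v = transport v +
      ((b : ℂ) - 4) • (fun x => (v 0 - (φ x : ℂ) * v x) * (dφ x : ℂ)) + Q b v := by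
    funext x
    simp only [linFull, Pi.add_apply, Pi.smul_apply, smul_eq_mul]; ring
  rw [e]; exact h

theorem linRed_eq (b : ℝ) {v : ℝ → ℂ} (h0 : v 0 = 0) (x : ℝ) :
    linRed b v x = linFull b v x
      - 4 * ((b : ℂ) - 3) * (∫ y, ((φ y ^ 2 * dφ y : ℝ) : ℂ) * v y) * (φ x : ℂ) := by
  unfold linRed L linFull
  rw [h0]; push_cast; ring

theorem linRed_mem (b : ℝ) {v : ℝ → ℂ} (hv : v ∈ H1zero) (ht : transport v ∈ H1) :
    linRed b v ∈ H1zero := by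
  constructor
  · have e : linRed b v = linFull b v -
        (4 * ((b : ℂ) - 3) * ∫ y, ((φ y ^ 2 * dφ y : ℝ) : ℂ) * v y) • fun x => (φ x : ℂ) := by
      funext x; rw [linRed_eq b hv.2]; rfl
    rw [e]
    exact H1.sub_mem (linFull_mem b hv.1 ht) (H1.smul_mem _ φ_mem)
  · rw [linRed_eq b hv.2, linFull, Q_zero, transport_zero, dφ_zero, φ_zero]
    simp

theorem transport_add {v w : ℝ → ℂ} (hv : v ∈ H1) (hvt : transport v ∈ H1) (hw : w ∈ H1)
    (hwt : transport w ∈ H1) : transport (v + w) = transport v + transport w := by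
  funext x
  by_cases hx : x = 0
  · subst hx; simp [transport_zero]
  · have := ((H1.hasDerivAt hv hvt hx).add (H1.hasDerivAt hw hwt hx)).deriv
    simp only [transport, Pi.add_apply]
    rw [this]; ring

theorem transport_smul (c : ℂ) (v : ℝ → ℂ) : transport (c • v) = c • transport v := by
  funext x
  simp only [transport, Pi.smul_apply, smul_eq_mul]
  rw [deriv_const_smul_field]
  simp only [smul_eq_mul]; ring

theorem linFull_add (b : ℝ) {v w : ℝ → ℂ} (hv : v ∈ H1) (hvt : transport v ∈ H1) (hw : w ∈ H1)
    (hwt : transport w ∈ H1) : linFull b (v + w) = linFull b v + linFull b w := by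
  funext x
  simp only [linFull, Pi.add_apply, transport_add hv hvt hw hwt, Q_add b hv hw]
  ring

theorem linFull_smul (b : ℝ) (c : ℂ) (v : ℝ → ℂ) : linFull b (c • v) = c • linFull b v := by
  funext x
  simp only [linFull, Pi.smul_apply, smul_eq_mul, transport_smul, Q_smul]
  ring

theorem integrable_weight {v : ℝ → ℂ} (hv : v ∈ H1) :
    Integrable (fun y => ((φ y ^ 2 * dφ y : ℝ) : ℂ) * v y) volume := by
  have h := (goodSource_snd hv).integrable_mul dφ_measurable (C := 1) (fun y => by
    refine (abs_dφ_le y).trans ((φ_le_one y).trans ?_)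
    rw [one_mul]; exact Real.one_le_exp (abs_nonneg y))
  refine h.congr (Filter.Eventually.of_forall fun y => ?_)
  push_cast; ring

theorem linRed_add (b : ℝ) {v w : ℝ → ℂ} (hv : v ∈ H1zero) (hvt : transport v ∈ H1)
    (hw : w ∈ H1zero) (hwt : transport w ∈ H1) :
    linRed b (v + w) = linRed b v + linRed b w := by
  funext x
  rw [Pi.add_apply, linRed_eq b hv.2, linRed_eq b hw.2, linRed_eq b (H1zero.add_mem hv hw).2,
    linFull_add b hv.1 hvt hw.1 hwt]
  simp only [Pi.add_apply, mul_add]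
  rw [integral_add (integrable_weight hv.1) (integrable_weight hw.1)]
  ring

theorem linRed_smul (b : ℝ) (c : ℂ) {v : ℝ → ℂ} (hv : v ∈ H1zero) :
    linRed b (c • v) = c • linRed b v := by
  funext x
  rw [Pi.smul_apply, linRed_eq b hv.2, linRed_eq b (H1zero.smul_mem c hv).2, linFull_smul]
  simp only [Pi.smul_apply, smul_eq_mul, mul_left_comm _ c, integral_const_mul]
  ring

/-! ### The unbounded operators and their spectra -/

/-- The linearized operator of the peakon on `H¹(ℝ)`, with domain
`{v ∈ H¹(ℝ) : (1 - φ²) v' ∈ H¹(ℝ)}`. -/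
def opFull (b : ℝ) : H1 →ₗ.[ℂ] H1 where
  domain :=
    { carrier := {v | transport v ∈ H1}
      zero_mem' := by
        have h := transport_smul 0 (0 : ℝ → ℂ)
        simp only [smul_zero, zero_smul] at h
        simp only [mem_ofPred_eq, ZeroMemClass.coe_zero, h, H1.zero_mem]
      add_mem' := by
        intro v w hv hw
        simp only [mem_ofPred_eq] at hv hw
        simp only [mem_ofPred_eq, Submodule.coe_add, transport_add v.2 hv w.2 hw]
        exact H1.add_mem hv hw
      smul_mem' := by
        intro c v hv
        simp only [mem_ofPred_eq] at hv
        simp only [mem_ofPred_eq, Submodule.coe_smul, transport_smul]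
        exact H1.smul_mem c hv }
  toFun :=
    { toFun := fun v => ⟨linFull b v.1, linFull_mem b v.1.2 v.2⟩
      map_add' := fun v w => Subtype.ext (linFull_add b v.1.2 v.2 w.1.2 w.2)
      map_smul' := fun c v => Subtype.ext (linFull_smul b c v.1) }

/-- The operator `v ↦ L v - 4 (b - 3) ⟨φ² φ', v⟩ φ` on `{v ∈ H¹(ℝ) : v(0) = 0}`, with domain
`{v : (1 - φ²) v' ∈ H¹(ℝ), ((1 - φ²) v')(0) = 0}`. -/
def opRed (b : ℝ) : H1zero →ₗ.[ℂ] H1zero where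
  domain :=
    { carrier := {v | transport v ∈ H1zero}
      zero_mem' := by
        have h := transport_smul 0 (0 : ℝ → ℂ)
        simp only [smul_zero, zero_smul] at h
        simp only [mem_ofPred_eq, ZeroMemClass.coe_zero, h, H1zero.zero_mem]
      add_mem' := by
        intro v w hv hw
        simp only [mem_ofPred_eq] at hv hw
        simp only [mem_ofPred_eq, Submodule.coe_add, transport_add v.2.1 hv.1 w.2.1 hw.1]
        exact H1zero.add_mem hv hw
      smul_mem' := by
        intro c v hv
        simp only [mem_ofPred_eq] at hv
        simp only [mem_ofPred_eq, Submodule.coe_smul, transport_smul]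
        exact H1zero.smul_mem c hv }
  toFun :=
    { toFun := fun v => ⟨linRed b v.1, linRed_mem b v.1.2 v.2.1⟩
      map_add' := fun v w => Subtype.ext (linRed_add b v.1.2 v.2.1 w.1.2 w.2.1)
      map_smul' := fun c v => Subtype.ext (linRed_smul b c v.1.2) }

/-- `z` is in the resolvent set of the unbounded operator `T` in `X ⊆ H¹(ℝ)`: the map
`T - z : Dom(T) → X` is a bijection with bounded inverse, for the `H¹` norm. -/
def InResolventSet {X : Submodule ℂ (ℝ → ℂ)} (T : X →ₗ.[ℂ] X) (z : ℂ) : Prop :=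
  Function.Bijective (fun v : T.domain => T v - z • (v : X)) ∧
    ∃ C : ℝ, ∀ v : T.domain,
      h1Norm ((v : X) : ℝ → ℂ) ≤ C * h1Norm ((T v - z • (v : X) : X) : ℝ → ℂ)

/-- The spectrum of `T`: the complement of the resolvent set. -/
def spec {X : Submodule ℂ (ℝ → ℂ)} (T : X →ₗ.[ℂ] X) : Set ℂ := {z | ¬ InResolventSet T z}

/-- Spectral stability: no spectrum in the open right half plane. -/
def SpectrallyStable {X : Submodule ℂ (ℝ → ℂ)} (T : X →ₗ.[ℂ] X) : Prop :=
  ∀ z ∈ spec T, z.re ≤ 0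

end

end BNovikov

open MeasureTheory Set

namespace BNovikov

noncomputable section

/-! The instability comes from the behaviour at the peak. To the right of the origin `1 - φ²`
vanishes like `2x` and `φφ'` tends to `-1`, so to leading order the operator is `2x v' + (b - 4) v`,
with `x^κ` as eigenfunction for `2κ + b - 4`. The power `x^κ` belongs to `H¹` near `0` exactly when
`Re κ > 1/2`, and the critical value `Re κ = 1/2` corresponds to the line `Re z = b - 3`. Every
point of that line is in the spectrum. Indeed, take `2κ = 1 + iτ + 2ε` and replace `x^κ` by `e^{-x}
(1 - e^{-2x})^κ` on `x > 0` and zero elsewhere (`peakFun`). Transport then acts by an exact formula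
(`transport_peakFun`), and `(A - z) v` is `2ε v` plus a remainder bounded in `H¹` uniformly in `ε`
(`linFull_peakFun`, `exists_peakonBound_remainder`), because `Q` is smoothing and the rest is less
singular by one power. Since `‖v‖²` grows at least like `1/ε` (`le_sobSq_peakFun`), no bounded
inverse exists (`HasApproxEigenfunctions.not_bounded`). The correction term of the reduced operator
is only one more bounded multiple of `φ`.

Reflection `x ↦ -x` turns both operators into their negatives (`linFull_refl`, `linRed_refl`), so
the line `Re z = 3 - b` is in the spectrum too. Stability therefore forces `b = 3`, and for `b = 3`
the imaginary axis is contained in the spectrum.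

For `b = 3` the nonlocal term disappears, and on each half-line the resolvent equation is a scalar
linear ODE. Variation of constants (`exists_primitive`) gives a solution, based at the end dictated
by the sign of `Re z`. Hardy's inequality (`hardy`, `div_den_memLp`) puts the data divided by `1 -
φ²` in `L²`. The energy `|v|² / (1 - φ²)` has derivative `2 Re z |v / (1 - φ²)|²` plus a source term
(`hasDerivAt_energy`), which bounds `v / (1 - φ²)`, hence `v'`, in `L²` (`energy_memLp`). The same
identity without source gives uniqueness (`eq_zero_on_half`). The left half-line follows by
reflection, and `H¹` differs from the functions vanishing at `0` only by multiples of `φ`, which the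
full operator annihilates when `b = 3` (`linFull_three_φ`). -/

/-! ### The squared Sobolev norm -/

/-- The square of the `H¹` norm. -/
def sobSq (v : ℝ → ℂ) : ℝ := (∫ x, ‖v x‖ ^ 2) + ∫ x, ‖deriv v x‖ ^ 2

theorem sobSq_nonneg (v : ℝ → ℂ) : 0 ≤ sobSq v := by unfold sobSq; positivity

theorem h1Norm_sq (v : ℝ → ℂ) : h1Norm v ^ 2 = sobSq v := Real.sq_sqrt (sobSq_nonneg v)

theorem h1Norm_nonneg (v : ℝ → ℂ) : 0 ≤ h1Norm v := Real.sqrt_nonneg _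

theorem integrable_sq {f : ℝ → ℂ} (h : MemLp f 2 volume) :
    Integrable (fun x => ‖f x‖ ^ 2) volume :=
  (memLp_two_iff_integrable_sq_norm h.1).1 h

theorem integral_sq_add_le {f g : ℝ → ℂ} (hf : MemLp f 2 volume) (hg : MemLp g 2 volume) :
    ∫ x, ‖f x + g x‖ ^ 2 ≤ 2 * ((∫ x, ‖f x‖ ^ 2) + ∫ x, ‖g x‖ ^ 2) := by
  rw [← integral_add (integrable_sq hf) (integrable_sq hg), ← integral_const_mul]
  refine integral_mono (integrable_sq (hf.add hg))
    (((integrable_sq hf).add (integrable_sq hg)).const_mul 2) fun x => ?_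
  have h1 := norm_add_le (f x) (g x)
  have h2 : ‖f x + g x‖ ^ 2 ≤ (‖f x‖ + ‖g x‖) ^ 2 := by gcongr
  nlinarith [sq_nonneg (‖f x‖ - ‖g x‖)]

theorem H1.hasDerivAt_ae {v : ℝ → ℂ} (hv : v ∈ H1) :
    ∀ᵐ x ∂volume, HasDerivAt v (deriv v x) x := by
  obtain ⟨-, g, -, h⟩ := hv
  filter_upwards [LocallyIntegrable.ae_hasDerivAt_integral h.1] with x hx
  have h' : v = fun y => v 0 + ∫ t in (0 : ℝ)..y, g t := by
    funext y; rw [h.2]; ring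
  have := (hx 0).const_add (v 0)
  rw [← h'] at this
  exact this.differentiableAt.hasDerivAt

theorem H1.deriv_add_ae {v w : ℝ → ℂ} (hv : v ∈ H1) (hw : w ∈ H1) :
    deriv (v + w) =ᵐ[volume] fun x => deriv v x + deriv w x := by
  filter_upwards [H1.hasDerivAt_ae hv, H1.hasDerivAt_ae hw] with x h1 h2
  exact (h1.add h2).deriv

theorem sobSq_add_le {v w : ℝ → ℂ} (hv : v ∈ H1) (hw : w ∈ H1) :
    sobSq (v + w) ≤ 2 * (sobSq v + sobSq w) := by
  have h1 := integral_sq_add_le hv.1 hw.1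
  have h2 := integral_sq_add_le (H1.memLp_deriv hv) (H1.memLp_deriv hw)
  have h3 : ∫ x, ‖deriv (v + w) x‖ ^ 2 = ∫ x, ‖deriv v x + deriv w x‖ ^ 2 :=
    integral_congr_ae ((H1.deriv_add_ae hv hw).mono fun x hx => by simp only [hx])
  unfold sobSq
  rw [h3]
  simp only [Pi.add_apply]
  linarith

theorem sobSq_smul (c : ℂ) (v : ℝ → ℂ) : sobSq (c • v) = ‖c‖ ^ 2 * sobSq v := by
  unfold sobSq
  have : ∀ x, deriv (c • v) x = c * deriv v x := fun x => by
    rw [deriv_const_smul_field]; rfl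
  simp only [this, Pi.smul_apply, smul_eq_mul, norm_mul, mul_pow, integral_const_mul]
  ring

theorem sobSq_neg (v : ℝ → ℂ) : sobSq (-v) = sobSq v := by
  have := sobSq_smul (-1) v
  simpa using this

theorem integrable_φ_sq : Integrable (fun x => φ x ^ 2) volume := by
  refine (integrable_sq φ_memLp).congr (Filter.Eventually.of_forall fun x => ?_)
  simp only [Complex.norm_real, Real.norm_eq_abs, sq_abs]

theorem sobSq_le_of_bound {v : ℝ → ℂ} {K : ℝ} (h1 : ∀ᵐ x ∂volume, ‖v x‖ ≤ K * φ x)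
    (h2 : ∀ᵐ x ∂volume, ‖deriv v x‖ ≤ K * φ x) :
    sobSq v ≤ K ^ 2 * (2 * ∫ x, φ x ^ 2) := by
  have key : ∀ f : ℝ → ℂ, (∀ᵐ x ∂volume, ‖f x‖ ≤ K * φ x) →
      ∫ x, ‖f x‖ ^ 2 ≤ K ^ 2 * ∫ x, φ x ^ 2 := by
    intro f hf
    rw [← integral_const_mul]
    refine integral_mono_of_nonneg (Filter.Eventually.of_forall fun x => by positivity)
      (integrable_φ_sq.const_mul _) (hf.mono fun x hx => ?_)
    have h : ‖f x‖ ^ 2 ≤ (K * φ x) ^ 2 := by gcongr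
    linarith [mul_pow K (φ x) 2]
  unfold sobSq
  linarith [key v h1, key _ h2]

theorem MemLp.of_φ_bound {f : ℝ → ℂ} (hf : AEStronglyMeasurable f volume) {K : ℝ}
    (h : ∀ᵐ x ∂volume, ‖f x‖ ≤ K * φ x) : MemLp f 2 volume := by
  refine φ_memLp.of_le_mul (c := K) hf (h.mono fun x hx => ?_)
  rw [Complex.norm_real, Real.norm_eq_abs, abs_of_pos (φ_pos x)]
  exact hx

/-! ### Reflection -/

/-- The reflection `v(-x)`. -/
def refl (v : ℝ → ℂ) : ℝ → ℂ := fun x => v (-x)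

theorem refl_memLp {v : ℝ → ℂ} (hv : MemLp v 2 volume) : MemLp (refl v) 2 volume :=
  hv.comp_measurePreserving (Measure.measurePreserving_neg volume)

theorem refl_mem {v : ℝ → ℂ} (hv : v ∈ H1) : refl v ∈ H1 := by
  obtain ⟨h, g, hg, -, hgi⟩ := hv
  have hm : MemLp (-refl g) 2 volume := (refl_memLp hg).neg
  refine ⟨refl_memLp h, -refl g, hm, hm.locallyIntegrable (by norm_num), fun x y => ?_⟩
  simp only [Pi.neg_apply, refl, intervalIntegral.integral_neg,
    intervalIntegral.integral_comp_neg (fun t => g t)]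
  rw [hgi]; ring

theorem deriv_refl (v : ℝ → ℂ) (x : ℝ) : deriv (refl v) x = -deriv v (-x) :=
  deriv_comp_neg v x

theorem sobSq_refl (v : ℝ → ℂ) : sobSq (refl v) = sobSq v := by
  unfold sobSq
  simp only [deriv_refl, norm_neg, refl]
  rw [integral_neg_eq_self (fun x => ‖v x‖ ^ 2), integral_neg_eq_self (fun x => ‖deriv v x‖ ^ 2)]

theorem φ_neg (x : ℝ) : φ (-x) = φ x := by simp [φ]

theorem dφ_neg (x : ℝ) : dφ (-x) = -dφ x := by
  rcases lt_trichotomy x 0 with h | h | h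
  · simp [dφ, Real.sign_of_neg h, Real.sign_of_pos (neg_pos.2 h)]
  · simp [h, dφ]
  · simp [dφ, Real.sign_of_pos h, Real.sign_of_neg (neg_lt_zero.2 h)]

theorem transport_refl (v : ℝ → ℂ) : transport (refl v) = -refl (transport v) := by
  funext x
  simp only [transport, deriv_refl, refl, Pi.neg_apply, φ_neg]
  ring

theorem conv_φ_refl (G : ℝ → ℂ) (x : ℝ) : conv φ (refl G) x = conv φ G (-x) := by
  unfold conv
  rw [← integral_neg_eq_self]
  congr 1; funext y
  simp only [refl, neg_neg]
  rw [← φ_neg (x - -y)]; congr 3; ring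

theorem conv_dφ_refl (G : ℝ → ℂ) (x : ℝ) : conv dφ (refl G) x = -conv dφ G (-x) := by
  unfold conv
  rw [← integral_neg_eq_self, ← integral_neg]
  congr 1; funext y
  have h : dφ (x - -y) = -dφ (-x - y) := by rw [← dφ_neg]; congr 1; ring
  simp only [refl, neg_neg]
  rw [h]; push_cast; ring

theorem conv_neg (k : ℝ → ℝ) (G : ℝ → ℂ) (x : ℝ) : conv k (fun y => -G y) x = -conv k G x := by
  unfold conv
  rw [← integral_neg]
  congr 1; funext y; ring

theorem Q_refl (b : ℝ) (v : ℝ → ℂ) (x : ℝ) : Q b (refl v) x = -Q b v (-x) := by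
  have h1 : (fun y => ((2 * φ y * dφ y : ℝ) : ℂ) * refl v y) =
      fun y => -refl (fun t => ((2 * φ t * dφ t : ℝ) : ℂ) * v t) y := by
    funext y; simp only [refl, φ_neg, dφ_neg]; push_cast; ring
  have h2 : (fun y => ((φ y ^ 2 : ℝ) : ℂ) * refl v y) =
      refl (fun t => ((φ t ^ 2 : ℝ) : ℂ) * v t) := by
    funext y; simp only [refl, φ_neg]
  unfold Q
  rw [h1, h2, conv_neg, conv_φ_refl, conv_dφ_refl]
  ring

/-- Each term contains exactly one odd factor: the derivative in the transport, `dφ` in the local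
term, and one `dφ` in each convolution of `Q`. This anticommutation makes the spectral obstruction
symmetric under `z ↦ -z`. -/
theorem linFull_refl (b : ℝ) (v : ℝ → ℂ) : linFull b (refl v) = -refl (linFull b v) := by
  funext x
  have h0 : refl v 0 = v 0 := by simp [refl]
  have hx : refl (linFull b v) x = linFull b v (-x) := rfl
  have hx' : refl (transport v) x = transport v (-x) := rfl
  have hx'' : refl v x = v (-x) := rfl
  rw [Pi.neg_apply, hx]
  simp only [linFull, transport_refl, Q_refl, Pi.neg_apply, φ_neg, dφ_neg, h0, hx', hx'']
  push_cast; ring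

theorem linRed_refl (b : ℝ) {v : ℝ → ℂ} (h0 : v 0 = 0) :
    linRed b (refl v) = -refl (linRed b v) := by
  funext x
  have h0' : refl v 0 = 0 := by simpa [refl] using h0
  have hi : ∫ y, ((φ y ^ 2 * dφ y : ℝ) : ℂ) * refl v y
      = -∫ y, ((φ y ^ 2 * dφ y : ℝ) : ℂ) * v y := by
    rw [← integral_neg_eq_self, ← integral_neg]
    congr 1; funext y
    simp only [refl, φ_neg, dφ_neg, neg_neg]; push_cast; ring
  rw [linRed_eq b h0', linFull_refl, hi]
  simp only [Pi.neg_apply, refl, linRed_eq b h0, φ_neg]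
  ring

theorem refl_mem_H1zero {v : ℝ → ℂ} (hv : v ∈ H1zero) : refl v ∈ H1zero :=
  ⟨refl_mem hv.1, by simpa [refl] using hv.2⟩

theorem transport_refl_mem {v : ℝ → ℂ} (hv : transport v ∈ H1) : transport (refl v) ∈ H1 := by
  rw [transport_refl]; exact H1.neg_mem (refl_mem hv)

/-! ### Functions supported on the right half-line -/

/-- The function `1 - φ²` on the right half-line. -/
def den (x : ℝ) : ℝ := 1 - Real.exp (-2 * x)

theorem den_pos {x : ℝ} (hx : 0 < x) : 0 < den x := by
  have : Real.exp (-2 * x) < 1 := Real.exp_lt_one_iff.2 (by linarith)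
  unfold den; linarith

theorem den_le_one (x : ℝ) : den x ≤ 1 := by
  unfold den; linarith [Real.exp_pos (-2 * x)]

theorem den_continuous : Continuous den := by unfold den; fun_prop

theorem den_zero : den 0 = 0 := by simp [den]

theorem hasDerivAt_den (x : ℝ) : HasDerivAt den (2 * Real.exp (-2 * x)) x := by
  have h : HasDerivAt (fun x : ℝ => Real.exp (-2 * x)) (Real.exp (-2 * x) * (-2 * 1)) x :=
    ((hasDerivAt_id x).const_mul (-2)).exp
  exact (h.const_sub 1).congr_deriv (by ring)

theorem φ_of_pos {x : ℝ} (hx : 0 < x) : φ x = Real.exp (-x) := by simp [φ, abs_of_pos hx]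

theorem dφ_of_pos {x : ℝ} (hx : 0 < x) : dφ x = -Real.exp (-x) := by
  simp [dφ, abs_of_pos hx, Real.sign_of_pos hx]

theorem exp_neg_sq (x : ℝ) : Real.exp (-x) ^ 2 = Real.exp (-2 * x) := by
  rw [← Real.exp_nat_mul]; congr 1; push_cast; ring

theorem one_sub_φ_sq_of_pos {x : ℝ} (hx : 0 < x) : 1 - φ x ^ 2 = den x := by
  rw [φ_of_pos hx, exp_neg_sq, den]

theorem φ_mul_dφ_of_pos {x : ℝ} (hx : 0 < x) : φ x * dφ x = den x - 1 := by
  rw [φ_of_pos hx, dφ_of_pos hx, den, ← exp_neg_sq]; ring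

/-- The extension by zero to the left half-line. -/
def half (h : ℝ → ℂ) (x : ℝ) : ℂ := if 0 < x then h x else 0

theorem half_of_pos (h : ℝ → ℂ) {x : ℝ} (hx : 0 < x) : half h x = h x := if_pos hx

theorem half_of_nonpos (h : ℝ → ℂ) {x : ℝ} (hx : x ≤ 0) : half h x = 0 := if_neg (not_lt.2 hx)

theorem half_zero (h : ℝ → ℂ) : half h 0 = 0 := half_of_nonpos h le_rfl

theorem half_eq_indicator (h : ℝ → ℂ) : half h = (Ioi (0 : ℝ)).indicator h := by
  funext x
  by_cases hx : 0 < x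
  · rw [half_of_pos h hx, indicator_of_mem (mem_Ioi.2 hx)]
  · rw [half_of_nonpos h (not_lt.1 hx), indicator_of_notMem (by simpa using hx)]

theorem half_memLp_iff {h : ℝ → ℂ} :
    MemLp (half h) 2 volume ↔ MemLp h 2 (volume.restrict (Ioi 0)) := by
  rw [half_eq_indicator, memLp_indicator_iff_restrict measurableSet_Ioi]

theorem half_hasDerivAt {h h' : ℝ → ℂ} (hd : ∀ x, 0 < x → HasDerivAt h (h' x) x) {x : ℝ}
    (hx : x ≠ 0) : HasDerivAt (half h) (half h' x) x := by
  rcases lt_or_gt_of_ne hx with hx | hx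
  · rw [half_of_nonpos h' hx.le]
    refine (hasDerivAt_const x (0 : ℂ)).congr_of_eventuallyEq ?_
    filter_upwards [isOpen_Iio.mem_nhds hx] with y hy
    exact half_of_nonpos h (le_of_lt hy)
  · rw [half_of_pos h' hx]
    refine (hd x hx).congr_of_eventuallyEq ?_
    filter_upwards [isOpen_Ioi.mem_nhds hx] with y hy
    exact half_of_pos h hy

theorem half_continuous {h h' : ℝ → ℂ} (hd : ∀ x, 0 < x → HasDerivAt h (h' x) x)
    (h0 : Filter.Tendsto h (nhdsWithin 0 (Ioi 0)) (nhds 0)) : Continuous (half h) := by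
  rw [continuous_iff_continuousAt]
  intro x
  by_cases hx : x = 0
  · subst hx
    rw [continuousAt_iff_continuous_left'_right']
    constructor
    · have : Filter.Tendsto (fun _ : ℝ => (0 : ℂ)) (nhdsWithin 0 (Iio 0)) (nhds 0) :=
        tendsto_const_nhds
      unfold ContinuousWithinAt
      rw [half_zero]
      refine this.congr' ?_
      filter_upwards [self_mem_nhdsWithin] with y hy
      exact (half_of_nonpos h (le_of_lt hy)).symm
    · unfold ContinuousWithinAt
      rw [half_zero]
      refine h0.congr' ?_
      filter_upwards [self_mem_nhdsWithin] with y hy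
      exact (half_of_pos h hy).symm
  · exact (half_hasDerivAt hd hx).continuousAt

/-- The limit `0` at the origin removes the jump of the extension, so the weak derivative has no
point mass there and is the extension by zero of `h'`. -/
theorem half_mem {h h' : ℝ → ℂ} (hd : ∀ x, 0 < x → HasDerivAt h (h' x) x)
    (h0 : Filter.Tendsto h (nhdsWithin 0 (Ioi 0)) (nhds 0))
    (hm : MemLp (half h) 2 volume) (hm' : MemLp (half h') 2 volume) : half h ∈ H1zero :=
  ⟨H1.of_hasDerivAt (half_continuous hd h0) (fun _ hx => half_hasDerivAt hd hx) hm hm',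
    half_zero h⟩

/-- Complex powers of `1 - φ²` on the right half-line. -/
def denPow (κ : ℂ) (x : ℝ) : ℂ := Complex.exp (κ * (Real.log (den x) : ℂ))

theorem norm_denPow (κ : ℂ) {x : ℝ} (hx : 0 < x) : ‖denPow κ x‖ = den x ^ κ.re := by
  rw [denPow, Complex.norm_exp, Complex.re_mul_ofReal, Real.rpow_def_of_pos (den_pos hx), mul_comm]

theorem denPow_add_one (κ : ℂ) {x : ℝ} (hx : 0 < x) : denPow (κ + 1) x = den x * denPow κ x := by
  rw [denPow, denPow, add_mul, Complex.exp_add, one_mul, ← Complex.ofReal_exp,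
    Real.exp_log (den_pos hx), mul_comm]

theorem hasDerivAt_denPow (κ : ℂ) {x : ℝ} (hx : 0 < x) :
    HasDerivAt (denPow κ) (κ * (2 * Real.exp (-2 * x) / den x) * denPow κ x) x := by
  have h := (((hasDerivAt_den x).log (den_pos hx).ne').ofReal_comp.const_mul κ).cexp
  refine h.congr_deriv ?_
  simp only [denPow]; push_cast; ring

/-! ### Functions bounded by the peakon together with their derivative -/

/-- `v ∈ H¹` and its derivative off the origin are bounded by `K φ`. -/
structure PeakonBound (K : ℝ) (v : ℝ → ℂ) : Prop where
  mem : v ∈ H1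
  norm_le : ∀ x, ‖v x‖ ≤ K * φ x
  deriv_le : ∀ x, x ≠ 0 → ∃ d, HasDerivAt v d x ∧ ‖d‖ ≤ K * φ x

theorem PeakonBound.add {K₁ K₂ : ℝ} {v w : ℝ → ℂ} (hv : PeakonBound K₁ v)
    (hw : PeakonBound K₂ w) : PeakonBound (K₁ + K₂) (v + w) where
  mem := H1.add_mem hv.mem hw.mem
  norm_le x := by
    rw [Pi.add_apply, add_mul]
    exact norm_add_le_of_le (hv.norm_le x) (hw.norm_le x)
  deriv_le x hx := by
    obtain ⟨d, hd, hd'⟩ := hv.deriv_le x hx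
    obtain ⟨e, he, he'⟩ := hw.deriv_le x hx
    refine ⟨d + e, hd.add he, ?_⟩
    rw [add_mul]
    exact norm_add_le_of_le hd' he'

theorem PeakonBound.smul {K : ℝ} {v : ℝ → ℂ} (hv : PeakonBound K v) (c : ℂ) :
    PeakonBound (‖c‖ * K) (c • v) where
  mem := H1.smul_mem c hv.mem
  norm_le x := by
    rw [Pi.smul_apply, norm_smul, mul_assoc]
    exact mul_le_mul_of_nonneg_left (hv.norm_le x) (norm_nonneg c)
  deriv_le x hx := by
    obtain ⟨d, hd, hd'⟩ := hv.deriv_le x hx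
    refine ⟨c • d, hd.const_smul c, ?_⟩
    rw [norm_smul, mul_assoc]
    exact mul_le_mul_of_nonneg_left hd' (norm_nonneg c)

theorem PeakonBound.mono {K K' : ℝ} {v : ℝ → ℂ} (hv : PeakonBound K v) (h : K ≤ K') :
    PeakonBound K' v where
  mem := hv.mem
  norm_le x := (hv.norm_le x).trans (mul_le_mul_of_nonneg_right h (φ_pos x).le)
  deriv_le x hx := by
    obtain ⟨d, hd, hd'⟩ := hv.deriv_le x hx
    exact ⟨d, hd, hd'.trans (mul_le_mul_of_nonneg_right h (φ_pos x).le)⟩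

theorem PeakonBound.sobSq_le {K : ℝ} {v : ℝ → ℂ} (hv : PeakonBound K v) :
    sobSq v ≤ K ^ 2 * (2 * ∫ x, φ x ^ 2) := by
  refine sobSq_le_of_bound (Filter.Eventually.of_forall hv.norm_le) ?_
  have h0 : ∀ᵐ x : ℝ ∂volume, x ≠ 0 := by
    rw [ae_iff]; simp
  filter_upwards [h0] with x hx
  obtain ⟨d, hd, hd'⟩ := hv.deriv_le x hx
  rwa [hd.deriv]

theorem peakonBound_φ : PeakonBound 1 (fun x => (φ x : ℂ)) where
  mem := φ_mem
  norm_le x := by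
    rw [Complex.norm_real, Real.norm_eq_abs, abs_of_pos (φ_pos x), one_mul]
  deriv_le x hx := by
    refine ⟨_, (hasDerivAt_φ hx).ofReal_comp, ?_⟩
    rw [Complex.norm_real, Real.norm_eq_abs, one_mul]
    exact abs_dφ_le x

/-! ### Pointwise bounds for the two halves of a convolution and for `Q` -/

theorem hasDerivAt_leftHalf {G : ℝ → ℂ} (h : GoodSource G) {x : ℝ} (hx : x ≠ 0) :
    HasDerivAt (leftHalf G) (-leftHalf G x + G x) x := by
  obtain ⟨-, hPd⟩ := primitive_facts h.integrable_exp
  have he : leftHalf G = fun x => (Real.exp (-1 * x) : ℂ) *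
      ∫ y in Iic x, (Real.exp y : ℂ) * G y := by
    funext x; rw [leftHalf_eq]; simp
  have hco : ContinuousAt (fun y : ℝ => (Real.exp y : ℂ) * G y) x :=
    (by fun_prop : Continuous fun x : ℝ => (Real.exp x : ℂ)).continuousAt.mul (h.continuousAt x hx)
  have := (hasDerivAt_cexp_real (-1) x).mul (hPd x hco)
  rw [he]
  refine this.congr_deriv ?_
  have hE : (Real.exp (-1 * x) : ℂ) * (Real.exp x : ℂ) = 1 := by
    rw [← Complex.ofReal_mul, ← Real.exp_add]; simp
  simp only [Complex.ofReal_neg, Complex.ofReal_one]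
  linear_combination G x * hE

theorem hasDerivAt_rightHalf {G : ℝ → ℂ} (h : GoodSource G) {x : ℝ} (hx : x ≠ 0) :
    HasDerivAt (rightHalf G) (rightHalf G x - G x) x := by
  obtain ⟨-, hPd⟩ := primitive_facts h.integrable_exp_neg
  have he : rightHalf G = fun x => (Real.exp (1 * x) : ℂ) *
      ((∫ y, (Real.exp (-y) : ℂ) * G y) - ∫ y in Iic x, (Real.exp (-y) : ℂ) * G y) := by
    funext x; rw [rightHalf_eq, integral_Ioi_eq h.integrable_exp_neg]; simp
  have hco : ContinuousAt (fun y : ℝ => (Real.exp (-y) : ℂ) * G y) x :=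
    (by fun_prop : Continuous fun x : ℝ => (Real.exp (-x) : ℂ)).continuousAt.mul
      (h.continuousAt x hx)
  have := (hasDerivAt_cexp_real 1 x).mul ((hPd x hco).const_sub (∫ y, (Real.exp (-y) : ℂ) * G y))
  rw [he]
  refine this.congr_deriv ?_
  have hE : (Real.exp (1 * x) : ℂ) * (Real.exp (-x) : ℂ) = 1 := by
    rw [← Complex.ofReal_mul, ← Real.exp_add]; simp
  simp only [Complex.ofReal_one]
  linear_combination -G x * hE

theorem conv_φ_eq {G : ℝ → ℂ} (h : GoodSource G) : conv φ G = leftHalf G + rightHalf G := by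
  funext x
  unfold conv leftHalf rightHalf
  rw [Pi.add_apply, ← integral_add_compl (measurableSet_Iic (a := x)) (h.integrable_φ x),
    compl_Iic]
  congr 1
  · refine setIntegral_congr_fun measurableSet_Iic fun y hy => ?_
    have hy' : y ≤ x := hy
    simp only [φ, abs_of_nonneg (sub_nonneg.2 hy'), neg_sub]
  · refine setIntegral_congr_fun measurableSet_Ioi fun y hy => ?_
    have hy' : x < y := hy
    simp only [φ, abs_of_neg (sub_neg.2 hy'), neg_neg]

theorem conv_dφ_eq {G : ℝ → ℂ} (h : GoodSource G) : conv dφ G = rightHalf G - leftHalf G := by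
  funext x
  unfold conv leftHalf rightHalf
  rw [Pi.sub_apply, ← integral_add_compl (measurableSet_Iic (a := x)) (h.integrable_dφ x),
    compl_Iic, add_comm, sub_eq_add_neg]
  congr 1
  · refine setIntegral_congr_fun measurableSet_Ioi fun y hy => ?_
    have hy' : x - y < 0 := sub_neg.2 hy
    simp only [dφ, abs_of_neg hy', Real.sign_of_neg hy', neg_neg, one_mul]
  · rw [← integral_neg, integral_Iic_eq_integral_Iio, integral_Iic_eq_integral_Iio]
    refine setIntegral_congr_fun measurableSet_Iio fun y hy => ?_
    have hy' : 0 < x - y := sub_pos.2 hy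
    simp only [dφ, abs_of_pos hy', Real.sign_of_pos hy', neg_sub, neg_mul, one_mul,
      Complex.ofReal_neg]

/-- The constant in the bound of the two halves of a convolution. -/
def convConst : ℝ := ∫ x, 2 * φ x ^ 2

theorem GoodSource.integral_norm_le {G : ℝ → ℂ} (hb : ∀ y, ‖G y‖ ≤ 2 * φ y ^ 3) :
    ∫ y, ‖(Real.exp |y| : ℂ) * G y‖ ≤ convConst := by
  refine integral_mono_of_nonneg (Filter.Eventually.of_forall fun x => norm_nonneg _)
    (integrable_φ_sq.const_mul 2) (Filter.Eventually.of_forall fun y => ?_)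
  have hE : Real.exp |y| * φ y = 1 := by unfold φ; rw [← Real.exp_add]; simp
  simp only [norm_mul, Complex.norm_real, Real.norm_eq_abs, Real.abs_exp]
  calc Real.exp |y| * ‖G y‖ ≤ Real.exp |y| * (2 * φ y ^ 3) :=
        mul_le_mul_of_nonneg_left (hb y) (Real.exp_pos _).le
    _ = 2 * φ y ^ 2 := by linear_combination 2 * φ y ^ 2 * hE

theorem two_φ_cube_le (y : ℝ) : 2 * φ y ^ 3 ≤ 2 * φ y := by
  have h := φ_pos y
  have h1 := φ_le_one y
  nlinarith [mul_le_mul h1 h1 h.le zero_le_one, mul_pos h h]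

/-- The kernel is at most `φ x * e^{|y|}`. The factor `e^{|y|}` costs one of the three powers of `φ`
in the source and leaves an integrable `φ²`. The derivative off the origin is again the half
convolution, up to sign, plus the source itself. -/
theorem peakonBound_leftHalf {G : ℝ → ℂ} (h : GoodSource G) (hb : ∀ y, ‖G y‖ ≤ 2 * φ y ^ 3) :
    PeakonBound (convConst + 2) (leftHalf G) := by
  have hn : ∀ x, ‖leftHalf G x‖ ≤ convConst * φ x := fun x => by
    refine (h.norm_setIntegral_le x (fun y => Real.exp (y - x)) _ measurableSet_Iic ?_).trans
      (mul_le_mul_of_nonneg_right (GoodSource.integral_norm_le hb) (φ_pos x).le)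
    intro y hy
    rw [Real.abs_exp, ← Real.exp_add, Real.exp_le_exp]
    have hy' : y ≤ x := hy
    rcases abs_cases x with h1 | h1 <;> rcases abs_cases y with h2 | h2 <;> linarith
  refine ⟨leftHalf_mem h, fun x => (hn x).trans (by nlinarith [φ_pos x]), fun x hx =>
    ⟨_, hasDerivAt_leftHalf h hx, ?_⟩⟩
  rw [add_mul]
  refine norm_add_le_of_le ?_ ((hb x).trans (two_φ_cube_le x))
  rw [norm_neg]; exact hn x

theorem peakonBound_rightHalf {G : ℝ → ℂ} (h : GoodSource G) (hb : ∀ y, ‖G y‖ ≤ 2 * φ y ^ 3) :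
    PeakonBound (convConst + 2) (rightHalf G) := by
  have hn : ∀ x, ‖rightHalf G x‖ ≤ convConst * φ x := fun x => by
    refine (h.norm_setIntegral_le x (fun y => Real.exp (x - y)) _ measurableSet_Ioi ?_).trans
      (mul_le_mul_of_nonneg_right (GoodSource.integral_norm_le hb) (φ_pos x).le)
    intro y hy
    rw [Real.abs_exp, ← Real.exp_add, Real.exp_le_exp]
    have hy' : x < y := hy
    rcases abs_cases x with h1 | h1 <;> rcases abs_cases y with h2 | h2 <;> linarith
  refine ⟨rightHalf_mem h, fun x => (hn x).trans (by nlinarith [φ_pos x]), fun x hx =>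
    ⟨_, hasDerivAt_rightHalf h hx, ?_⟩⟩
  rw [add_mul]
  exact norm_sub_le_of_le (hn x) ((hb x).trans (two_φ_cube_le x))

/-- The operator `Q` maps functions of `H¹` bounded by `φ` to uniformly bounded ones. -/
theorem exists_peakonBound_Q (b : ℝ) :
    ∃ K, ∀ v ∈ H1, (∀ x, ‖v x‖ ≤ φ x) → PeakonBound K (Q b v) := by
  refine ⟨‖(b : ℂ) - 3‖ * ((convConst + 2 + (convConst + 2)) +
    ‖(-2 : ℂ)‖ * (convConst + 2 + ‖(-1 : ℂ)‖ * (convConst + 2))), fun v hv hb => ?_⟩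
  have b1 : ∀ y, ‖((2 * φ y * dφ y : ℝ) : ℂ) * v y‖ ≤ 2 * φ y ^ 3 := fun y => by
    rw [norm_mul, Complex.norm_real, Real.norm_eq_abs, abs_mul, abs_mul, abs_two,
      abs_of_pos (φ_pos y)]
    have h := φ_pos y
    calc 2 * φ y * |dφ y| * ‖v y‖ ≤ 2 * φ y * φ y * φ y := by
          gcongr
          · exact abs_dφ_le y
          · exact hb y
      _ = 2 * φ y ^ 3 := by ring
  have b2 : ∀ y, ‖((φ y ^ 2 : ℝ) : ℂ) * v y‖ ≤ 2 * φ y ^ 3 := fun y => by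
    rw [norm_mul, Complex.norm_real, Real.norm_eq_abs, abs_of_nonneg (sq_nonneg _)]
    have h := φ_pos y
    calc φ y ^ 2 * ‖v y‖ ≤ φ y ^ 2 * φ y := by gcongr; exact hb y
      _ ≤ 2 * φ y ^ 3 := by nlinarith [pow_pos h 3]
  have g1 := goodSource_fst hv
  have g2 := goodSource_snd hv
  set G₁ : ℝ → ℂ := fun y => ((2 * φ y * dφ y : ℝ) : ℂ) * v y with hG₁
  set G₂ : ℝ → ℂ := fun y => ((φ y ^ 2 : ℝ) : ℂ) * v y with hG₂
  have e : Q b v = ((b : ℂ) - 3) • ((leftHalf G₁ + rightHalf G₁) +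
      (-2 : ℂ) • (rightHalf G₂ + (-1 : ℂ) • leftHalf G₂)) := by
    funext x
    unfold Q
    rw [← hG₁, ← hG₂, conv_φ_eq g1, conv_dφ_eq g2]
    simp only [Pi.add_apply, Pi.sub_apply, Pi.smul_apply, smul_eq_mul]
    ring
  rw [e]
  exact (((peakonBound_leftHalf g1 b1).add (peakonBound_rightHalf g1 b1)).add
    (((peakonBound_rightHalf g2 b2).add ((peakonBound_leftHalf g2 b2).smul _)).smul _)).smul _

/-! ### Approximate eigenfunctions concentrated at the peak -/

/-- The function `e^{-x} (1 - φ²)^κ` on the right half-line, extended by zero. -/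
def peakFun (κ : ℂ) : ℝ → ℂ := half fun x => (Real.exp (-x) : ℂ) * denPow κ x

/-- The derivative of `peakFun κ`. -/
def peakFun' (κ : ℂ) (x : ℝ) : ℂ :=
  (2 * κ * (Real.exp (-2 * x) / den x) - 1) * ((Real.exp (-x) : ℂ) * denPow κ x)

theorem hasDerivAt_exp_mul_denPow (κ : ℂ) {x : ℝ} (hx : 0 < x) :
    HasDerivAt (fun x : ℝ => (Real.exp (-x) : ℂ) * denPow κ x) (peakFun' κ x) x := by
  have h1 := hasDerivAt_cexp_real (-1) x
  simp only [neg_mul, one_mul] at h1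
  refine (h1.mul (hasDerivAt_denPow κ hx)).congr_deriv ?_
  simp only [peakFun']; push_cast; ring

theorem hasDerivAt_peakFun (κ : ℂ) {x : ℝ} (hx : x ≠ 0) :
    HasDerivAt (peakFun κ) (half (peakFun' κ) x) x :=
  half_hasDerivAt (fun _ h => hasDerivAt_exp_mul_denPow κ h) hx

theorem norm_peakFun (κ : ℂ) {x : ℝ} (hx : 0 < x) :
    ‖(Real.exp (-x) : ℂ) * denPow κ x‖ = Real.exp (-x) * den x ^ κ.re := by
  rw [norm_mul, norm_denPow κ hx, Complex.norm_real, Real.norm_eq_abs, Real.abs_exp]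

theorem norm_peakFun_le {κ : ℂ} (hκ : 0 ≤ κ.re) (x : ℝ) : ‖peakFun κ x‖ ≤ φ x := by
  by_cases hx : 0 < x
  · rw [peakFun, half_of_pos _ hx, norm_peakFun κ hx, φ_of_pos hx]
    exact mul_le_of_le_one_right (Real.exp_pos _).le
      (Real.rpow_le_one (den_pos hx).le (den_le_one x) hκ)
  · rw [peakFun, half_of_nonpos _ (not_lt.1 hx), norm_zero]
    exact (φ_pos x).le

/-- Isolates the singular power `κ - 1` at the peak. The prefactor is bounded and tends to `2κ ≠ 0`
when `Re κ > 0`, so the formula serves for both upper and lower bounds of the derivative. -/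
theorem peakFun'_eq (κ : ℂ) {x : ℝ} (hx : 0 < x) :
    peakFun' κ x = (2 * κ * (Real.exp (-2 * x) : ℂ) - (den x : ℂ)) *
      ((Real.exp (-x) : ℂ) * denPow (κ - 1) x) := by
  have h := denPow_add_one (κ - 1) hx
  rw [sub_add_cancel] at h
  have hd : (den x : ℂ) ≠ 0 := by exact_mod_cast (den_pos hx).ne'
  rw [peakFun', h]
  field_simp

theorem norm_peakFun'_le (κ : ℂ) {x : ℝ} (hx : 0 < x) :
    ‖peakFun' κ x‖ ≤ (1 + 2 * ‖κ‖) * (Real.exp (-x) * den x ^ (κ.re - 1)) := by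
  rw [peakFun'_eq κ hx, norm_mul, norm_peakFun (κ - 1) hx, Complex.sub_re, Complex.one_re]
  refine mul_le_mul_of_nonneg_right ?_ (mul_nonneg (Real.exp_pos _).le
    (Real.rpow_nonneg (den_pos hx).le _))
  refine (norm_sub_le _ _).trans ?_
  rw [norm_mul, norm_mul, Complex.norm_real, Complex.norm_real, Real.norm_eq_abs, Real.norm_eq_abs,
    Real.abs_exp, abs_of_pos (den_pos hx), Complex.norm_two]
  have h1 : Real.exp (-2 * x) ≤ 1 := Real.exp_le_one_iff.2 (by linarith)
  nlinarith [norm_nonneg κ, den_le_one x]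

theorem tendsto_peakFun {κ : ℂ} (hκ : 0 < κ.re) : Filter.Tendsto
    (fun x : ℝ => (Real.exp (-x) : ℂ) * denPow κ x) (nhdsWithin 0 (Ioi 0)) (nhds 0) := by
  have h1 : Continuous fun x : ℝ => Real.exp (-x) * den x ^ κ.re :=
    (by fun_prop : Continuous fun x : ℝ => Real.exp (-x)).mul
      (den_continuous.rpow_const fun _ => Or.inr hκ.le)
  have h2 := (h1.tendsto 0).mono_left (nhdsWithin_le_nhds (s := Ioi 0))
  rw [den_zero, Real.zero_rpow hκ.ne', mul_zero] at h2
  refine squeeze_zero_norm' ?_ h2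
  filter_upwards [self_mem_nhdsWithin] with x hx
  exact (norm_peakFun κ hx).le

theorem continuousOn_peakFun' (κ : ℂ) : ContinuousOn (peakFun' κ) (Ioi 0) := by
  intro x hx
  have hx' : 0 < x := hx
  have hd : (den x : ℂ) ≠ 0 := by exact_mod_cast (den_pos hx').ne'
  have h1 := (hasDerivAt_denPow κ hx').continuousAt
  have h2 : ContinuousAt (fun x => (den x : ℂ)) x :=
    (Complex.continuous_ofReal.comp den_continuous).continuousAt
  refine ContinuousAt.continuousWithinAt ?_
  unfold peakFun'
  exact ((continuousAt_const.mul ((by fun_prop : Continuous fun x : ℝ =>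
    (Real.exp (-2 * x) : ℂ)).continuousAt.div h2 hd)).sub continuousAt_const).mul
    ((by fun_prop : Continuous fun x : ℝ => (Real.exp (-x) : ℂ)).continuousAt.mul h1)

theorem peakFun_memLp {κ : ℂ} (hκ : 0 < κ.re) : MemLp (peakFun κ) 2 volume := by
  refine MemLp.of_φ_bound (K := 1) ?_ (Filter.Eventually.of_forall fun x => by
    rw [one_mul]; exact norm_peakFun_le hκ.le x)
  exact (half_continuous (fun _ h => hasDerivAt_exp_mul_denPow κ h)
    (tendsto_peakFun hκ)).aestronglyMeasurable

/-- A primitive of `e^{-2x} (1 - φ²)^{2s-1}`. -/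
theorem hasDerivAt_den_rpow {s : ℝ} (hs : s ≠ 0) {x : ℝ} (hx : 0 < x) :
    HasDerivAt (fun x => den x ^ (2 * s) / (4 * s))
      (Real.exp (-2 * x) * den x ^ (2 * s - 1)) x := by
  refine (((hasDerivAt_den x).rpow_const (p := 2 * s) (Or.inl (den_pos hx).ne')).div_const
    (4 * s)).congr_deriv ?_
  field_simp; ring

theorem tendsto_den : Filter.Tendsto den Filter.atTop (nhds 1) := by
  have h : Filter.Tendsto (fun x : ℝ => Real.exp (-2 * x)) Filter.atTop (nhds 0) :=
    Real.tendsto_exp_atBot.comp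
      (Filter.tendsto_id.const_mul_atTop_of_neg (by norm_num : (-2 : ℝ) < 0))
  have := h.const_sub 1
  rwa [sub_zero] at this

/-- A nonnegative function whose primitive is continuous at `0` and converges at infinity is
integrable. For small `s` the integrand itself is unbounded at `0`. -/
theorem integrableOn_den_rpow {s : ℝ} (hs : 0 < s) :
    IntegrableOn (fun x => Real.exp (-2 * x) * den x ^ (2 * s - 1)) (Ioi 0) := by
  have hc : Continuous fun x => den x ^ (2 * s) / (4 * s) :=
    (den_continuous.rpow_const fun _ => Or.inr (by linarith)).div_const _
  refine integrableOn_Ioi_deriv_of_nonneg (l := 1 ^ (2 * s) / (4 * s)) hc.continuousWithinAt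
    (fun x hx => hasDerivAt_den_rpow hs.ne' hx)
    (fun x hx => mul_nonneg (Real.exp_pos _).le (Real.rpow_nonneg (den_pos hx).le _)) ?_
  exact (tendsto_den.rpow_const (Or.inr (by linarith))).div_const _

theorem exp_mul_den_rpow_sq (t : ℝ) {x : ℝ} (hx : 0 < x) :
    (Real.exp (-x) * den x ^ t) ^ 2 = Real.exp (-2 * x) * den x ^ (2 * t) := by
  rw [mul_pow, exp_neg_sq, ← Real.rpow_natCast, ← Real.rpow_mul (den_pos hx).le, mul_comm t]
  norm_num

/-- The square of the derivative is controlled by `e^{-2x} den^{2s-1}` with `s = Re κ - 1/2`. This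
is where the `H¹` threshold `1/2`, and with it the critical line `Re z = b - 3`, comes from. -/
theorem peakFun'_memLp {κ : ℂ} (hκ : 1 / 2 < κ.re) : MemLp (half (peakFun' κ)) 2 volume := by
  rw [half_memLp_iff]
  have hm := (continuousOn_peakFun' κ).aestronglyMeasurable (μ := volume) measurableSet_Ioi
  rw [memLp_two_iff_integrable_sq_norm hm]
  refine Integrable.mono' ((integrableOn_den_rpow (s := κ.re - 1 / 2) (by linarith)).const_mul
    ((1 + 2 * ‖κ‖) ^ 2)) (hm.norm.pow 2) ?_
  filter_upwards [ae_restrict_mem measurableSet_Ioi] with x hx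
  have h := norm_peakFun'_le κ hx
  rw [Real.norm_of_nonneg (by positivity)]
  calc ‖peakFun' κ x‖ ^ 2 ≤ ((1 + 2 * ‖κ‖) * (Real.exp (-x) * den x ^ (κ.re - 1))) ^ 2 := by
        gcongr
    _ = _ := by
        rw [mul_pow, exp_mul_den_rpow_sq _ hx]
        congr 4; ring

theorem peakFun_mem {κ : ℂ} (hκ : 1 / 2 < κ.re) : peakFun κ ∈ H1zero :=
  half_mem (fun _ h => hasDerivAt_exp_mul_denPow κ h) (tendsto_peakFun (by linarith))
    (peakFun_memLp (by linarith)) (peakFun'_memLp hκ)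

theorem peakFun_add_one (κ : ℂ) {x : ℝ} (hx : 0 < x) :
    peakFun (κ + 1) x = den x * peakFun κ x := by
  rw [peakFun, peakFun, half_of_pos _ hx, half_of_pos _ hx, denPow_add_one κ hx]; ring

/-- On the right half-line `e^{-2x} = 1 - den`, so transport leaves the span of the peak functions
with exponents `κ` and `κ + 1` closed up to one step: the leading coefficient is `2κ` and the error
is less singular by one power. -/
theorem transport_peakFun (κ : ℂ) :
    transport (peakFun κ) = (2 * κ) • peakFun κ - (2 * κ + 1) • peakFun (κ + 1) := by
  funext x
  rcases lt_trichotomy x 0 with hx | hx | hx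
  · rw [transport, (hasDerivAt_peakFun κ hx.ne).deriv]
    simp [peakFun, half_of_nonpos _ hx.le]
  · subst hx
    simp [transport_zero, peakFun, half_zero]
  · have hd : (den x : ℂ) ≠ 0 := by exact_mod_cast (den_pos hx).ne'
    have hE : (Real.exp (-2 * x) : ℂ) = 1 - (den x : ℂ) := by rw [den]; push_cast; ring
    rw [transport, (hasDerivAt_peakFun κ hx.ne').deriv, one_sub_φ_sq_of_pos hx]
    simp only [Pi.sub_apply, Pi.smul_apply, smul_eq_mul, peakFun_add_one κ hx]
    rw [half_of_pos _ hx, peakFun, half_of_pos _ hx, peakFun', hE]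
    field_simp
    ring

theorem φ_dφ_mul_peakFun (κ : ℂ) (x : ℝ) :
    (φ x : ℂ) * (dφ x : ℂ) * peakFun κ x = peakFun (κ + 1) x - peakFun κ x := by
  by_cases hx : 0 < x
  · rw [← Complex.ofReal_mul, φ_mul_dφ_of_pos hx, peakFun_add_one κ hx]; push_cast; ring
  · simp [peakFun, half_of_nonpos _ (not_lt.1 hx)]

/-- From `Re κ = 1` on, the power `κ - 1` in the derivative is no longer singular. This is used for
the exponent `κ + 1` of the remainder. -/
theorem peakBound_peakFun {κ : ℂ} (hκ : 1 ≤ κ.re) : PeakonBound (1 + 2 * ‖κ‖) (peakFun κ) where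
  mem := (peakFun_mem (by linarith)).1
  norm_le x := (norm_peakFun_le (by linarith) x).trans (by
    nlinarith [φ_pos x, norm_nonneg κ])
  deriv_le x hx := by
    refine ⟨_, hasDerivAt_peakFun κ hx, ?_⟩
    by_cases h : 0 < x
    · rw [half_of_pos _ h, φ_of_pos h]
      refine (norm_peakFun'_le κ h).trans (mul_le_mul_of_nonneg_left ?_ (by positivity))
      exact mul_le_of_le_one_right (Real.exp_pos _).le
        (Real.rpow_le_one (den_pos h).le (den_le_one x) (by linarith))
    · rw [half_of_nonpos _ (not_lt.1 h), norm_zero]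
      have := φ_pos x
      positivity

/-- Near the peak the squared derivative is comparable to `x^{2ε-1}`, whose integral blows up like
`1/ε`. The constant is `1/4 * (1/16) / 4`: the squared prefactor, a lower bound for `(1/4)^{2ε}`,
and the factor `4` in the primitive. -/
theorem le_sobSq_peakFun {κ : ℂ} {ε : ℝ} (hε : 0 < ε) (hε1 : ε ≤ 1) (hκ : κ.re = 1 / 2 + ε) :
    (1 / 256) / ε ≤ sobSq (peakFun κ) := by
  -- Chosen so that `e^{-2δ} = 3/4` and `den δ = 1/4`. On `(0, δ]` the real part of the prefactor
  -- `2κ e^{-2x} - den x` is then at least `3/4 - 1/4 = 1/2`.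
  set δ : ℝ := Real.log (4 / 3) / 2 with hδ
  have hlog : 0 < Real.log (4 / 3) := Real.log_pos (by norm_num)
  have hδ0 : 0 < δ := by positivity
  have hEδ : Real.exp (-2 * δ) = 3 / 4 := by
    have : -2 * δ = -Real.log (4 / 3) := by rw [hδ]; ring
    rw [this, Real.exp_neg, Real.exp_log (by norm_num)]; norm_num
  have hdδ : den δ = 1 / 4 := by rw [den, hEδ]; norm_num
  have hmem := peakFun_mem (κ := κ) (by linarith)
  have hc : Continuous fun x => den x ^ (2 * ε) / (4 * ε) :=
    (den_continuous.rpow_const fun _ => Or.inr (by linarith)).div_const _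
  have hint : IntervalIntegrable (fun x => Real.exp (-2 * x) * den x ^ (2 * ε - 1))
      volume 0 δ := by
    rw [intervalIntegrable_iff_integrableOn_Ioc_of_le hδ0.le]
    exact (integrableOn_den_rpow hε).mono_set Ioc_subset_Ioi_self
  have hFTC := intervalIntegral.integral_eq_sub_of_hasDerivAt_of_le hδ0.le hc.continuousOn
    (fun x hx => hasDerivAt_den_rpow hε.ne' hx.1) hint
  rw [den_zero, Real.zero_rpow (by linarith), hdδ, zero_div, sub_zero,
    intervalIntegral.integral_of_le hδ0.le] at hFTC
  have hpow : (1 / 16 : ℝ) ≤ (1 / 4) ^ (2 * ε) := by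
    calc (1 / 16 : ℝ) = (1 / 4) ^ (2 : ℝ) := by norm_num
      _ ≤ (1 / 4) ^ (2 * ε) :=
        Real.rpow_le_rpow_of_exponent_ge (by norm_num) (by norm_num) (by linarith)
  have hder : ∫ x in Ioc 0 δ, ‖deriv (peakFun κ) x‖ ^ 2 ≤ ∫ x, ‖deriv (peakFun κ) x‖ ^ 2 :=
    setIntegral_le_integral (integrable_sq (H1.memLp_deriv hmem.1))
      (Filter.Eventually.of_forall fun x => by positivity)
  have hlow : ∫ x in Ioc 0 δ, (1 / 4) * (Real.exp (-2 * x) * den x ^ (2 * ε - 1)) ≤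
      ∫ x in Ioc 0 δ, ‖deriv (peakFun κ) x‖ ^ 2 := by
    refine setIntegral_mono_on ?_ (integrable_sq (H1.memLp_deriv hmem.1)).integrableOn
      measurableSet_Ioc fun x hx => ?_
    · exact ((integrableOn_den_rpow hε).mono_set Ioc_subset_Ioi_self).const_mul _
    have hx0 : 0 < x := hx.1
    have hE : 3 / 4 ≤ Real.exp (-2 * x) := by
      rw [← hEδ, Real.exp_le_exp]; linarith [hx.2]
    rw [(hasDerivAt_peakFun κ hx0.ne').deriv, half_of_pos _ hx0, peakFun'_eq κ hx0, norm_mul,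
      norm_peakFun (κ - 1) hx0, mul_pow, exp_mul_den_rpow_sq _ hx0, Complex.sub_re, Complex.one_re,
      hκ]
    have h2 : 2 * (1 / 2 + ε - 1) = 2 * ε - 1 := by ring
    rw [h2]
    refine mul_le_mul_of_nonneg_right ?_ (mul_nonneg (Real.exp_pos _).le
      (Real.rpow_nonneg (den_pos hx0).le _))
    have h3 : (1 / 2 : ℝ) ≤ ‖2 * κ * (Real.exp (-2 * x) : ℂ) - (den x : ℂ)‖ := by
      refine le_trans ?_ (Complex.re_le_norm _)
      rw [Complex.sub_re, Complex.re_mul_ofReal, Complex.ofReal_re]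
      have : (2 * κ).re = 1 + 2 * ε := by simp [hκ]; ring
      rw [this, den]
      nlinarith
    nlinarith
  rw [integral_const_mul, hFTC] at hlow
  have hfin : (1 / 256) / ε ≤ 1 / 4 * ((1 / 4) ^ (2 * ε) / (4 * ε)) := by
    have : 1 / 4 * ((1 / 4 : ℝ) ^ (2 * ε) / (4 * ε)) = ((1 / 4) ^ (2 * ε) / 16) / ε := by
      field_simp; norm_num
    rw [this]
    exact div_le_div_of_nonneg_right (by linarith) hε.le
  have h0 : 0 ≤ ∫ x, ‖peakFun κ x‖ ^ 2 := by positivity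
  unfold sobSq
  linarith

/-! ### Approximate eigenfunctions exclude a bounded inverse -/

/-- `A - z` has no bounded inverse, since there are `v` with `v(0) = 0` whose norm is
large compared to that of `(A - z) v`. -/
def HasApproxEigenfunctions (A : (ℝ → ℂ) → ℝ → ℂ) (z : ℂ) : Prop :=
  ∃ K c : ℝ, 0 < c ∧ ∀ ε : ℝ, 0 < ε → ε ≤ 1 → ∃ v ∈ H1zero, transport v ∈ H1 ∧
    c / ε ≤ sobSq v ∧ sobSq (A v - z • v) ≤ K * (1 + ε ^ 2 * sobSq v)

theorem HasApproxEigenfunctions.not_bounded {A : (ℝ → ℂ) → ℝ → ℂ} {z : ℂ}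
    (h : HasApproxEigenfunctions A z) (C : ℝ) :
    ∃ v ∈ H1zero, transport v ∈ H1 ∧ C * h1Norm (A v - z • v) < h1Norm v := by
  obtain ⟨K, c, hc, h⟩ := h
  by_contra! hcon
  set M : ℝ := |C ^ 2 * K| with hM
  have hM0 : 0 ≤ M := abs_nonneg _
  -- With `S = sobSq v`, a bounded inverse would give `S ≤ M (1 + ε² S)`. The second entry of the
  -- minimum yields `M ε² ≤ 1/2`, hence `S ≤ 2M`, while the third forces `S ≥ 2M + 2`.
  set ε : ℝ := min 1 (min (1 / (2 * M + 2)) (c / (2 * M + 2))) with hε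
  have hε0 : 0 < ε := by positivity
  have h1 : ε ≤ 1 := min_le_left _ _
  have h2 : ε * (2 * M + 2) ≤ 1 :=
    (le_div_iff₀ (by positivity)).1 ((min_le_right _ _).trans (min_le_left _ _))
  have h3 : ε * (2 * M + 2) ≤ c :=
    (le_div_iff₀ (by positivity)).1 ((min_le_right _ _).trans (min_le_right _ _))
  obtain ⟨v, hv, hvt, hlow, hup⟩ := h ε hε0 h1
  have h4 : 2 * M + 2 ≤ sobSq v := le_trans (by rw [le_div_iff₀ hε0]; linarith) hlow
  have h5 : h1Norm v ^ 2 ≤ (C * h1Norm (A v - z • v)) ^ 2 := by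
    have := h1Norm_nonneg v
    gcongr
    exact hcon v hv hvt
  rw [mul_pow, h1Norm_sq, h1Norm_sq] at h5
  have h6 : sobSq v ≤ M * (1 + ε ^ 2 * sobSq v) := by
    calc sobSq v ≤ C ^ 2 * (K * (1 + ε ^ 2 * sobSq v)) := h5.trans (by gcongr)
      _ = C ^ 2 * K * (1 + ε ^ 2 * sobSq v) := by ring
      _ ≤ M * (1 + ε ^ 2 * sobSq v) := by
        have := sobSq_nonneg v
        gcongr
        exact le_abs_self _
  have h7 : M * ε ^ 2 ≤ 1 / 2 := by nlinarith
  nlinarith [sobSq_nonneg v]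

theorem HasApproxEigenfunctions.neg {A : (ℝ → ℂ) → ℝ → ℂ} {z : ℂ}
    (h : HasApproxEigenfunctions A z) (hA : ∀ v ∈ H1zero, A (refl v) = -refl (A v)) :
    HasApproxEigenfunctions A (-z) := by
  obtain ⟨K, c, hc, h⟩ := h
  refine ⟨K, c, hc, fun ε h0 h1 => ?_⟩
  obtain ⟨v, hv, hvt, hlow, hup⟩ := h ε h0 h1
  refine ⟨refl v, refl_mem_H1zero hv, transport_refl_mem hvt, ?_, ?_⟩
  · rwa [sobSq_refl]
  · have e : A (refl v) - -z • refl v = -refl (A v - z • v) := by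
      rw [hA v hv]
      funext x
      simp only [refl, Pi.sub_apply, Pi.neg_apply, Pi.smul_apply, smul_eq_mul]
      ring
    rw [e, sobSq_neg, sobSq_refl, sobSq_refl]
    exact hup

/-- Puts an error of the form `2ε w` plus a uniformly bounded remainder into the shape required by
`HasApproxEigenfunctions`; the `8` is `2 * |2|²`. -/
theorem sobSq_smul_add_le {w R : ℝ → ℂ} {ε K : ℝ} (hw : w ∈ H1) (hR : PeakonBound K R) :
    sobSq ((2 * (ε : ℂ)) • w + R) ≤
      (8 + 2 * (K ^ 2 * (2 * ∫ x, φ x ^ 2))) * (1 + ε ^ 2 * sobSq w) := by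
  have h1 := sobSq_add_le (H1.smul_mem (2 * (ε : ℂ)) hw) hR.mem
  have h2 : ‖2 * (ε : ℂ)‖ ^ 2 = 4 * ε ^ 2 := by
    rw [norm_mul, Complex.norm_real, Real.norm_eq_abs, mul_pow, sq_abs, Complex.norm_two]; norm_num
  rw [sobSq_smul, h2] at h1
  have h3 := hR.sobSq_le
  have h4 : 0 ≤ K ^ 2 * (2 * ∫ x, φ x ^ 2) := by positivity
  have h5 : 0 ≤ ε ^ 2 * sobSq w := mul_nonneg (sq_nonneg _) (sobSq_nonneg w)
  nlinarith [mul_nonneg h4 h5]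

/-! ### The linearized operators on the peak functions -/

/-- Transport contributes `2κ` and the local term `b - 4` to the coefficient of `peakFun κ`; their
sum is `b - 3 + iτ + 2ε`. The same two terms give the coefficient `-(2κ + 1) + (4 - b)` of `peakFun
(κ + 1)`. -/
theorem linFull_peakFun (b τ ε : ℝ) {κ : ℂ} (hκ : 2 * κ = 1 + τ * Complex.I + 2 * ε) :
    linFull b (peakFun κ) - ((b : ℂ) - 3 + τ * Complex.I) • peakFun κ =
      (2 * (ε : ℂ)) • peakFun κ + ((2 - (b : ℂ) - τ * Complex.I - 2 * ε) • peakFun (κ + 1)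
        + Q b (peakFun κ)) := by
  funext x
  have h0 : peakFun κ 0 = 0 := half_zero _
  have h1 := φ_dφ_mul_peakFun κ x
  simp only [Pi.sub_apply, Pi.add_apply, Pi.smul_apply, smul_eq_mul, linFull, transport_peakFun, h0]
  linear_combination (peakFun κ x - peakFun (κ + 1) x) * hκ + (4 - (b : ℂ)) * h1

/-- The point is uniformity in `ε`: `Re (κ + 1) > 1`, so `peakFun (κ + 1)` has no singular
derivative, and `Q` only sees the bound `|peakFun κ| ≤ φ`, not the derivative that blows up. -/
theorem exists_peakonBound_remainder (b τ : ℝ) : ∃ K, ∀ (ε : ℝ) (κ : ℂ), 0 < ε → ε ≤ 1 →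
    2 * κ = 1 + τ * Complex.I + 2 * ε →
      PeakonBound K ((2 - (b : ℂ) - τ * Complex.I - 2 * ε) • peakFun (κ + 1)
        + Q b (peakFun κ)) := by
  obtain ⟨K, hK⟩ := exists_peakonBound_Q b
  refine ⟨(‖(2 - (b : ℂ) - τ * Complex.I)‖ + 2) * (1 + 2 * (‖1 + τ * Complex.I‖ + 3)) + K,
    fun ε κ h0 h1 hκ => ?_⟩
  have hre : κ.re = 1 / 2 + ε := by
    have := congrArg Complex.re hκ
    simp at this
    linarith
  have hε2 : ‖2 * (ε : ℂ)‖ ≤ 2 := by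
    rw [norm_mul, Complex.norm_real, Real.norm_eq_abs, abs_of_pos h0, Complex.norm_two]; linarith
  have hn1 : ‖2 - (b : ℂ) - τ * Complex.I - 2 * ε‖ ≤ ‖(2 - (b : ℂ) - τ * Complex.I)‖ + 2 :=
    norm_sub_le_of_le le_rfl hε2
  have hn2 : ‖κ + 1‖ ≤ ‖1 + τ * Complex.I‖ + 3 := by
    have h2 : ‖2 * κ‖ ≤ ‖1 + τ * Complex.I‖ + 2 := by
      rw [hκ]; exact norm_add_le_of_le le_rfl hε2
    rw [norm_mul, Complex.norm_two] at h2
    have h3 := norm_add_le κ 1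
    rw [norm_one] at h3
    linarith [norm_nonneg κ]
  have hP := (peakBound_peakFun (κ := κ + 1) (by simp [hre]; linarith)).smul
    (2 - (b : ℂ) - τ * Complex.I - 2 * ε)
  refine (hP.mono ?_).add (hK _ (peakFun_mem (by rw [hre]; linarith)).1
    (norm_peakFun_le (by rw [hre]; linarith)))
  gcongr

theorem exists_exponent (τ ε : ℝ) : ∃ κ : ℂ, 2 * κ = 1 + τ * Complex.I + 2 * ε ∧
    κ.re = 1 / 2 + ε := by
  refine ⟨(1 + τ * Complex.I + 2 * ε) / 2, by ring, ?_⟩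
  simp
  ring

theorem hasApproxEigenfunctions_linFull (b τ : ℝ) :
    HasApproxEigenfunctions (linFull b) ((b : ℂ) - 3 + τ * Complex.I) := by
  obtain ⟨K, hK⟩ := exists_peakonBound_remainder b τ
  refine ⟨8 + 2 * (K ^ 2 * (2 * ∫ x, φ x ^ 2)), 1 / 256, by norm_num,
    fun ε h0 h1 => ?_⟩
  obtain ⟨κ, hκ, hre⟩ := exists_exponent τ ε
  have hm := peakFun_mem (κ := κ) (by linarith)
  refine ⟨peakFun κ, hm, ?_, le_sobSq_peakFun h0 h1 hre, ?_⟩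
  · rw [transport_peakFun]
    exact H1.sub_mem (H1.smul_mem _ hm.1)
      (H1.smul_mem _ (peakFun_mem (κ := κ + 1) (by simp [hre]; linarith)).1)
  · rw [linFull_peakFun b τ ε hκ]
    exact sobSq_smul_add_le hm.1 (hK ε κ h0 h1 hκ)

theorem hasApproxEigenfunctions_linRed (b τ : ℝ) :
    HasApproxEigenfunctions (linRed b) ((b : ℂ) - 3 + τ * Complex.I) := by
  obtain ⟨K, hK⟩ := exists_peakonBound_remainder b τ
  obtain ⟨K', hK'⟩ := exists_peakonBound_Q b
  refine ⟨8 + 2 * ((K + K') ^ 2 * (2 * ∫ x, φ x ^ 2)), 1 / 256, by norm_num,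
    fun ε h0 h1 => ?_⟩
  obtain ⟨κ, hκ, hre⟩ := exists_exponent τ ε
  have hm := peakFun_mem (κ := κ) (by linarith)
  refine ⟨peakFun κ, hm, ?_, le_sobSq_peakFun h0 h1 hre, ?_⟩
  · rw [transport_peakFun]
    exact H1.sub_mem (H1.smul_mem _ hm.1)
      (H1.smul_mem _ (peakFun_mem (κ := κ + 1) (by simp [hre]; linarith)).1)
  · have hQ := hK' (peakFun κ) hm.1 (norm_peakFun_le (by linarith))
    -- By `Q_zero` the correction term of the reduced operator is `-Q(v)(0) φ`. Its coefficient is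
    -- bounded uniformly by the bound on `Q` evaluated at the peak, where `φ = 1`.
    have e : linRed b (peakFun κ) - ((b : ℂ) - 3 + τ * Complex.I) • peakFun κ =
        (2 * (ε : ℂ)) • peakFun κ + (((2 - (b : ℂ) - τ * Complex.I - 2 * ε) • peakFun (κ + 1)
          + Q b (peakFun κ)) + (-Q b (peakFun κ) 0) • fun x => (φ x : ℂ)) := by
      rw [← add_assoc, ← linFull_peakFun b τ ε hκ, Q_zero]
      funext x
      simp only [Pi.sub_apply, Pi.add_apply, Pi.smul_apply, smul_eq_mul, linRed_eq b hm.2]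
      ring
    rw [e]
    refine sobSq_smul_add_le hm.1 ((hK ε κ h0 h1 hκ).add ((peakonBound_φ.smul _).mono ?_))
    have := hQ.norm_le 0
    rw [φ_zero, mul_one] at this
    rwa [norm_neg, mul_one]

/-! ### The Cauchy-Schwarz and Hardy inequalities -/

theorem norm_integral_mul_sq_le {μ : Measure ℝ} {f g : ℝ → ℂ} (hf : MemLp f 2 μ)
    (hg : MemLp g 2 μ) :
    ‖∫ x, f x * g x ∂μ‖ ^ 2 ≤ (∫ x, ‖f x‖ ^ 2 ∂μ) * ∫ x, ‖g x‖ ^ 2 ∂μ := by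
  have h2 : ENNReal.ofReal 2 = 2 := by norm_num
  have h := integral_mul_norm_le_Lp_mul_Lq (μ := μ) (f := f) (g := g) (p := 2) (q := 2)
    Real.HolderConjugate.two_two (by rwa [h2]) (by rwa [h2])
  simp only [Real.rpow_two, ← Real.sqrt_eq_rpow] at h
  have h1 : ‖∫ x, f x * g x ∂μ‖ ≤ ∫ x, ‖f x‖ * ‖g x‖ ∂μ := by
    refine (norm_integral_le_integral_norm _).trans_eq ?_
    simp only [norm_mul]
  have h3 := pow_le_pow_left₀ (norm_nonneg _) (h1.trans h) 2
  rwa [mul_pow, Real.sq_sqrt (by positivity), Real.sq_sqrt (by positivity)] at h3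

theorem H1zero.eq_integral {f : ℝ → ℂ} (hf : f ∈ H1zero) (x : ℝ) :
    f x = ∫ y in (0 : ℝ)..x, deriv f y := by
  obtain ⟨⟨-, g, -, hg⟩, h0⟩ := hf
  rw [intervalIntegral.integral_congr_ae (g := g) ((H1.deriv_ae hg).mono fun t ht _ => ht), hg.2,
    h0, sub_zero]

/-- Cauchy-Schwarz for `f' = y^{-1/4} (y^{1/4} f')`, with `∫₀ˣ y^{-1/2} = 2 x^{1/2}`. The exponent
keeps the first factor square integrable at `0` and, after division by `x²`, leaves the kernel
`x^{-3/2}`, which is integrable at infinity. -/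
theorem H1zero.norm_sq_le {f : ℝ → ℂ} (hf : f ∈ H1zero) {x : ℝ} (hx : 0 < x) :
    ‖f x‖ ^ 2 ≤ 2 * x ^ (1 / 2 : ℝ) * ∫ y in Ioc 0 x, y ^ (1 / 2 : ℝ) * ‖deriv f y‖ ^ 2 := by
  have hm := H1.memLp_deriv hf.1
  have hA : MemLp (fun y : ℝ => ((y ^ (1 / 4 : ℝ) : ℝ) : ℂ) * deriv f y) 2
      (volume.restrict (Ioc 0 x)) := by
    refine (hm.restrict _).of_le_mul (c := x ^ (1 / 4 : ℝ)) ?_ ?_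
    · exact (Complex.measurable_ofReal.comp (measurable_id.pow_const _)).aestronglyMeasurable.mul
        (measurable_deriv f).aestronglyMeasurable
    · filter_upwards [ae_restrict_mem measurableSet_Ioc] with y hy
      rw [norm_mul, Complex.norm_real, Real.norm_of_nonneg (Real.rpow_nonneg hy.1.le _)]
      exact mul_le_mul_of_nonneg_right (Real.rpow_le_rpow hy.1.le hy.2 (by norm_num))
        (norm_nonneg _)
  have hsq : ∀ y ∈ Ioc 0 x, ‖((y ^ (-1 / 4 : ℝ) : ℝ) : ℂ)‖ ^ 2 = y ^ (-1 / 2 : ℝ) := by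
    intro y hy
    rw [Complex.norm_real, Real.norm_of_nonneg (Real.rpow_nonneg hy.1.le _), ← Real.rpow_natCast,
      ← Real.rpow_mul hy.1.le]
    norm_num
  have hsq' : ∀ y ∈ Ioc 0 x, ‖((y ^ (1 / 4 : ℝ) : ℝ) : ℂ) * deriv f y‖ ^ 2 =
      y ^ (1 / 2 : ℝ) * ‖deriv f y‖ ^ 2 := by
    intro y hy
    rw [norm_mul, mul_pow, Complex.norm_real, Real.norm_of_nonneg (Real.rpow_nonneg hy.1.le _),
      ← Real.rpow_natCast, ← Real.rpow_mul hy.1.le]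
    norm_num
  have hint : IntervalIntegrable (fun y : ℝ => y ^ (-1 / 2 : ℝ)) volume 0 x :=
    intervalIntegral.intervalIntegrable_rpow' (by norm_num)
  rw [intervalIntegrable_iff_integrableOn_Ioc_of_le hx.le] at hint
  have hB : MemLp (fun y : ℝ => ((y ^ (-1 / 4 : ℝ) : ℝ) : ℂ)) 2 (volume.restrict (Ioc 0 x)) := by
    have hBm : Measurable fun y : ℝ => ((y ^ (-1 / 4 : ℝ) : ℝ) : ℂ) :=
      Complex.measurable_ofReal.comp (measurable_id.pow_const _)
    rw [memLp_two_iff_integrable_sq_norm hBm.aestronglyMeasurable]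
    exact hint.congr_fun (fun y hy => (hsq y hy).symm) measurableSet_Ioc
  have h := norm_integral_mul_sq_le hB hA
  rw [setIntegral_congr_fun measurableSet_Ioc hsq, setIntegral_congr_fun measurableSet_Ioc hsq',
    ← intervalIntegral.integral_of_le hx.le (f := fun y : ℝ => y ^ (-1 / 2 : ℝ)),
    integral_rpow (Or.inl (by norm_num))] at h
  have e : ∫ y in Ioc 0 x, ((y ^ (-1 / 4 : ℝ) : ℝ) : ℂ) * (((y ^ (1 / 4 : ℝ) : ℝ) : ℂ) * deriv f y)
      = f x := by
    rw [H1zero.eq_integral hf x, intervalIntegral.integral_of_le hx.le]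
    refine setIntegral_congr_fun measurableSet_Ioc fun y hy => ?_
    rw [← mul_assoc, ← Complex.ofReal_mul, ← Real.rpow_add hy.1]
    norm_num
  have e' : (x ^ (-1 / 2 + 1 : ℝ) - 0 ^ (-1 / 2 + 1 : ℝ)) / (-1 / 2 + 1) = 2 * x ^ (1 / 2 : ℝ) := by
    norm_num
    ring
  rwa [e, e'] at h

/-- Tonelli on the region `y ≤ x`, together with `∫_y^∞ 2 x^{-3/2} = 4 y^{-1/2}`. Working in
`ENNReal` avoids any integrability hypothesis before the Hardy bound is known. -/
theorem lintegral_hardy_kernel {h : ℝ → ENNReal} (hm : Measurable h) :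
    ∫⁻ x in Ioi (0 : ℝ), ENNReal.ofReal (2 * x ^ (-3 / 2 : ℝ)) * ∫⁻ y in Ioc 0 x, h y =
      ∫⁻ y in Ioi (0 : ℝ), ENNReal.ofReal (4 * y ^ (-1 / 2 : ℝ)) * h y := by
  set k : ℝ → ENNReal := fun x => ENNReal.ofReal (2 * x ^ (-3 / 2 : ℝ)) with hk
  have hkm : Measurable k := by
    exact ENNReal.measurable_ofReal.comp ((measurable_id.pow_const _).const_mul 2)
  have h1 : ∀ x ∈ Ioi (0 : ℝ), k x * ∫⁻ y in Ioc 0 x, h y =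
      ∫⁻ y in Ioi (0 : ℝ), {p : ℝ × ℝ | p.2 ≤ p.1}.indicator (fun p => k p.1 * h p.2) (x, y) := by
    intro x hx
    have : Ioc 0 x = Iic x ∩ Ioi 0 := by ext y; simp [and_comm]
    rw [← lintegral_const_mul _ hm, this, ← Measure.restrict_restrict measurableSet_Iic,
      ← lintegral_indicator measurableSet_Iic]
    refine lintegral_congr fun y => ?_
    simp only [indicator, mem_Iic, mem_ofPred_eq]
  have h2 : ∀ y ∈ Ioi (0 : ℝ), ENNReal.ofReal (4 * y ^ (-1 / 2 : ℝ)) * h y =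
      ∫⁻ x in Ioi (0 : ℝ), {p : ℝ × ℝ | p.2 ≤ p.1}.indicator (fun p => k p.1 * h p.2) (x, y) := by
    intro y hy
    have hy' : 0 < y := hy
    have e : Ici y = Ici y ∩ Ioi 0 := by
      ext x
      simp only [mem_inter_iff, mem_Ici, mem_Ioi]
      exact ⟨fun hx => ⟨hx, hy'.trans_le hx⟩, fun hx => hx.1⟩
    have hkint : ∫⁻ x in Ici y, k x = ENNReal.ofReal (4 * y ^ (-1 / 2 : ℝ)) := by
      rw [setLIntegral_congr Ioi_ae_eq_Ici.symm, hk, ← ofReal_integral_eq_lintegral_ofReal]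
      · rw [integral_const_mul, integral_Ioi_rpow_of_lt (by norm_num) hy']
        congr 1
        norm_num
        ring
      · exact (integrableOn_Ioi_rpow_of_lt (by norm_num) hy').const_mul 2
      · filter_upwards [ae_restrict_mem measurableSet_Ioi] with x hx
        exact mul_nonneg zero_le_two (Real.rpow_nonneg (hy'.trans hx).le _)
    rw [← hkint, ← lintegral_mul_const _ hkm, e, ← Measure.restrict_restrict measurableSet_Ici,
      ← lintegral_indicator measurableSet_Ici]
    refine lintegral_congr fun x => ?_
    simp only [indicator, mem_Ici, mem_ofPred_eq]
  rw [setLIntegral_congr_fun measurableSet_Ioi h1, setLIntegral_congr_fun measurableSet_Ioi h2,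
    lintegral_lintegral_swap]
  refine Measurable.aemeasurable ?_
  exact ((hkm.comp measurable_fst).mul (hm.comp measurable_snd)).indicator
    (measurableSet_le measurable_snd measurable_fst)

/-- **Hardy's inequality** on the half-line. -/
theorem hardy {f : ℝ → ℂ} (hf : f ∈ H1zero) :
    IntegrableOn (fun x => ‖f x‖ ^ 2 / x ^ 2) (Ioi 0) ∧
      ∫ x in Ioi 0, ‖f x‖ ^ 2 / x ^ 2 ≤ 4 * ∫ x, ‖deriv f x‖ ^ 2 := by
  have hm := integrable_sq (H1.memLp_deriv hf.1)
  have hfc := H1.continuous hf.1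
  have hdm := measurable_deriv f
  set h : ℝ → ENNReal := fun y => ENNReal.ofReal (y ^ (1 / 2 : ℝ) * ‖deriv f y‖ ^ 2) with hh
  have hhm : Measurable h :=
    ENNReal.measurable_ofReal.comp ((measurable_id.pow_const _).mul (hdm.norm.pow_const 2))
  have hle : ∫⁻ x in Ioi (0 : ℝ), ENNReal.ofReal (‖f x‖ ^ 2 / x ^ 2) ≤
      ENNReal.ofReal (4 * ∫ x, ‖deriv f x‖ ^ 2) := by
    calc ∫⁻ x in Ioi (0 : ℝ), ENNReal.ofReal (‖f x‖ ^ 2 / x ^ 2)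
        ≤ ∫⁻ x in Ioi (0 : ℝ), ENNReal.ofReal (2 * x ^ (-3 / 2 : ℝ)) * ∫⁻ y in Ioc 0 x, h y := by
          refine setLIntegral_mono' measurableSet_Ioi fun x hx => ?_
          have hx' : 0 < x := hx
          have hint : IntegrableOn (fun y : ℝ => y ^ (1 / 2 : ℝ) * ‖deriv f y‖ ^ 2) (Ioc 0 x) := by
            refine Integrable.mono' (hm.integrableOn.const_mul (x ^ (1 / 2 : ℝ)))
              ((measurable_id.pow_const _).mul (hdm.norm.pow_const 2)).aestronglyMeasurable ?_
            filter_upwards [ae_restrict_mem measurableSet_Ioc] with y hy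
            have := Real.rpow_nonneg hy.1.le (1 / 2 : ℝ)
            rw [Real.norm_of_nonneg (by positivity)]
            exact mul_le_mul_of_nonneg_right (Real.rpow_le_rpow hy.1.le hy.2 (by norm_num))
              (by positivity)
          rw [hh, ← ofReal_integral_eq_lintegral_ofReal hint, ← ENNReal.ofReal_mul]
          · refine ENNReal.ofReal_le_ofReal ?_
            rw [div_le_iff₀ (by positivity)]
            refine (H1zero.norm_sq_le hf hx').trans_eq ?_
            have : x ^ (1 / 2 : ℝ) = x ^ (-3 / 2 : ℝ) * x ^ 2 := by
              rw [← Real.rpow_natCast, ← Real.rpow_add hx']; norm_num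
            rw [this]; ring
          · have := Real.rpow_nonneg hx'.le (-3 / 2 : ℝ)
            positivity
          · filter_upwards [ae_restrict_mem measurableSet_Ioc] with y hy
            have := Real.rpow_nonneg hy.1.le (1 / 2 : ℝ)
            positivity
      _ = ∫⁻ y in Ioi (0 : ℝ), ENNReal.ofReal (4 * y ^ (-1 / 2 : ℝ)) * h y :=
          lintegral_hardy_kernel hhm
      _ = ∫⁻ y in Ioi (0 : ℝ), ENNReal.ofReal (4 * ‖deriv f y‖ ^ 2) := by
          refine setLIntegral_congr_fun measurableSet_Ioi fun y hy => ?_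
          have hy' : 0 < y := hy
          have h1 := Real.rpow_nonneg hy'.le (-1 / 2 : ℝ)
          simp only [hh]
          rw [← ENNReal.ofReal_mul (by positivity)]
          congr 1
          have : y ^ (-1 / 2 : ℝ) * y ^ (1 / 2 : ℝ) = 1 := by
            rw [← Real.rpow_add hy']; norm_num
          linear_combination 4 * ‖deriv f y‖ ^ 2 * this
      _ ≤ ∫⁻ y, ENNReal.ofReal (4 * ‖deriv f y‖ ^ 2) := setLIntegral_le_lintegral _ _
      _ = ENNReal.ofReal (4 * ∫ x, ‖deriv f x‖ ^ 2) := by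
          rw [← integral_const_mul, ofReal_integral_eq_lintegral_ofReal (hm.const_mul 4)]
          exact Filter.Eventually.of_forall fun y => by positivity
  have hmeas : AEStronglyMeasurable (fun x : ℝ => ‖f x‖ ^ 2 / x ^ 2) (volume.restrict (Ioi 0)) :=
    ((hfc.measurable.norm.pow_const 2).div (measurable_id.pow_const 2)).aestronglyMeasurable
  have hpos : 0 ≤ᵐ[volume.restrict (Ioi 0)] fun x : ℝ => ‖f x‖ ^ 2 / x ^ 2 :=
    Filter.Eventually.of_forall fun x => by positivity
  refine ⟨⟨hmeas, ?_⟩, ?_⟩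
  · rw [hasFiniteIntegral_iff_ofReal hpos]
    exact hle.trans_lt ENNReal.ofReal_lt_top
  · rw [integral_eq_lintegral_of_nonneg_ae hpos hmeas]
    refine ENNReal.toReal_le_of_le_ofReal (by positivity) hle

/-- The quotient of a function of `H¹` vanishing at the peak by `1 - φ²` is square integrable on the
half-line. -/
theorem div_den_memLp {f : ℝ → ℂ} (hf : f ∈ H1zero) :
    MemLp (fun x => f x / den x) 2 (volume.restrict (Ioi 0)) ∧
      ∫ x in Ioi 0, ‖f x / den x‖ ^ 2 ≤ 2 * sobSq f := by
  obtain ⟨hi, hle⟩ := hardy hf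
  have hfi := integrable_sq hf.1.1
  have hfc := H1.continuous hf.1
  have hm : AEStronglyMeasurable (fun x => f x / den x) (volume.restrict (Ioi 0)) :=
    (hfc.measurable.div (Complex.measurable_ofReal.comp
      den_continuous.measurable)).aestronglyMeasurable
  have hb : ∀ x ∈ Ioi (0 : ℝ), ‖f x / den x‖ ^ 2 ≤ 2 * ‖f x‖ ^ 2 + 1 / 2 * (‖f x‖ ^ 2 / x ^ 2) := by
    intro x hx
    have hx' : 0 < x := hx
    have hd := den_pos hx'
    -- Equivalent to `1 + 2x ≤ e^{2x}`. Squaring the resulting sum produces the weight `1/2` in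
    -- front of `|f|²/x²`, which against the Hardy constant `4` gives the final `2`.
    have h1 : 1 / den x ≤ 1 + 1 / (2 * x) := by
      have h2 : (1 + 2 * x) * Real.exp (-2 * x) ≤ 1 := by
        have h3 := Real.add_one_le_exp (2 * x)
        have h4 : Real.exp (2 * x) * Real.exp (-2 * x) = 1 := by rw [← Real.exp_add]; simp
        nlinarith [Real.exp_pos (-2 * x)]
      rw [div_le_iff₀ hd]
      have : (1 + 1 / (2 * x)) * den x = ((1 + 2 * x) * den x) / (2 * x) := by field_simp; ring
      rw [this, le_div_iff₀ (by positivity), den]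
      linarith
    have h2 : ‖f x / den x‖ ≤ ‖f x‖ + ‖f x‖ / (2 * x) := by
      rw [norm_div, Complex.norm_real, Real.norm_of_nonneg hd.le]
      calc ‖f x‖ / den x = ‖f x‖ * (1 / den x) := by ring
        _ ≤ ‖f x‖ * (1 + 1 / (2 * x)) := mul_le_mul_of_nonneg_left h1 (norm_nonneg _)
        _ = _ := by ring
    have h3 : ‖f x / den x‖ ^ 2 ≤ (‖f x‖ + ‖f x‖ / (2 * x)) ^ 2 := by gcongr
    have h4 : (‖f x‖ / (2 * x)) ^ 2 = 1 / 4 * (‖f x‖ ^ 2 / x ^ 2) := by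
      rw [div_pow, mul_pow]; field_simp; norm_num
    nlinarith [sq_nonneg (‖f x‖ - ‖f x‖ / (2 * x))]
  have hdom : IntegrableOn (fun x => 2 * ‖f x‖ ^ 2 + 1 / 2 * (‖f x‖ ^ 2 / x ^ 2)) (Ioi 0) :=
    (hfi.integrableOn.const_mul 2).add (hi.const_mul _)
  have hint : IntegrableOn (fun x => ‖f x / den x‖ ^ 2) (Ioi 0) := by
    refine Integrable.mono' hdom (hm.norm.pow 2) ?_
    filter_upwards [ae_restrict_mem measurableSet_Ioi] with x hx
    rw [Real.norm_of_nonneg (by positivity)]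
    exact hb x hx
  refine ⟨(memLp_two_iff_integrable_sq_norm hm).2 hint, ?_⟩
  refine (setIntegral_mono_on hint hdom measurableSet_Ioi hb).trans ?_
  rw [integral_add (hfi.integrableOn.const_mul 2) (hi.const_mul _), integral_const_mul,
    integral_const_mul]
  have h1 : ∫ x in Ioi (0 : ℝ), ‖f x‖ ^ 2 ≤ ∫ x, ‖f x‖ ^ 2 :=
    setIntegral_le_integral hfi (Filter.Eventually.of_forall fun x => by positivity)
  unfold sobSq
  linarith

/-! ### The resolvent equation on the half-line -/

/-- The solution of `(1 - φ²) w' - φ² w = z w` on the right half-line. -/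
def homSol (z : ℂ) (x : ℝ) : ℂ := Complex.exp (z * x) * denPow ((1 + z) / 2) x

/-- The power `(e^{2x} - 1)^β` on the right half-line. -/
def weight (β x : ℝ) : ℝ := Real.exp (2 * β * x) * den x ^ β

theorem weight_pos (β : ℝ) {x : ℝ} (hx : 0 < x) : 0 < weight β x :=
  mul_pos (Real.exp_pos _) (Real.rpow_pos_of_pos (den_pos hx) _)

theorem weight_mul_neg (β : ℝ) {x : ℝ} (hx : 0 < x) : weight β x * weight (-β) x = 1 := by
  unfold weight
  rw [mul_mul_mul_comm, ← Real.exp_add, ← Real.rpow_add (den_pos hx)]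
  ring_nf
  simp

theorem hasDerivAt_weight (β : ℝ) {x : ℝ} (hx : 0 < x) :
    HasDerivAt (weight β) (2 * β * (weight β x / den x)) x := by
  have hd := den_pos hx
  have h1 : HasDerivAt (fun x : ℝ => Real.exp (2 * β * x))
      (Real.exp (2 * β * x) * (2 * β * 1)) x := ((hasDerivAt_id x).const_mul (2 * β)).exp
  have h2 := (hasDerivAt_den x).rpow_const (p := β) (Or.inl hd.ne')
  refine (h1.mul h2).congr_deriv ?_
  have h3 : den x ^ (β - 1) = den x ^ β / den x := by
    rw [Real.rpow_sub hd, Real.rpow_one]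
  have h4 : Real.exp (-2 * x) = 1 - den x := by rw [den]; ring
  rw [h3, h4, weight]
  field_simp
  ring

/-- Separates the factor `den`, which the energy divides out, from a power of `e^{2x} - 1` depending
only on `Re z`. That power is monotone from one end of the half-line to the other, which is what
decides the base point of the primitive. -/
theorem norm_homSol_sq (z : ℂ) {x : ℝ} (hx : 0 < x) :
    ‖homSol z x‖ ^ 2 = den x * weight z.re x := by
  have hd := den_pos hx
  have h1 : ((1 + z) / 2).re = (1 + z.re) / 2 := by simp
  rw [homSol, norm_mul, norm_denPow _ hx, Complex.norm_exp, Complex.re_mul_ofReal, h1, mul_pow,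
    ← Real.exp_nat_mul, ← Real.rpow_natCast, ← Real.rpow_mul hd.le, weight]
  have h2 : (1 + z.re) / 2 * ((2 : ℕ) : ℝ) = 1 + z.re := by push_cast; ring
  rw [h2, Real.rpow_add hd, Real.rpow_one]
  have h3 : ((2 : ℕ) : ℝ) * (z.re * x) = 2 * z.re * x := by push_cast; ring
  rw [h3]; ring

theorem homSol_ne_zero (z : ℂ) (x : ℝ) : homSol z x ≠ 0 :=
  mul_ne_zero (Complex.exp_ne_zero _) (Complex.exp_ne_zero _)

theorem hasDerivAt_homSol (z : ℂ) {x : ℝ} (hx : 0 < x) :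
    HasDerivAt (homSol z) ((z + Real.exp (-2 * x)) / den x * homSol z x) x := by
  have hd : (den x : ℂ) ≠ 0 := by exact_mod_cast (den_pos hx).ne'
  have h1 : HasDerivAt (fun x : ℝ => Complex.exp (z * x)) (Complex.exp (z * x) * (z * 1)) x :=
    ((hasDerivAt_id x).ofReal_comp.const_mul z).cexp
  refine (h1.mul (hasDerivAt_denPow ((1 + z) / 2) hx)).congr_deriv ?_
  have h2 : (den x : ℂ) = 1 - (Real.exp (-2 * x) : ℂ) := by rw [den]; push_cast; ring
  unfold homSol
  field_simp
  rw [h2]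
  ring_nf

theorem weight_continuous {β : ℝ} (hβ : 0 < β) : Continuous (weight β) :=
  (by fun_prop : Continuous fun x : ℝ => Real.exp (2 * β * x)).mul
    (den_continuous.rpow_const fun _ => Or.inr hβ.le)

theorem weight_zero {β : ℝ} (hβ : 0 < β) : weight β 0 = 0 := by
  rw [weight, den_zero, Real.zero_rpow hβ.ne', mul_zero]

theorem tendsto_weight_atTop {β : ℝ} (hβ : β < 0) :
    Filter.Tendsto (weight β) Filter.atTop (nhds 0) := by
  have h1 : Filter.Tendsto (fun x : ℝ => Real.exp (2 * β * x)) Filter.atTop (nhds 0) :=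
    Real.tendsto_exp_atBot.comp
      (Filter.tendsto_id.const_mul_atTop_of_neg (by linarith : 2 * β < 0))
  have h2 := h1.mul (tendsto_den.rpow_const (p := β) (Or.inl one_ne_zero))
  rwa [zero_mul] at h2

theorem exists_tendsto_weight {β : ℝ} (hβ : β ≠ 0) : ∃ l : Filter ℝ, l.NeBot ∧
    (∀ᶠ x in l, 0 < x) ∧ Filter.Tendsto (weight β) l (nhds 0) := by
  rcases lt_or_gt_of_ne hβ with h | h
  · exact ⟨Filter.atTop, inferInstance, Filter.eventually_gt_atTop 0, tendsto_weight_atTop h⟩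
  · refine ⟨nhdsWithin 0 (Ioi 0), inferInstance, self_mem_nhdsWithin, ?_⟩
    have := ((weight_continuous h).tendsto 0).mono_left (nhdsWithin_le_nhds (s := Ioi 0))
    rwa [weight_zero h] at this

theorem norm_inv_homSol_sq (z : ℂ) {x : ℝ} (hx : 0 < x) :
    ‖(homSol z x)⁻¹‖ ^ 2 = weight (-z.re) x / den x := by
  have h := weight_mul_neg z.re hx
  have h1 := (weight_pos z.re hx).ne'
  have hd := (den_pos hx).ne'
  rw [norm_inv, inv_pow, norm_homSol_sq z hx]
  field_simp
  linarith

theorem continuousOn_homSol (z : ℂ) : ContinuousOn (homSol z) (Ioi 0) := fun _ hx =>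
  (hasDerivAt_homSol z hx).continuousAt.continuousWithinAt

/-- Cauchy-Schwarz, with `norm_inv_homSol_sq` turning the second factor into `weight (-Re z) / den`,
which has an explicit primitive. -/
theorem integral_div_homSol {z : ℂ} {F : ℝ → ℂ} (hF : MemLp F 2 (volume.restrict (Ioi 0)))
    {s : Set ℝ} (hs : MeasurableSet s) (hs0 : s ⊆ Ioi 0)
    (hi : IntegrableOn (fun x => weight (-z.re) x / den x) s) :
    IntegrableOn (fun x => F x / homSol z x) s ∧ ‖∫ x in s, F x / homSol z x‖ ^ 2 ≤
      (∫ x in Ioi 0, ‖F x‖ ^ 2) * ∫ x in s, weight (-z.re) x / den x := by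
  have hFs : MemLp F 2 (volume.restrict s) := hF.mono_measure (Measure.restrict_mono hs0 le_rfl)
  have hm : AEStronglyMeasurable (fun x => (homSol z x)⁻¹) (volume.restrict s) :=
    (((continuousOn_homSol z).inv₀ fun x _ => homSol_ne_zero z x).mono hs0).aestronglyMeasurable hs
  have hW : MemLp (fun x => (homSol z x)⁻¹) 2 (volume.restrict s) := by
    rw [memLp_two_iff_integrable_sq_norm hm]
    exact hi.congr_fun (fun x hx => (norm_inv_homSol_sq z (hs0 hx)).symm) hs
  simp only [div_eq_mul_inv (F _)]
  refine ⟨hFs.integrable_mul hW, (norm_integral_mul_sq_le hFs hW).trans ?_⟩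
  rw [setIntegral_congr_fun hs fun x hx => norm_inv_homSol_sq z (hs0 hx)]
  refine mul_le_mul_of_nonneg_right ?_ (setIntegral_nonneg hs fun x hx =>
    div_nonneg (weight_pos _ (hs0 hx)).le (den_pos (hs0 hx)).le)
  exact setIntegral_mono_set ((memLp_two_iff_integrable_sq_norm hF.1).1 hF)
    (Filter.Eventually.of_forall fun x => by positivity) (Filter.Eventually.of_forall hs0)

theorem weight_div_den_nonneg (β : ℝ) {x : ℝ} (hx : 0 < x) : 0 ≤ weight β x / den x :=
  div_nonneg (weight_pos _ hx).le (den_pos hx).le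

theorem hasDerivAt_weight_div {β : ℝ} (hβ : β ≠ 0) {x : ℝ} (hx : 0 < x) :
    HasDerivAt (fun x => weight β x / (2 * β)) (weight β x / den x) x :=
  ((hasDerivAt_weight β hx).div_const (2 * β)).congr_deriv (by field_simp)

theorem integral_weight_Ioi {β : ℝ} (hβ : β < 0) {x : ℝ} (hx : 0 < x) :
    IntegrableOn (fun y => weight β y / den y) (Ioi x) ∧
      ∫ y in Ioi x, weight β y / den y = weight β x / (2 * |β|) := by
  have h1 : ∀ y ∈ Ici x, HasDerivAt (fun x => weight β x / (2 * β)) (weight β y / den y) y :=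
    fun y hy => hasDerivAt_weight_div hβ.ne (hx.trans_le hy)
  have h2 : ∀ y ∈ Ioi x, 0 ≤ weight β y / den y :=
    fun y hy => weight_div_den_nonneg β (hx.trans hy)
  have h3 : Filter.Tendsto (fun x => weight β x / (2 * β)) Filter.atTop (nhds (0 / (2 * β))) :=
    (tendsto_weight_atTop hβ).div_const _
  refine ⟨integrableOn_Ioi_deriv_of_nonneg' h1 h2 h3, ?_⟩
  rw [integral_Ioi_of_hasDerivAt_of_nonneg' h1 h2 h3, abs_of_neg hβ, zero_div, zero_sub, mul_neg,
    div_neg]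

theorem integral_weight_Ioc {β : ℝ} (hβ : 0 < β) {x : ℝ} (hx : 0 < x) :
    IntegrableOn (fun y => weight β y / den y) (Ioc 0 x) ∧
      ∫ y in Ioc 0 x, weight β y / den y = weight β x / (2 * |β|) := by
  have hc : ContinuousOn (fun x => weight β x / (2 * β)) (Icc 0 x) :=
    ((weight_continuous hβ).div_const _).continuousOn
  have h1 : ∀ y ∈ Ioo 0 x, HasDerivAt (fun x => weight β x / (2 * β)) (weight β y / den y) y :=
    fun y hy => hasDerivAt_weight_div hβ.ne' hy.1
  have hi := intervalIntegral.integrableOn_deriv_of_nonneg hc h1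
    fun y hy => weight_div_den_nonneg β hy.1
  refine ⟨hi, ?_⟩
  rw [← intervalIntegral.integral_of_le hx.le,
    intervalIntegral.integral_eq_sub_of_hasDerivAt_of_le hx.le hc h1
      ((intervalIntegrable_iff_integrableOn_Ioc_of_le hx.le).2 hi), weight_zero hβ, abs_of_pos hβ,
    zero_div, sub_zero]

/-- A primitive of `F / homSol z` that vanishes at the end where `homSol z` is small. -/
theorem exists_primitive {z : ℂ} (hz : z.re ≠ 0) {F : ℝ → ℂ} (hFc : ContinuousOn F (Ioi 0))
    (hF : MemLp F 2 (volume.restrict (Ioi 0))) :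
    ∃ I : ℝ → ℂ, ∀ x, 0 < x → HasDerivAt I (F x / homSol z x) x ∧
      ‖I x‖ ^ 2 ≤ (∫ x in Ioi 0, ‖F x‖ ^ 2) * (weight (-z.re) x / (2 * |z.re|)) := by
  have hGc : ContinuousOn (fun x => F x / homSol z x) (Ioi 0) :=
    hFc.div (continuousOn_homSol z) fun x _ => homSol_ne_zero z x
  have hGa : ∀ x, 0 < x → ContinuousAt (fun x => F x / homSol z x) x :=
    fun x hx => hGc.continuousAt (isOpen_Ioi.mem_nhds hx)
  have hGm := hGc.stronglyMeasurableAtFilter isOpen_Ioi (μ := volume)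
  -- `weight (-Re z) / den` is integrable up to `0` when `Re z < 0` and up to infinity when `Re z >
  -- 0`. The primitive is based at that end.
  rcases lt_or_gt_of_ne hz with h | h
  · refine ⟨fun x => ∫ y in (0 : ℝ)..x, F y / homSol z y, fun x hx => ?_⟩
    obtain ⟨h1, h2⟩ := integral_weight_Ioc (β := -z.re) (by linarith) hx
    obtain ⟨h3, h4⟩ := integral_div_homSol hF measurableSet_Ioc Ioc_subset_Ioi_self h1
    refine ⟨intervalIntegral.integral_hasDerivAt_right
      ((intervalIntegrable_iff_integrableOn_Ioc_of_le hx.le).2 h3) (hGm x hx) (hGa x hx), ?_⟩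
    simp only [intervalIntegral.integral_of_le hx.le]
    rwa [h2, abs_neg] at h4
  · have key : ∀ x, 0 < x → IntegrableOn (fun x => F x / homSol z x) (Ioi x) ∧
        ‖∫ y in Ioi x, F y / homSol z y‖ ^ 2 ≤
          (∫ x in Ioi 0, ‖F x‖ ^ 2) * (weight (-z.re) x / (2 * |z.re|)) := by
      intro x hx
      obtain ⟨h1, h2⟩ := integral_weight_Ioi (β := -z.re) (by linarith) hx
      obtain ⟨h3, h4⟩ := integral_div_homSol hF measurableSet_Ioi (Ioi_subset_Ioi hx.le) h1
      rw [h2, abs_neg] at h4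
      exact ⟨h3, h4⟩
    refine ⟨fun x => -∫ y in Ioi x, F y / homSol z y, fun x hx => ⟨?_, ?_⟩⟩
    -- An auxiliary base point to the left of `x` turns the tail integral into an integral over a
    -- bounded interval, which can be differentiated at `x`.
    · have ha : 0 < x / 2 := by positivity
      have hi := (key (x / 2) ha).1
      have hI : IntervalIntegrable (fun x => F x / homSol z x) volume (x / 2) x := by
        rw [intervalIntegrable_iff_integrableOn_Ioc_of_le (by linarith)]
        exact hi.mono_set Ioc_subset_Ioi_self
      have hD := (intervalIntegral.integral_hasDerivAt_right hI (hGm x hx) (hGa x hx)).sub_const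
        (∫ y in Ioi (x / 2), F y / homSol z y)
      refine hD.congr_of_eventuallyEq ?_
      filter_upwards [isOpen_Ioi.mem_nhds (show x / 2 < x by linarith)] with y hy
      rw [← intervalIntegral.integral_Ioi_sub_Ioi hi (le_of_lt hy)]
      ring
    · rw [norm_neg]; exact (key x hx).2

/-! ### The energy estimate -/

/-- The derivative of `1 / den` cancels the term `e^{-2x}` of the equation exactly, and the
imaginary part of `z` acts as a rotation. Only `Re z` survives, so the quadratic term has a fixed
sign. -/
theorem hasDerivAt_energy {z : ℂ} {v F : ℝ → ℂ} {x : ℝ} (hx : 0 < x)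
    (h : HasDerivAt v ((z + Real.exp (-2 * x)) / den x * v x + F x) x) :
    HasDerivAt (fun x => ‖v x‖ ^ 2 / den x)
      (2 * z.re * ‖v x / den x‖ ^ 2 + 2 * inner ℝ (v x / den x) (F x)) x := by
  have hd := den_pos hx
  refine (h.norm_sq.div (hasDerivAt_den x) hd.ne').congr_deriv ?_
  have h1 : (z + Real.exp (-2 * x)) / den x * v x =
      ((((z.re + Real.exp (-2 * x)) / den x : ℝ)) : ℂ) * v x +
        ((z.im / den x : ℝ) : ℂ) * (Complex.I * v x) := by
    conv_lhs => rw [← Complex.re_add_im z]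
    push_cast; ring
  have h2 : inner ℝ (v x) ((z + Real.exp (-2 * x)) / den x * v x + F x) =
      (z.re + Real.exp (-2 * x)) / den x * ‖v x‖ ^ 2 + inner ℝ (v x) (F x) := by
    have h3 : inner ℝ (v x) (Complex.I * v x) = (0 : ℝ) := by
      simp [Complex.inner]; ring_nf
    rw [h1, inner_add_right, inner_add_right, ← Complex.real_smul, ← Complex.real_smul,
      inner_smul_right, inner_smul_right, h3, real_inner_self_eq_norm_sq]
    ring
  have h4 : inner ℝ (v x / den x) (F x) = inner ℝ (v x) (F x) / den x := by
    have : v x / den x = (den x)⁻¹ • v x := by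
      rw [Complex.real_smul]; push_cast; field_simp
    rw [this, real_inner_smul_left]; field_simp
  rw [h2, h4, norm_div, Complex.norm_real, Real.norm_of_nonneg hd.le]
  field_simp
  ring

/-- Integrating the energy identity bounds `|Re z| ∫ |v / den|²` by a boundary term, at most `N / (2
|Re z|)`, and a source term, at most `N / |Re z|`. Together they give the factor `3/2`,
independently of the interval. -/
theorem integral_energy_le {z : ℂ} (hz : z.re ≠ 0) {v F : ℝ → ℂ} (hFc : ContinuousOn F (Ioi 0))
    (hF : MemLp F 2 (volume.restrict (Ioi 0)))
    (hd : ∀ x, 0 < x → HasDerivAt v ((z + Real.exp (-2 * x)) / den x * v x + F x) x)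
    (he : ∀ x, 0 < x → ‖v x‖ ^ 2 / den x ≤ (∫ x in Ioi 0, ‖F x‖ ^ 2) / (2 * |z.re|))
    {a c : ℝ} (ha : 0 < a) (hac : a ≤ c) :
    ∫ x in Ioc a c, ‖v x / den x‖ ^ 2 ≤ 3 / 2 * (∫ x in Ioi 0, ‖F x‖ ^ 2) / z.re ^ 2 := by
  set N := ∫ x in Ioi 0, ‖F x‖ ^ 2 with hN
  have hα : 0 < |z.re| := abs_pos.2 hz
  -- The sign of `Re z`: multiplying the identity by it makes the quadratic term positive in both
  -- cases.
  obtain ⟨σ, hσ, hσ1⟩ : ∃ σ : ℝ, σ * z.re = |z.re| ∧ (σ = 1 ∨ σ = -1) := by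
    rcases abs_cases z.re with h | h
    · exact ⟨1, by rw [h.1, one_mul], Or.inl rfl⟩
    · exact ⟨-1, by rw [h.1, neg_one_mul], Or.inr rfl⟩
  have hσa : |σ| = 1 := by rcases hσ1 with h | h <;> simp [h]
  have hsub : uIcc a c ⊆ Ioi 0 := by
    rw [uIcc_of_le hac]; exact fun x hx => ha.trans_le hx.1
  have hFc' := hFc.mono hsub
  have hYc : ContinuousOn (fun x => v x / den x) (uIcc a c) := fun x hx => by
    have hx0 : 0 < x := hsub hx
    refine ContinuousAt.continuousWithinAt ((hd x hx0).continuousAt.div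
      (Complex.continuous_ofReal.comp den_continuous).continuousAt ?_)
    exact_mod_cast (den_pos hx0).ne'
  have hY2 : IntervalIntegrable (fun x => ‖v x / den x‖ ^ 2) volume a c :=
    (hYc.norm.pow 2).intervalIntegrable
  have hF2 : IntervalIntegrable (fun x => ‖F x‖ ^ 2) volume a c :=
    (hFc'.norm.pow 2).intervalIntegrable
  have hD : IntervalIntegrable
      (fun x => 2 * z.re * ‖v x / den x‖ ^ 2 + 2 * inner ℝ (v x / den x) (F x)) volume a c :=
    (((hYc.norm.pow 2).const_smul (2 * z.re)).add
      ((hYc.inner hFc').const_smul (2 : ℝ))).intervalIntegrable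
  have hFTC := intervalIntegral.integral_eq_sub_of_hasDerivAt
    (fun x hx => hasDerivAt_energy (hsub hx) (hd x (hsub hx))) hD
  have hle : ∫ x in a..c, |z.re| * ‖v x / den x‖ ^ 2 ≤
      ∫ x in a..c, (σ * (2 * z.re * ‖v x / den x‖ ^ 2 + 2 * inner ℝ (v x / den x) (F x)) +
        |z.re|⁻¹ * ‖F x‖ ^ 2) := by
    refine intervalIntegral.integral_mono_on hac (hY2.const_mul _)
      ((hD.const_mul _).add (hF2.const_mul _)) fun x hx => ?_
    have h1 := abs_real_inner_le_norm (v x / den x) (F x)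
    have h2 : -(‖v x / den x‖ * ‖F x‖) ≤ σ * inner ℝ (v x / den x) (F x) := by
      have h3 := neg_abs_le (σ * inner ℝ (v x / den x) (F x))
      rw [abs_mul, hσa, one_mul] at h3
      linarith
    -- Young's inequality, weighted so that exactly half of the quadratic term `2 |Re z| |v / den|²`
    -- is absorbed.
    have h4 : 2 * (‖v x / den x‖ * ‖F x‖) ≤
        |z.re| * ‖v x / den x‖ ^ 2 + |z.re|⁻¹ * ‖F x‖ ^ 2 := by
      have h5 : |z.re| * |z.re|⁻¹ = 1 := mul_inv_cancel₀ hα.ne'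
      have h6 : |z.re| * ‖v x / den x‖ ^ 2 + |z.re|⁻¹ * ‖F x‖ ^ 2 -
          2 * (‖v x / den x‖ * ‖F x‖) =
          |z.re| * (‖v x / den x‖ - |z.re|⁻¹ * ‖F x‖) ^ 2 := by
        linear_combination (2 * ‖v x / den x‖ * ‖F x‖ - |z.re|⁻¹ * ‖F x‖ ^ 2) * h5
      have h7 : 0 ≤ |z.re| * (‖v x / den x‖ - |z.re|⁻¹ * ‖F x‖) ^ 2 := by positivity
      linarith
    have h8 : σ * (2 * z.re * ‖v x / den x‖ ^ 2) = 2 * |z.re| * ‖v x / den x‖ ^ 2 := by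
      rw [← hσ]; ring
    rw [mul_add, h8]
    linarith
  rw [intervalIntegral.integral_const_mul, intervalIntegral.integral_add (hD.const_mul _)
    (hF2.const_mul _), intervalIntegral.integral_const_mul, intervalIntegral.integral_const_mul,
    hFTC, intervalIntegral.integral_of_le hac, intervalIntegral.integral_of_le hac] at hle
  have hFN : ∫ x in Ioc a c, ‖F x‖ ^ 2 ≤ N :=
    setIntegral_mono_set ((memLp_two_iff_integrable_sq_norm hF.1).1 hF)
      (Filter.Eventually.of_forall fun x => by positivity)
      (Filter.Eventually.of_forall fun x hx => ha.trans hx.1)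
  -- The energy is nonnegative, so only one endpoint, depending on the sign, has to be estimated.
  have hee : σ * (‖v c‖ ^ 2 / den c - ‖v a‖ ^ 2 / den a) ≤ N / (2 * |z.re|) := by
    have h1 := he a ha
    have h2 := he c (ha.trans_le hac)
    have h3 : 0 ≤ ‖v a‖ ^ 2 / den a := div_nonneg (by positivity) (den_pos ha).le
    have h4 : 0 ≤ ‖v c‖ ^ 2 / den c := div_nonneg (by positivity) (den_pos (ha.trans_le hac)).le
    rcases hσ1 with h | h <;> rw [h] <;> linarith
  have hN2 : |z.re|⁻¹ * ∫ x in Ioc a c, ‖F x‖ ^ 2 ≤ |z.re|⁻¹ * N := by gcongr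
  have hfin : |z.re| * ∫ x in Ioc a c, ‖v x / den x‖ ^ 2 ≤ 3 / 2 * N / |z.re| := by
    have : N / (2 * |z.re|) + |z.re|⁻¹ * N = 3 / 2 * N / |z.re| := by field_simp; norm_num
    linarith
  rw [← sq_abs z.re, le_div_iff₀ (by positivity)]
  rw [le_div_iff₀ hα] at hfin
  linarith

/-- The bound on compact subintervals is uniform, so it passes to the exhaustion of the half-line by
`(1/(n+1), n+1]`; square integrability at both ends is part of the conclusion. -/
theorem energy_memLp {z : ℂ} (hz : z.re ≠ 0) {v F : ℝ → ℂ} (hFc : ContinuousOn F (Ioi 0))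
    (hF : MemLp F 2 (volume.restrict (Ioi 0)))
    (hd : ∀ x, 0 < x → HasDerivAt v ((z + Real.exp (-2 * x)) / den x * v x + F x) x)
    (he : ∀ x, 0 < x → ‖v x‖ ^ 2 / den x ≤ (∫ x in Ioi 0, ‖F x‖ ^ 2) / (2 * |z.re|)) :
    MemLp (fun x => v x / den x) 2 (volume.restrict (Ioi 0)) ∧
      ∫ x in Ioi 0, ‖v x / den x‖ ^ 2 ≤ 3 / 2 * (∫ x in Ioi 0, ‖F x‖ ^ 2) / z.re ^ 2 := by
  have hYc : ContinuousOn (fun x => v x / den x) (Ioi 0) := fun x hx => by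
    refine ContinuousAt.continuousWithinAt ((hd x hx).continuousAt.div
      (Complex.continuous_ofReal.comp den_continuous).continuousAt ?_)
    exact_mod_cast (den_pos hx).ne'
  have hm := hYc.aestronglyMeasurable (μ := volume) measurableSet_Ioi
  have hta : Filter.Tendsto (fun n : ℕ => 1 / ((n : ℝ) + 1)) Filter.atTop (nhds 0) :=
    tendsto_one_div_add_atTop_nhds_zero_nat
  have htb : Filter.Tendsto (fun n : ℕ => (n : ℝ) + 1) Filter.atTop Filter.atTop :=
    Filter.tendsto_atTop_add_const_right _ _ tendsto_natCast_atTop_atTop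
  have hcov : AECover (volume.restrict (Ioi (0 : ℝ))) Filter.atTop
      fun n : ℕ => Ioi (1 / ((n : ℝ) + 1)) ∩ Iic ((n : ℝ) + 1) :=
    (aecover_Ioi_of_Ioi hta).inter (aecover_Iic htb)
  have ha : ∀ n : ℕ, 0 < 1 / ((n : ℝ) + 1) := fun n => by positivity
  have hac : ∀ n : ℕ, 1 / ((n : ℝ) + 1) ≤ (n : ℝ) + 1 := fun n => by
    rw [div_le_iff₀ (by positivity)]
    nlinarith [(Nat.cast_nonneg n : (0 : ℝ) ≤ n)]
  have hres : ∀ n : ℕ, (volume.restrict (Ioi (0 : ℝ))).restrict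
      (Ioi (1 / ((n : ℝ) + 1)) ∩ Iic ((n : ℝ) + 1)) =
      volume.restrict (Ioc (1 / ((n : ℝ) + 1)) ((n : ℝ) + 1)) := fun n => by
    rw [Ioi_inter_Iic, Measure.restrict_restrict measurableSet_Ioc,
      inter_eq_self_of_subset_left (Ioc_subset_Ioi_self.trans (Ioi_subset_Ioi (ha n).le))]
  have hb : ∀ n : ℕ, ∫ x in Ioi (1 / ((n : ℝ) + 1)) ∩ Iic ((n : ℝ) + 1), ‖v x / den x‖ ^ 2
      ∂(volume.restrict (Ioi 0)) ≤ 3 / 2 * (∫ x in Ioi 0, ‖F x‖ ^ 2) / z.re ^ 2 := fun n => by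
    rw [hres]; exact integral_energy_le hz hFc hF hd he (ha n) (hac n)
  have hint : Integrable (fun x => ‖v x / den x‖ ^ 2) (volume.restrict (Ioi 0)) := by
    refine hcov.integrable_of_integral_bounded_of_nonneg_ae _ (fun n => ?_)
      (Filter.Eventually.of_forall fun x => by positivity) (Filter.Eventually.of_forall hb)
    rw [IntegrableOn, hres]
    have : ContinuousOn (fun x => ‖v x / den x‖ ^ 2) (Icc (1 / ((n : ℝ) + 1)) ((n : ℝ) + 1)) :=
      (hYc.norm.pow 2).mono fun x hx => (ha n).trans_le hx.1
    exact this.integrableOn_Icc.mono_set Ioc_subset_Icc_self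
  refine ⟨(memLp_two_iff_integrable_sq_norm hm).2 hint, ?_⟩
  exact le_of_tendsto (hcov.integral_tendsto_of_countably_generated hint)
    (Filter.Eventually.of_forall hb)

/-! ### The resolvent of the Novikov case -/

theorem integral_half_sq (h : ℝ → ℂ) : ∫ x, ‖half h x‖ ^ 2 = ∫ x in Ioi 0, ‖h x‖ ^ 2 := by
  rw [← integral_indicator measurableSet_Ioi]
  congr 1; funext x
  rw [half_eq_indicator]
  by_cases hx : x ∈ Ioi (0 : ℝ) <;> simp [hx]

theorem sobSq_half {h h' : ℝ → ℂ} (hd : ∀ x, 0 < x → HasDerivAt h (h' x) x) :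
    sobSq (half h) = (∫ x in Ioi 0, ‖h x‖ ^ 2) + ∫ x in Ioi 0, ‖h' x‖ ^ 2 := by
  rw [sobSq, integral_half_sq, ← integral_half_sq h']
  congr 1
  refine integral_congr_ae ?_
  have h0 : ∀ᵐ x : ℝ ∂volume, x ≠ 0 := by rw [ae_iff]; simp
  filter_upwards [h0] with x hx
  rw [(half_hasDerivAt hd hx).deriv]

/-- Membership in `H¹` and norm bound for a function on the half-line solving the resolvent
equation, given the bounds on `w / (1 - φ²)`. -/
theorem half_solution_mem {z : ℂ} {w F : ℝ → ℂ} {N M : ℝ}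
    (hF : MemLp F 2 (volume.restrict (Ioi 0))) (hFN : ∫ x in Ioi 0, ‖F x‖ ^ 2 = N)
    (hd : ∀ x, 0 < x → HasDerivAt w ((z + Real.exp (-2 * x)) / den x * w x + F x) x)
    (he : ∀ x, 0 < x → ‖w x‖ ^ 2 / den x ≤ M)
    (hY : MemLp (fun x => w x / den x) 2 (volume.restrict (Ioi 0))) {D : ℝ}
    (hYD : ∫ x in Ioi 0, ‖w x / den x‖ ^ 2 ≤ D) :
    half w ∈ H1zero ∧ sobSq (half w) ≤ (1 + 2 * (1 + ‖z‖) ^ 2) * D + 2 * N := by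
  have hwc : ContinuousOn w (Ioi 0) := fun x hx => (hd x hx).continuousAt.continuousWithinAt
  have hwm := hwc.aestronglyMeasurable (μ := volume) measurableSet_Ioi
  have hwY : ∀ x ∈ Ioi (0 : ℝ), ‖w x‖ ≤ ‖w x / den x‖ := fun x hx => by
    have hdx := den_pos hx
    rw [norm_div, Complex.norm_real, Real.norm_of_nonneg hdx.le, le_div_iff₀ hdx]
    exact mul_le_of_le_one_right (norm_nonneg _) (den_le_one x)
  have hwL : MemLp w 2 (volume.restrict (Ioi 0)) := by
    refine hY.of_le hwm ?_
    filter_upwards [ae_restrict_mem measurableSet_Ioi] with x hx using hwY x hx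
  have hco : ∀ x ∈ Ioi (0 : ℝ), ‖(z + Real.exp (-2 * x)) / den x * w x‖ ≤
      (1 + ‖z‖) * ‖w x / den x‖ := fun x hx => by
    rw [div_mul_eq_mul_div, mul_div_assoc, norm_mul]
    refine mul_le_mul_of_nonneg_right ((norm_add_le _ _).trans ?_) (norm_nonneg _)
    rw [Complex.norm_real, Real.norm_of_nonneg (Real.exp_pos _).le, add_comm]
    have : Real.exp (-2 * x) ≤ 1 := Real.exp_le_one_iff.2 (by linarith [mem_Ioi.1 hx])
    linarith
  have hcm : AEStronglyMeasurable (fun x => (z + Real.exp (-2 * x)) / den x * w x)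
      (volume.restrict (Ioi 0)) := by
    have h1 : Measurable fun x : ℝ => (z + Real.exp (-2 * x)) / (den x : ℂ) :=
      (by fun_prop : Measurable fun x : ℝ => (z + Real.exp (-2 * x) : ℂ)).div
        (Complex.measurable_ofReal.comp den_continuous.measurable)
    exact h1.aestronglyMeasurable.mul hwm
  have hcL : MemLp (fun x => (z + Real.exp (-2 * x)) / den x * w x) 2
      (volume.restrict (Ioi 0)) := by
    refine hY.of_le_mul (c := 1 + ‖z‖) hcm ?_
    filter_upwards [ae_restrict_mem measurableSet_Ioi] with x hx using hco x hx
  -- The pointwise energy bound gives `|w|² ≤ M den`, and `den` vanishes at the peak.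
  have ht : Filter.Tendsto w (nhdsWithin 0 (Ioi 0)) (nhds 0) := by
    have h1 : Continuous fun x => Real.sqrt (M * den x) :=
      Real.continuous_sqrt.comp (continuous_const.mul den_continuous)
    have h2 := (h1.tendsto 0).mono_left (nhdsWithin_le_nhds (s := Ioi 0))
    rw [den_zero, mul_zero, Real.sqrt_zero] at h2
    refine squeeze_zero_norm' ?_ h2
    filter_upwards [self_mem_nhdsWithin] with x hx
    refine Real.le_sqrt_of_sq_le ?_
    exact (div_le_iff₀ (den_pos hx)).1 (he x hx)
  refine ⟨half_mem hd ht (half_memLp_iff.2 hwL) (half_memLp_iff.2 (hcL.add hF)), ?_⟩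
  have iY := (memLp_two_iff_integrable_sq_norm hY.1).1 hY
  have iF := (memLp_two_iff_integrable_sq_norm hF.1).1 hF
  have i1 : ∫ x in Ioi 0, ‖w x‖ ^ 2 ≤ ∫ x in Ioi 0, ‖w x / den x‖ ^ 2 :=
    setIntegral_mono_on ((memLp_two_iff_integrable_sq_norm hwm).1 hwL) iY measurableSet_Ioi
      fun x hx => pow_le_pow_left₀ (norm_nonneg _) (hwY x hx) 2
  have i2 : ∫ x in Ioi 0, ‖(z + Real.exp (-2 * x)) / den x * w x + F x‖ ^ 2 ≤
      ∫ x in Ioi 0, (2 * (1 + ‖z‖) ^ 2 * ‖w x / den x‖ ^ 2 + 2 * ‖F x‖ ^ 2) := by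
    refine setIntegral_mono_on ((memLp_two_iff_integrable_sq_norm (hcL.add hF).1).1 (hcL.add hF))
      ((iY.const_mul _).add (iF.const_mul _)) measurableSet_Ioi fun x hx => ?_
    have h1 := pow_le_pow_left₀ (norm_nonneg _) (norm_add_le_of_le (hco x hx) (le_refl ‖F x‖)) 2
    nlinarith [sq_nonneg ((1 + ‖z‖) * ‖w x / den x‖ - ‖F x‖)]
  rw [integral_add (iY.const_mul _) (iF.const_mul _), integral_const_mul, integral_const_mul,
    hFN] at i2
  rw [sobSq_half hd]
  have h3 : 2 * (1 + ‖z‖) ^ 2 * ∫ x in Ioi 0, ‖w x / den x‖ ^ 2 ≤ 2 * (1 + ‖z‖) ^ 2 * D := by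
    gcongr
  linarith

/-- Variation of constants with `homSol` and the primitive of `exists_primitive`. The weights
`weight (Re z)` and `weight (-Re z)` cancel in the pointwise energy, which is therefore bounded on
the whole half-line. -/
theorem exists_half_solution {z : ℂ} (hz : z.re ≠ 0) : ∃ C, 0 ≤ C ∧ ∀ f ∈ H1zero, ∃ v ∈ H1zero,
    (∀ x ≤ 0, v x = 0) ∧ (∀ x < 0, HasDerivAt v 0 x) ∧
    (∀ x, 0 < x → HasDerivAt v ((z + Real.exp (-2 * x)) / den x * v x + f x / den x) x) ∧
    sobSq v ≤ C * sobSq f := by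
  -- The factor `3 / 2 / z.re ^ 2` is the energy estimate; the last factor `2` is the bound of `f /
  -- den` by `div_den_memLp`.
  refine ⟨((1 + 2 * (1 + ‖z‖) ^ 2) * (3 / 2 / z.re ^ 2) + 2) * 2, by positivity, fun f hf => ?_⟩
  obtain ⟨hF, hFle⟩ := div_den_memLp hf
  have hFc : ContinuousOn (fun x => f x / den x) (Ioi 0) :=
    (H1.continuous hf.1).continuousOn.div
      (Complex.continuous_ofReal.comp den_continuous).continuousOn fun x hx => by
        exact_mod_cast (den_pos hx).ne'
  obtain ⟨I, hI⟩ := exists_primitive hz hFc hF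
  set N := ∫ x in Ioi 0, ‖f x / den x‖ ^ 2 with hN
  set w : ℝ → ℂ := fun x => homSol z x * I x with hw
  have hd : ∀ x, 0 < x →
      HasDerivAt w ((z + Real.exp (-2 * x)) / den x * w x + f x / den x) x := by
    intro x hx
    refine ((hasDerivAt_homSol z hx).mul (hI x hx).1).congr_deriv ?_
    rw [mul_div_cancel₀ _ (homSol_ne_zero z x), hw]
    ring
  have he : ∀ x, 0 < x → ‖w x‖ ^ 2 / den x ≤ N / (2 * |z.re|) := by
    intro x hx
    have hdx := den_pos hx
    have h1 := weight_mul_neg z.re hx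
    have h2 := mul_le_mul_of_nonneg_left (hI x hx).2 (weight_pos z.re hx).le
    have h3 : ‖w x‖ ^ 2 / den x = weight z.re x * ‖I x‖ ^ 2 := by
      rw [hw, norm_mul, mul_pow, norm_homSol_sq z hx]; field_simp
    rw [h3]
    refine h2.trans_eq ?_
    calc weight z.re x * (N * (weight (-z.re) x / (2 * |z.re|)))
        = weight z.re x * weight (-z.re) x * (N / (2 * |z.re|)) := by ring
      _ = N / (2 * |z.re|) := by rw [h1, one_mul]
  obtain ⟨hY, hYD⟩ := energy_memLp hz hFc hF hd he
  obtain ⟨hmem, hle⟩ := half_solution_mem hF rfl hd he hY hYD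
  refine ⟨half w, hmem, fun x hx => half_of_nonpos w hx, fun x hx => ?_, fun x hx => ?_, ?_⟩
  · have := half_hasDerivAt hd hx.ne
    rwa [half_of_nonpos _ hx.le] at this
  · have := half_hasDerivAt hd hx.ne'
    rw [half_of_pos _ hx] at this
    rwa [half_of_pos w hx]
  · refine hle.trans ?_
    have e : (1 + 2 * (1 + ‖z‖) ^ 2) * (3 / 2 * N / z.re ^ 2) + 2 * N =
        ((1 + 2 * (1 + ‖z‖) ^ 2) * (3 / 2 / z.re ^ 2) + 2) * N := by ring
    rw [← hN, e, mul_assoc _ 2]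
    gcongr

/-- The coefficient `φ * dφ` jumps at the origin; the product is continuous there because `v`
vanishes. -/
theorem φ_mul_dφ_mul_mem {v : ℝ → ℂ} (hv : v ∈ H1zero)
    (hd : ∀ x, x ≠ 0 → HasDerivAt v (deriv v x) x) :
    (fun x => ((φ x * dφ x : ℝ) : ℂ) * v x) ∈ H1 := by
  have hvc := H1.continuous hv.1
  have hb1 : ∀ x, |φ x * dφ x| ≤ 1 := fun x => by
    rw [abs_mul, abs_of_pos (φ_pos x)]
    nlinarith [abs_dφ_le x, φ_pos x, φ_le_one x, abs_nonneg (dφ x)]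
  have hb2 : ∀ x, |dφ x ^ 2 + φ x ^ 2| ≤ 2 := fun x => by
    rw [abs_of_nonneg (by positivity), ← sq_abs (dφ x)]
    nlinarith [abs_dφ_le x, φ_pos x, φ_le_one x, abs_nonneg (dφ x)]
  have hm := φ_continuous.measurable
  have hm' := dφ_measurable
  refine H1.of_hasDerivAt (f' := fun x => ((dφ x ^ 2 + φ x ^ 2 : ℝ) : ℂ) * v x
    + ((φ x * dφ x : ℝ) : ℂ) * deriv v x) ?_ (fun x hx => ?_) ?_ ?_
  · rw [continuous_iff_continuousAt]
    intro x
    by_cases hx : x = 0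
    · subst hx
      unfold ContinuousAt
      simp only [hv.2, mul_zero]
      have h0 := hvc.norm.tendsto 0
      rw [hv.2, norm_zero] at h0
      refine squeeze_zero_norm (fun x => ?_) h0
      rw [norm_mul, Complex.norm_real, Real.norm_eq_abs]
      exact mul_le_of_le_one_left (norm_nonneg _) (hb1 x)
    · exact (Complex.continuous_ofReal.continuousAt.comp
        ((hasDerivAt_φ hx).mul (hasDerivAt_dφ hx)).continuousAt).mul (hd x hx).continuousAt
  · refine (((hasDerivAt_φ hx).mul (hasDerivAt_dφ hx)).ofReal_comp.mul (hd x hx)).congr_deriv ?_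
    simp only [Pi.mul_apply]
    push_cast; ring
  · exact memLp_mul (hm.mul hm') hb1 hv.1.1
  · exact (memLp_mul ((hm'.pow_const 2).add (hm.pow_const 2)) hb2 hv.1.1).add
      (memLp_mul (hm.mul hm') hb1 (H1.memLp_deriv hv.1))

theorem Q_three (v : ℝ → ℂ) (x : ℝ) : Q 3 v x = 0 := by
  unfold Q; push_cast; ring

theorem linRed_three (v : ℝ → ℂ) (x : ℝ) :
    linRed 3 v x = transport v x + ((φ x * dφ x : ℝ) : ℂ) * v x := by
  unfold linRed L
  rw [Q_three]; push_cast; ring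

theorem linFull_three (v : ℝ → ℂ) (x : ℝ) :
    linFull 3 v x = transport v x - (v 0 - (φ x : ℂ) * v x) * (dφ x : ℂ) := by
  unfold linFull
  rw [Q_three]; push_cast; ring

theorem exp_eq_one_sub_den (x : ℝ) : (Real.exp (-2 * x) : ℂ) = 1 - (den x : ℂ) := by
  rw [den]; push_cast; ring

/-- The resolvent equation of the Novikov case is solvable off the imaginary axis. -/
theorem exists_solution {z : ℂ} (hz : z.re ≠ 0) : ∃ C, 0 ≤ C ∧ ∀ f ∈ H1zero, ∃ v ∈ H1zero,
    transport v ∈ H1 ∧ linRed 3 v - z • v = f ∧ sobSq v ≤ C * sobSq f := by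
  obtain ⟨C₁, hC₁, h₁⟩ := exists_half_solution hz
  obtain ⟨C₂, hC₂, h₂⟩ := exists_half_solution (z := -z) (by simpa using hz)
  refine ⟨2 * (C₁ + C₂), by positivity, fun f hf => ?_⟩
  obtain ⟨v₁, m₁, n₁, l₁, r₁, s₁⟩ := h₁ f hf
  -- Reflection changes the sign of the operator, so the left half-line becomes the right one with
  -- spectral parameter `-z` and data `-refl f`.
  obtain ⟨v₂, m₂, n₂, l₂, r₂, s₂⟩ := h₂ (-refl f) (H1zero.neg_mem (refl_mem_H1zero hf))
  rw [sobSq_neg, sobSq_refl] at s₂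
  have hrv : ∀ x, refl v₂ x = v₂ (-x) := fun _ => rfl
  have hm : v₁ + refl v₂ ∈ H1zero := H1zero.add_mem m₁ (refl_mem_H1zero m₂)
  have hrefl : ∀ {x d}, HasDerivAt v₂ d (-x) → HasDerivAt (refl v₂) (-d) x := fun {x d} h => by
    have := h.scomp x (hasDerivAt_neg x)
    rwa [neg_one_smul] at this
  have hpos : ∀ x, 0 < x → HasDerivAt (v₁ + refl v₂)
      ((z + Real.exp (-2 * x)) / den x * v₁ x + f x / den x) x := fun x hx => by
    have := (r₁ x hx).add (hrefl (l₂ (-x) (by linarith)))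
    rwa [neg_zero, add_zero] at this
  have hneg : ∀ x, x < 0 → HasDerivAt (v₁ + refl v₂)
      (-((-z + Real.exp (-2 * -x)) / den (-x) * v₂ (-x) + -f x / den (-x))) x := fun x hx => by
    have h := hrefl (r₂ (-x) (by linarith))
    have := (l₁ x hx).add h
    rw [zero_add] at this
    simpa only [Pi.neg_apply, refl, neg_neg] using this
  have hderiv : ∀ x, x ≠ 0 → HasDerivAt (v₁ + refl v₂) (deriv (v₁ + refl v₂) x) x := fun x hx => by
    rcases lt_or_gt_of_ne hx with h | h
    · exact (hneg x h).differentiableAt.hasDerivAt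
    · exact (hpos x h).differentiableAt.hasDerivAt
  have heq : ∀ x, transport (v₁ + refl v₂) x =
      z * (v₁ + refl v₂) x - ((φ x * dφ x : ℝ) : ℂ) * (v₁ + refl v₂) x + f x := by
    intro x
    rcases lt_trichotomy x 0 with h | h | h
    · have h' : 0 < -x := by linarith
      have hd : (den (-x) : ℂ) ≠ 0 := by exact_mod_cast (den_pos h').ne'
      have e1 : (1 - φ x ^ 2 : ℝ) = den (-x) := by rw [← one_sub_φ_sq_of_pos h', φ_neg]
      have e2 : φ x * dφ x = 1 - den (-x) := by
        have := φ_mul_dφ_of_pos h'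
        rw [φ_neg, dφ_neg] at this
        linarith
      rw [transport, (hneg x h).deriv, e1, e2, exp_eq_one_sub_den, Pi.add_apply, n₁ x h.le, hrv]
      push_cast
      field_simp
      ring
    · subst h
      rw [transport_zero, hm.2, hf.2]; ring
    · have hd : (den x : ℂ) ≠ 0 := by exact_mod_cast (den_pos h).ne'
      rw [transport, (hpos x h).deriv, one_sub_φ_sq_of_pos h, φ_mul_dφ_of_pos h,
        exp_eq_one_sub_den, Pi.add_apply, hrv, n₂ (-x) (by linarith)]
      push_cast
      field_simp
      ring
  refine ⟨v₁ + refl v₂, hm, ?_, ?_, ?_⟩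
  · have e : transport (v₁ + refl v₂) = z • (v₁ + refl v₂) -
        (fun x => ((φ x * dφ x : ℝ) : ℂ) * (v₁ + refl v₂) x) + f := by
      funext x; rw [heq]; rfl
    rw [e]
    exact H1.add_mem (H1.sub_mem (H1.smul_mem z hm.1) (φ_mul_dφ_mul_mem hm hderiv)) hf.1
  · funext x
    rw [Pi.sub_apply, linRed_three, heq, Pi.smul_apply, smul_eq_mul]
    ring
  · refine (sobSq_add_le m₁.1 (refl_mem m₂.1)).trans ?_
    rw [sobSq_refl]
    linarith

/-! ### No eigenvalues off the imaginary axis in the Novikov case -/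

/-- The energy `e = |v|² / den` satisfies `e' = 2 Re z e / den`, so `e` times `weight (-Re z)` is
constant. By Hardy `v / den` is in `L²`, which bounds `e` on the half-line, while the weight tends
to `0` at one end. Hence the constant is `0`. -/
theorem eq_zero_on_half {z : ℂ} (hz : z.re ≠ 0) {v : ℝ → ℂ} (hv : v ∈ H1zero)
    (ht : transport v ∈ H1) (heq : linRed 3 v = z • v) {x : ℝ} (hx : 0 < x) : v x = 0 := by
  have hd : ∀ x, 0 < x → HasDerivAt v ((z + Real.exp (-2 * x)) / den x * v x + 0) x := by
    intro x hx
    refine (H1.hasDerivAt hv.1 ht hx.ne').congr_deriv ?_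
    have hdx : (den x : ℂ) ≠ 0 := by exact_mod_cast (den_pos hx).ne'
    have h := congrFun heq x
    rw [linRed_three, transport, one_sub_φ_sq_of_pos hx, φ_mul_dφ_of_pos hx, Pi.smul_apply,
      smul_eq_mul] at h
    rw [exp_eq_one_sub_den, add_zero, div_mul_eq_mul_div, eq_div_iff hdx]
    push_cast at h
    linear_combination h
  obtain ⟨hY, -⟩ := div_den_memLp hv
  have iY := (memLp_two_iff_integrable_sq_norm hY.1).1 hY
  set e : ℝ → ℝ := fun x => ‖v x‖ ^ 2 / den x with he
  have hde : ∀ x, 0 < x → HasDerivAt e (2 * z.re * ‖v x / den x‖ ^ 2) x := fun x hx => by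
    have := hasDerivAt_energy (F := fun _ => 0) hx (hd x hx)
    simpa using this
  set D := ∫ x in Ioi 0, ‖v x / den x‖ ^ 2 with hD
  have hbound : ∀ y, 0 < y → e y ≤ e x + 2 * |z.re| * D := by
    intro y hy
    have hsub : uIcc x y ⊆ Ioi 0 := fun t ht => lt_of_lt_of_le (lt_min hx hy) ht.1
    have hsub' : uIoc x y ⊆ Ioi 0 := uIoc_subset_uIcc.trans hsub
    have hI : IntervalIntegrable (fun x => 2 * z.re * ‖v x / den x‖ ^ 2) volume x y :=
      IntervalIntegrable.const_mul (intervalIntegrable_iff.2 (IntegrableOn.mono_set iY hsub')) _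
    have hFTC := intervalIntegral.integral_eq_sub_of_hasDerivAt (fun t ht => hde t (hsub ht)) hI
    have h1 := intervalIntegral.norm_integral_le_integral_norm_uIoc (μ := volume) (a := x) (b := y)
      (f := fun x => 2 * z.re * ‖v x / den x‖ ^ 2)
    rw [hFTC] at h1
    have h2 : ∫ t in uIoc x y, ‖2 * z.re * ‖v t / den t‖ ^ 2‖ ≤ 2 * |z.re| * D := by
      rw [hD, ← integral_const_mul]
      have : ∀ t, ‖2 * z.re * ‖v t / den t‖ ^ 2‖ = 2 * |z.re| * ‖v t / den t‖ ^ 2 := fun t => by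
        rw [Real.norm_eq_abs, abs_mul, abs_mul, abs_two, abs_of_nonneg (sq_nonneg ‖v t / den t‖)]
      simp only [this]
      exact setIntegral_mono_set (iY.const_mul _)
        (Filter.Eventually.of_forall fun t => by positivity) (Filter.Eventually.of_forall hsub')
    have h3 := (le_abs_self (e y - e x)).trans h1
    linarith
  have hconst : ∀ y, 0 < y → e y * weight (-z.re) y = e x * weight (-z.re) x := by
    intro y hy
    refine (convex_Ioi (0 : ℝ)).is_const_of_fderivWithin_eq_zero (𝕜 := ℝ)
      (f := fun y => e y * weight (-z.re) y) ?_ ?_ (mem_Ioi.2 hy) (mem_Ioi.2 hx)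
    all_goals
      have key : ∀ t ∈ Ioi (0 : ℝ), HasDerivAt (fun y => e y * weight (-z.re) y) 0 t := by
        intro t ht
        have ht' : 0 < t := ht
        refine ((hde t ht').mul (hasDerivAt_weight (-z.re) ht')).congr_deriv ?_
        have hdt := den_pos ht'
        rw [norm_div, Complex.norm_real, Real.norm_of_nonneg hdt.le, he]
        field_simp
        ring
    · exact fun t ht => (key t ht).differentiableAt.differentiableWithinAt
    · intro t ht
      have h1 := (key t ht).hasFDerivAt.hasFDerivWithinAt (s := Ioi 0)
      rw [h1.fderivWithin (isOpen_Ioi.uniqueDiffWithinAt ht)]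
      ext; simp
  obtain ⟨l, hl, hl0, hlt⟩ := exists_tendsto_weight (β := -z.re) (by simpa using hz)
  have hlim := hlt.const_mul (e x + 2 * |z.re| * D)
  rw [mul_zero] at hlim
  have h0 : e x * weight (-z.re) x ≤ 0 := by
    refine ge_of_tendsto hlim ?_
    filter_upwards [hl0] with y hy
    rw [← hconst y hy]
    exact mul_le_mul_of_nonneg_right (hbound y hy) (weight_pos _ hy).le
  have h1 : e x ≤ 0 := by
    by_contra! hcon
    exact absurd h0 (not_le.2 (mul_pos hcon (weight_pos _ hx)))
  have h2 : ‖v x‖ ^ 2 ≤ 0 := by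
    rw [he] at h1
    simpa using (div_le_iff₀ (den_pos hx)).1 h1
  have h3 : ‖v x‖ = 0 := by nlinarith [norm_nonneg (v x)]
  exact norm_eq_zero.1 h3

theorem eq_zero_of_eigen {z : ℂ} (hz : z.re ≠ 0) {v : ℝ → ℂ} (hv : v ∈ H1zero)
    (ht : transport v ∈ H1) (heq : linRed 3 v = z • v) : v = 0 := by
  funext x
  rcases lt_trichotomy x 0 with h | h | h
  · have heq' : linRed 3 (refl v) = (-z) • refl v := by
      rw [linRed_refl 3 hv.2, heq]
      funext y
      simp [refl]
    have := eq_zero_on_half (z := -z) (by simpa using hz) (refl_mem_H1zero hv)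
      (transport_refl_mem ht) heq' (x := -x) (by linarith)
    simpa [refl] using this
  · rw [h]; exact hv.2
  · exact eq_zero_on_half hz hv ht heq h

/-! ### The peakon itself -/

theorem denPow_one {x : ℝ} (hx : 0 < x) : denPow 1 x = den x := by
  have h := denPow_add_one 0 hx
  rw [zero_add] at h
  rw [h]; simp [denPow]

theorem transport_φ_eq (x : ℝ) :
    transport (fun x => (φ x : ℂ)) x = ((1 - φ x ^ 2 : ℝ) : ℂ) * (dφ x : ℂ) := by
  by_cases hx : x = 0
  · subst hx; simp [transport_zero, φ_zero]
  · rw [transport, ((hasDerivAt_φ hx).ofReal_comp).deriv]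

theorem transport_φ_mem : transport (fun x => (φ x : ℂ)) ∈ H1 := by
  have hm := (peakFun_mem (κ := 1) (by norm_num)).1
  -- `(1 - φ²) φ'` is odd and equals `-e^{-x} den` on the right, the peak function of exponent `1`
  -- up to sign.
  have e : transport (fun x => (φ x : ℂ)) = refl (peakFun 1) - peakFun 1 := by
    funext x
    have hp : ∀ y : ℝ, 0 < y → peakFun 1 y = (Real.exp (-y) : ℂ) * den y := fun y hy => by
      rw [peakFun, half_of_pos _ hy, denPow_one hy]
    have hr : refl (peakFun 1) x = peakFun 1 (-x) := rfl
    rw [transport_φ_eq, Pi.sub_apply, hr]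
    rcases lt_trichotomy x 0 with h | h | h
    · have h' : 0 < -x := by linarith
      have e1 : (1 - φ x ^ 2 : ℝ) = den (-x) := by rw [← one_sub_φ_sq_of_pos h', φ_neg]
      have e2 : dφ x = Real.exp (- -x) := by
        rw [← neg_neg (dφ x), ← dφ_neg, dφ_of_pos h', neg_neg]
      rw [hp _ h', e1, e2, peakFun, half_of_nonpos _ h.le]; ring
    · subst h
      rw [neg_zero, dφ_zero]; simp
    · rw [hp x h, one_sub_φ_sq_of_pos h, dφ_of_pos h, peakFun, half_of_nonpos _ (by linarith)]
      push_cast; ring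
  rw [e]
  exact H1.sub_mem (refl_mem hm) hm

theorem linFull_three_φ : linFull 3 (fun x => (φ x : ℂ)) = 0 := by
  funext x
  rw [linFull_three, transport_φ_eq, φ_zero, Pi.zero_apply]
  push_cast; ring

/-- The trace at the peak is bounded by comparing `f 0` with `f x` through Cauchy-Schwarz and
averaging over `x` in `(0, 1]`. -/
theorem norm_zero_sq_le {f : ℝ → ℂ} (hf : f ∈ H1) : ‖f 0‖ ^ 2 ≤ 2 * sobSq f := by
  have hm := H1.memLp_deriv hf
  have hfi := integrable_sq hf.1
  have hdi := integrable_sq hm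
  have hpt : ∀ x ∈ Ioc (0 : ℝ) 1, ‖f 0‖ ^ 2 ≤ 2 * ‖f x‖ ^ 2 + 2 * ∫ y, ‖deriv f y‖ ^ 2 := by
    intro x hx
    have h1 : ∫ y in Ioc 0 x, deriv f y = f x - f 0 := by
      obtain ⟨-, g, -, hg⟩ := hf
      rw [← hg.2, ← intervalIntegral.integral_of_le hx.1.le]
      exact intervalIntegral.integral_congr_ae ((H1.deriv_ae hg).mono fun t ht _ => ht)
    have h2 := norm_integral_mul_sq_le (μ := volume.restrict (Ioc 0 x)) (f := fun _ => 1)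
      (memLp_const 1) (hm.restrict _)
    simp only [one_mul, norm_one, one_pow, h1] at h2
    have h3 : ∫ _ in Ioc 0 x, (1 : ℝ) = x := by simp [hx.1.le]
    have h4 : ∫ y in Ioc 0 x, ‖deriv f y‖ ^ 2 ≤ ∫ y, ‖deriv f y‖ ^ 2 :=
      setIntegral_le_integral hdi (Filter.Eventually.of_forall fun y => by positivity)
    rw [h3] at h2
    have h5 : ‖f x - f 0‖ ^ 2 ≤ ∫ y, ‖deriv f y‖ ^ 2 :=
      h2.trans ((mul_le_of_le_one_left (by positivity) hx.2).trans h4)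
    have h6 : ‖f 0‖ ≤ ‖f x‖ + ‖f x - f 0‖ := by
      have := norm_sub_le (f x) (f x - f 0)
      simpa using this
    have h7 := pow_le_pow_left₀ (norm_nonneg _) h6 2
    nlinarith [sq_nonneg (‖f x‖ - ‖f x - f 0‖)]
  have hi : IntegrableOn (fun x => 2 * ‖f x‖ ^ 2 + 2 * ∫ y, ‖deriv f y‖ ^ 2) (Ioc 0 1) :=
    (hfi.integrableOn.const_mul 2).add (integrableOn_const (by simp))
  have h := setIntegral_mono_on (integrableOn_const (by simp)) hi measurableSet_Ioc hpt
  rw [integral_add (hfi.integrableOn.const_mul 2) (integrableOn_const (by simp)),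
    integral_const_mul] at h
  have h8 : ∫ x in Ioc (0 : ℝ) 1, ‖f x‖ ^ 2 ≤ ∫ x, ‖f x‖ ^ 2 :=
    setIntegral_le_integral hfi (Filter.Eventually.of_forall fun y => by positivity)
  simp at h
  unfold sobSq
  linarith

/-! ### The spectra -/

/-- Injectivity identifies every domain element with the solution constructed from its image, so the
estimate for one solution is the bound on the inverse. -/
theorem inResolventSet_of_solution {X : Submodule ℂ (ℝ → ℂ)} {T : X →ₗ.[ℂ] X} {z : ℂ} {C : ℝ}
    (hinj : ∀ v : T.domain, T v = z • (v : X) → v = 0)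
    (hsol : ∀ f : X, ∃ v : T.domain, T v - z • (v : X) = f ∧
      sobSq ((v : X) : ℝ → ℂ) ≤ C * sobSq (f : ℝ → ℂ)) : InResolventSet T z := by
  have hi : Function.Injective fun v : T.domain => T v - z • (v : X) := by
    intro v w hvw
    refine sub_eq_zero.1 (hinj (v - w) ?_)
    have hvw' : T v - z • (v : X) = T w - z • (w : X) := hvw
    rw [LinearPMap.map_sub, Submodule.coe_sub, smul_sub, sub_eq_sub_iff_sub_eq_sub]
    exact hvw'
  refine ⟨⟨hi, fun f => ?_⟩, Real.sqrt |C|, fun v => ?_⟩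
  · obtain ⟨v, hv, -⟩ := hsol f
    exact ⟨v, hv⟩
  · obtain ⟨w, hw, hle⟩ := hsol (T v - z • (v : X))
    have : w = v := hi hw
    subst this
    have h1 : ∀ g : ℝ → ℂ, h1Norm g = Real.sqrt (sobSq g) := fun _ => rfl
    rw [h1, h1, ← Real.sqrt_mul (abs_nonneg C)]
    refine Real.sqrt_le_sqrt (hle.trans ?_)
    exact mul_le_mul_of_nonneg_right (le_abs_self C) (sobSq_nonneg _)

theorem opRed_three_inResolventSet {z : ℂ} (hz : z.re ≠ 0) : InResolventSet (opRed 3) z := by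
  obtain ⟨C, -, hC⟩ := exists_solution hz
  refine inResolventSet_of_solution (C := C) (fun v hv => ?_) fun f => ?_
  · have h : linRed 3 ((v : H1zero) : ℝ → ℂ) = z • ((v : H1zero) : ℝ → ℂ) :=
      congrArg Subtype.val hv
    exact Subtype.ext (Subtype.ext (eq_zero_of_eigen hz (v : H1zero).2 v.2.1 h))
  · obtain ⟨v, hv, hvt, he, hle⟩ := hC f f.2
    exact ⟨⟨⟨v, hv⟩, hvt, transport_zero v⟩, Subtype.ext he, hle⟩

theorem linRed_three_eq_linFull {v : ℝ → ℂ} (h0 : v 0 = 0) : linRed 3 v = linFull 3 v := by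
  funext x
  rw [linRed_eq 3 h0]; push_cast; ring

/-- Writes `H¹` as the functions vanishing at `0` plus the multiples of `φ`. On the first part the
full and reduced operators agree, on the second the full operator is zero. The trace bound
`norm_zero_sq_le` makes the splitting bounded. -/
theorem opFull_three_inResolventSet {z : ℂ} (hz : z.re ≠ 0) : InResolventSet (opFull 3) z := by
  have hz0 : z ≠ 0 := fun h => hz (by rw [h]; rfl)
  obtain ⟨C, hC0, hC⟩ := exists_solution hz
  set P := sobSq (fun x => (φ x : ℂ)) with hP
  have hP0 : 0 ≤ P := sobSq_nonneg _
  refine inResolventSet_of_solution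
    (C := 2 * (C * (2 * (1 + 2 * P)) + 2 / ‖z‖ ^ 2 * P)) (fun v hv => ?_) fun f => ?_
  · have h : linFull 3 (v : H1).1 = z • (v : H1).1 := congrArg Subtype.val hv
    -- At the peak the Novikov operator has value `0`, so the eigenvalue equation reads `z v(0) =
    -- 0`.
    have h0 : (v : H1).1 0 = 0 := by
      have h1 := congrFun h 0
      rw [linFull_three, transport_zero, dφ_zero] at h1
      simpa [hz0] using h1
    have hm : (v : H1).1 ∈ H1zero := ⟨(v : H1).2, h0⟩
    refine Subtype.ext (Subtype.ext (eq_zero_of_eigen hz hm v.2 ?_))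
    rw [linRed_three_eq_linFull h0]; exact h
  · have hf := f.2
    have hfm : (f : ℝ → ℂ) + (-(f : ℝ → ℂ) 0) • (fun x => (φ x : ℂ)) ∈ H1zero :=
      ⟨H1.add_mem hf (H1.smul_mem _ φ_mem), by simp [φ_zero]⟩
    obtain ⟨v, hv, hvt, he, hle⟩ := hC _ hfm
    -- Since `φ` is in the kernel, `(A - z)(c φ) = -z c φ`, and this must equal `f(0) φ`.
    set c : ℂ := -(f : ℝ → ℂ) 0 / z with hc
    have hct : transport (c • fun x => (φ x : ℂ)) ∈ H1 := by
      rw [transport_smul]; exact H1.smul_mem c transport_φ_mem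
    have hcm : (c • fun x => (φ x : ℂ)) ∈ H1 := H1.smul_mem c φ_mem
    have hmem : v + c • (fun x => (φ x : ℂ)) ∈ H1 := H1.add_mem hv.1 hcm
    have htr : transport (v + c • fun x => (φ x : ℂ)) ∈ H1 := by
      rw [transport_add hv.1 hvt hcm hct]; exact H1.add_mem hvt hct
    refine ⟨⟨⟨_, hmem⟩, htr⟩, Subtype.ext ?_, ?_⟩
    · change linFull 3 (v + c • fun x => (φ x : ℂ)) - z • (v + c • fun x => (φ x : ℂ)) = f
      rw [linFull_add 3 hv.1 hvt hcm hct, linFull_smul, linFull_three_φ,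
        ← linRed_three_eq_linFull hv.2]
      funext x
      have h1 := congrFun he x
      have h2 : z * c = -(f : ℝ → ℂ) 0 := by rw [hc]; field_simp
      simp only [Pi.sub_apply, Pi.add_apply, Pi.smul_apply, smul_eq_mul, Pi.zero_apply] at h1 ⊢
      linear_combination h1 - (φ x : ℂ) * h2
    · have h0 := norm_zero_sq_le hf
      have h1 := sobSq_add_le hv.1 hcm
      have h2 := sobSq_add_le hf (H1.smul_mem (-(f : ℝ → ℂ) 0) φ_mem)
      rw [sobSq_smul, norm_neg] at h2
      rw [sobSq_smul, hc, norm_div, norm_neg, div_pow] at h1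
      have hz2 : 0 < ‖z‖ ^ 2 := by have := norm_pos_iff.2 hz0; positivity
      have h3 : ‖(f : ℝ → ℂ) 0‖ ^ 2 * P ≤ 2 * sobSq (f : ℝ → ℂ) * P := by gcongr
      have h4 : ‖(f : ℝ → ℂ) 0‖ ^ 2 / ‖z‖ ^ 2 * P ≤ 2 * sobSq (f : ℝ → ℂ) / ‖z‖ ^ 2 * P := by
        gcongr
      have h5 : sobSq v ≤ C * (2 * (sobSq (f : ℝ → ℂ) + 2 * sobSq (f : ℝ → ℂ) * P)) :=
        hle.trans (mul_le_mul_of_nonneg_left (h2.trans (by linarith)) hC0)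
      refine h1.trans ?_
      calc 2 * (sobSq v + ‖(f : ℝ → ℂ) 0‖ ^ 2 / ‖z‖ ^ 2 * P)
          ≤ 2 * (C * (2 * (sobSq (f : ℝ → ℂ) + 2 * sobSq (f : ℝ → ℂ) * P)) +
            2 * sobSq (f : ℝ → ℂ) / ‖z‖ ^ 2 * P) := by linarith
        _ = _ := by ring

theorem mem_spec_opRed {b : ℝ} {z : ℂ} (h : HasApproxEigenfunctions (linRed b) z) :
    z ∈ spec (opRed b) := by
  rintro ⟨-, C, hC⟩
  obtain ⟨v, hv, hvt, hlt⟩ := h.not_bounded C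
  exact absurd (hC ⟨⟨v, hv⟩, hvt, transport_zero v⟩) (not_le.2 hlt)

theorem mem_spec_opFull {b : ℝ} {z : ℂ} (h : HasApproxEigenfunctions (linFull b) z) :
    z ∈ spec (opFull b) := by
  rintro ⟨-, C, hC⟩
  obtain ⟨v, hv, hvt, hlt⟩ := h.not_bounded C
  exact absurd (hC ⟨⟨v, hv.1⟩, hvt⟩) (not_le.2 hlt)

/-- The real points `b - 3` and `3 - b` of the two critical lines already suffice for instability.
-/
theorem eq_three_of_spec {S : Set ℂ} {b : ℝ} (hS : ∀ z ∈ S, z.re ≤ 0)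
    (h1 : (b : ℂ) - 3 + (0 : ℝ) * Complex.I ∈ S)
    (h2 : -((b : ℂ) - 3 + (0 : ℝ) * Complex.I) ∈ S) : b = 3 := by
  have e1 := hS _ h1
  have e2 := hS _ h2
  simp at e1 e2
  linarith

theorem eq_imaginary_axis {S : Set ℂ}
    (h1 : ∀ τ : ℝ, ((3 : ℝ) : ℂ) - 3 + τ * Complex.I ∈ S) (h2 : ∀ z : ℂ, z.re ≠ 0 → z ∉ S) :
    S = {z : ℂ | z.re = 0} := by
  ext z
  refine ⟨fun hz => by_contra fun h => h2 z h hz, fun hz => ?_⟩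
  have hz' : z.re = 0 := hz
  have e : z = ((3 : ℝ) : ℂ) - 3 + z.im * Complex.I := by
    apply Complex.ext <;> simp [hz']
  rw [e]; exact h1 _

theorem spec_opRed_three : spec (opRed 3) = {z : ℂ | z.re = 0} :=
  eq_imaginary_axis (fun τ => mem_spec_opRed (hasApproxEigenfunctions_linRed 3 τ))
    fun _ hz h => h (opRed_three_inResolventSet hz)

theorem spec_opFull_three : spec (opFull 3) = {z : ℂ | z.re = 0} :=
  eq_imaginary_axis (fun τ => mem_spec_opFull (hasApproxEigenfunctions_linFull 3 τ))
    fun _ hz h => h (opFull_three_inResolventSet hz)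

theorem spectrallyStable_opRed_iff (b : ℝ) : SpectrallyStable (opRed b) ↔ b = 3 := by
  refine ⟨fun h => ?_, fun h => ?_⟩
  · have ha := hasApproxEigenfunctions_linRed b 0
    exact eq_three_of_spec h (mem_spec_opRed ha)
      (mem_spec_opRed (ha.neg fun v hv => linRed_refl b hv.2))
  · subst h
    intro z hz
    rw [spec_opRed_three] at hz
    exact le_of_eq hz

theorem spectrallyStable_opFull_iff (b : ℝ) : SpectrallyStable (opFull b) ↔ b = 3 := by
  refine ⟨fun h => ?_, fun h => ?_⟩
  · have ha := hasApproxEigenfunctions_linFull b 0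
    exact eq_three_of_spec h (mem_spec_opFull ha)
      (mem_spec_opFull (ha.neg fun v _ => linFull_refl b v))
  · subst h
    intro z hz
    rw [spec_opFull_three] at hz
    exact le_of_eq hz

end

end BNovikov

theorem mainTheorem8 (b : ℝ) :
    (BNovikov.SpectrallyStable (BNovikov.opRed b) ↔ b = 3) ∧
    (BNovikov.SpectrallyStable (BNovikov.opFull b) ↔ b = 3) ∧
    (b = 3 →
      BNovikov.spec (BNovikov.opRed b) = {z : ℂ | z.re = 0} ∧
      BNovikov.spec (BNovikov.opFull b) = {z : ℂ | z.re = 0}) := by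
  refine ⟨BNovikov.spectrallyStable_opRed_iff b, BNovikov.spectrallyStable_opFull_iff b, ?_⟩
  rintro rfl
  exact ⟨BNovikov.spec_opRed_three, BNovikov.spec_opFull_three⟩
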